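/- **Setting.** Let $V:\mathbb R\to\mathbb R$ be lower semicontinuous with $\frac{V(x)}2-\log|x|\to+\infty$ as $|x|\to\infty$, and let $$\mathcal F(\mu)=\iint_{\mathbb R\times\mathbb R}-\log|x-y|\,d\mu(x)\,d\mu(y)+\int_{\mathbb R}V\,d\mu$$ for probability measures $\mu$ on $\mathbb R$ (with $\mathcal F(\mu)=+\infty$ if $\int V\,d\mu=+\infty$). Let $\mu_0$ be the minimizer of $\mathcal F$ among probability measures (the equilibrium measure) and $\Sigma$ its support. Assume that: - $\mu_0$ has a density $m_0\in C^{0,1/2}(\mathbb R)$ with respect to Lebesgue measure; - $\Sigma$ is a finite union of compact intervals; - there are $\gamma,\overline m>0$ with $\gamma\sqrt{\mathrm{dist}(x,\mathbb R\setminus\Sigma)}\le m_0(x)\le\overline m$ for all $x\in\mathbb R$; - $\int_{\mathbb R\setminus[-1,1]}e^{-\beta_1(V(x)/2-\log|x|)}\,dx<+\infty$ for some $\beta_1>0$. Let $U^{\mu_0}(x)=-\int\log|x-y|\,d\mu_0(y)$. "Quasi-everywhere" means outside a set of zero (inner) logarithmic capacity. For $n\ge1$ and $x_1,\dots,x_n\in\mathbb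 R$ let $$w_n(x_1,\dots,x_n)=-\sum_{i\ne j}\log|x_i-x_j|+n\sum_{i=1}^nV(x_i)\in(-\infty,+\infty]$$ (the first sum is over ordered pairs, and $-\log 0=+\infty$), put $x_i'=nx_i$, and define on $\mathbb R^2$, where $\mathbb R$ is identified with $\mathbb R\times\{0\}$, $$H_n'=-2\pi\Delta^{-1}\Big(\sum_{i=1}^n\delta_{x_i'}-m_0(\cdot/n)\,\delta_{\mathbb R}\Big),$$ where $\Delta^{-1}$ is convolution with $\frac1{2\pi}\log|\cdot|$ in $\mathbb R^2$ and $\delta_{\mathbb R}$ is the length measure on $\mathbb R\times\{0\}$. For the set $\Lambda=\{x_1',\dots,x_n'\}$ of charges let $$W(\nabla H_n',\mathbf 1_{\mathbb R^2})=\lim_{\eta\to0^+}\Big(\frac12\int_{\mathbb R^2\setminus\bigcup_{p\in\Lambda}B(p,\eta)}|\nabla H_n'|^2+\pi\log\eta\;\#\Lambda\Big).$$ **Lemma (splitting formula).** There is a unique constant $c\in\mathbb R$ such that $U^{\mu_0}+\frac V2=c$ quasi-everywhere in $\Sigma$ and $U^{\mu_0}+\frac V2\ge c$ quasi-everywhere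 in $\mathbb R$. With this $c$ and $\zeta=U^{\mu_0}+\frac V2-c$, for every $n\ge1$ and all $x_1,\dots,x_n\in\mathbb R$ the limit defining $W(\nabla H_n',\mathbf 1_{\mathbb R^2})$ exists in $[-\infty,+\infty]$ and $$w_n(x_1,\dots,x_n)=n^2\mathcal F(\mu_0)-n\log n+\frac1\pi W(\nabla H_n',\mathbf 1_{\mathbb R^2})+2n\sum_{i=1}^n\zeta(x_i)$$ as an identity in $[-\infty,+\infty]$ (both sides being $+\infty$ when two of the points coincide). -/

import Mathlib

open MeasureTheory Filter Topology

noncomputable section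

namespace LogGas

/-- The integral of an extended-real function, `∫ f⁺ - ∫ f⁻`, with values in `[-∞, +∞]`.  It is the
usual integral as soon as one of the two parts is finite. -/
def eintegral {α : Type*} [MeasurableSpace α] (μ : Measure α) (f : α → EReal) : EReal :=
  ((∫⁻ a, (f a).toENNReal ∂μ : ENNReal) : EReal) - ((∫⁻ a, (-f a).toENNReal ∂μ : ENNReal) : EReal)

/-- The logarithmic kernel `-log |x - y|`, equal to `+∞` when `x = y`. -/
def logKernel (x y : ℝ) : EReal :=
  -ENNReal.log (edist x y)

/-- The Hamiltonian
`w_n (x_1, …, x_n) = - ∑_{i ≠ j} log |x_i - x_j| + n ∑_i V (x_i)` (a sum over ordered pairs),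
equal to `+∞` when two of the points coincide. -/
def hamiltonian (V : ℝ → ℝ) (n : ℕ) (x : Fin n → ℝ) : EReal :=
  (∑ i, ∑ j ∈ Finset.univ.erase i, logKernel (x i) (x j)) + ((n * ∑ i, V (x i) : ℝ) : EReal)

/-- The logarithmic energy `∬ - log |x - y| dμ(x) dμ(y)`. -/
def logEnergy (μ : Measure ℝ) : EReal :=
  eintegral (μ.prod μ) (fun p => logKernel p.1 p.2)

open Classical in
/-- The mean-field energy `F(μ) = ∬ - log |x - y| dμ(x) dμ(y) + ∫ V dμ`, with the convention
`F(μ) = +∞` if `∫ V dμ = +∞`.  (If `V / 2 - log |x| → +∞` at infinity, `V` is bounded below and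
`∫ V dμ < +∞`, then the double integral is well defined in `(-∞, +∞]`.) -/
def meanFieldEnergy (V : ℝ → ℝ) (μ : Measure ℝ) : EReal :=
  if ∫⁻ x, ENNReal.ofReal (V x) ∂μ = ⊤ then ⊤
  else logEnergy μ + eintegral μ (fun x => (V x : EReal))

/-- `μ₀` minimizes the mean-field energy among the probability measures on `ℝ`. -/
def IsEquilibriumMeasure (V : ℝ → ℝ) (μ₀ : Measure ℝ) : Prop :=
  IsProbabilityMeasure μ₀ ∧
    ∀ μ : Measure ℝ, IsProbabilityMeasure μ → meanFieldEnergy V μ₀ ≤ meanFieldEnergy V μ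

/-- A set of zero (inner) logarithmic capacity: it carries no compactly supported probability
measure of finite logarithmic energy. -/
def HasZeroCapacity (A : Set ℝ) : Prop :=
  ∀ μ : Measure ℝ, IsProbabilityMeasure μ → ∀ K : Set ℝ, IsCompact K → K ⊆ A → μ Kᶜ = 0 →
    logEnergy μ = ⊤

/-- The property `P` holds quasi-everywhere in the set `A`. -/
def QuasiEverywhereIn (A : Set ℝ) (P : ℝ → Prop) : Prop :=
  HasZeroCapacity {x | x ∈ A ∧ ¬ P x}

/-- The logarithmic potential `U^μ (x) = - ∫ log |x - y| dμ(y)`. -/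
def logPotential (μ : Measure ℝ) (x : ℝ) : ℝ :=
  -∫ y, Real.log |x - y| ∂μ

/-- `c` is the constant of the Euler–Lagrange conditions for `μ`: `U^μ + V / 2 = c`
quasi-everywhere in the support of `μ`, and `U^μ + V / 2 ≥ c` quasi-everywhere. -/
def IsEquilibriumConstant (V : ℝ → ℝ) (μ : Measure ℝ) (c : ℝ) : Prop :=
  QuasiEverywhereIn μ.support (fun x => logPotential μ x + V x / 2 = c) ∧
    QuasiEverywhereIn Set.univ (fun x => c ≤ logPotential μ x + V x / 2)

/-- `ζ = U^μ + V / 2 - c`. -/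
def zeta (V : ℝ → ℝ) (μ : Measure ℝ) (c : ℝ) (x : ℝ) : ℝ :=
  logPotential μ x + V x / 2 - c

/-- The plane, with its Euclidean norm and Lebesgue measure. -/
abbrev Plane : Type := EuclideanSpace ℝ (Fin 2)

/-- The embedding `x ↦ (x, 0)` of the real line in the plane. -/
def onLine (x : ℝ) : Plane := !₂[x, 0]

/-- The operator `Δ⁻¹` on positive measures of the plane: convolution with
`(1 / 2π) log |·|`. -/
def invLaplacian (μ : Measure Plane) (z : Plane) : ℝ :=
  1 / (2 * Real.pi) * ∫ y, Real.log ‖z - y‖ ∂μ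

/-- The measure `m δ_ℝ` on the plane: `∫ φ d(m δ_ℝ) = ∫ φ(x, 0) m(x) dx`, for a nonnegative
density `m` on the line. -/
def lineMeasure (m : ℝ → ℝ) : Measure Plane :=
  (volume.withDensity (fun t => ENNReal.ofReal (m t))).map onLine

/-- The blown-up potential
`H_n' = - 2π Δ⁻¹ (∑_i δ_{x_i'} - m₀(x' / n) δ_ℝ)` with `x_i' = n x_i`. -/
def blownUpPotential (m₀ : ℝ → ℝ) (n : ℕ) (x : Fin n → ℝ) (z : Plane) : ℝ :=
  -(2 * Real.pi) * (invLaplacian (∑ i, Measure.dirac (onLine (n * x i))) z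
    - invLaplacian (lineMeasure (fun t => m₀ (t / n))) z)

/-- `½ ∫_{ℝ² ∖ ⋃_{p ∈ Λ} B(p, η)} χ̄ |E|² + π log η ∑_{p ∈ Λ} χ(p)`, where
`χ̄ (x, y) = χ(x)`, for a finite set `Λ` of points of the real line. -/
def truncatedEnergy (E : Plane → Plane) (Λ : Finset ℝ) (χ : ℝ → ℝ) (η : ℝ) : EReal :=
  ((1 / 2 : ℝ) : EReal) *
      eintegral (volume.restrict (⋃ p ∈ Λ, Metric.ball (onLine p) η)ᶜ)
        (fun z => ((χ (z 0) * ‖E z‖ ^ 2 : ℝ) : EReal))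
    + ((Real.pi * Real.log η * ∑ p ∈ Λ, χ p : ℝ) : EReal)

/-- `W(E, χ)` exists in `[-∞, +∞]` and equals `w`: it is the limit of the truncated energies as
`η → 0⁺`, where `Λ` is the set of point charges of `E`. -/
def HasRenormalizedEnergy (E : Plane → Plane) (Λ : Finset ℝ) (χ : ℝ → ℝ) (w : EReal) : Prop :=
  Tendsto (truncatedEnergy E Λ χ) (𝓝[>] 0) (𝓝 w)

end LogGas

end

namespace LogGas

/-! ### Extended-real integrals and the logarithmic kernel -/

/-! Since the support of `μ₀` is compact and `m₀` is continuous and bounded, every logarithmic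
integral against `μ₀` converges absolutely and `U^{μ₀}` is continuous.

The Euler–Lagrange part is the first-order condition for the minimum. Along `(1 - t) μ₀ + t ν` the
energy is a quadratic polynomial in `t`, and its derivative at `0` gives `∫ (U^{μ₀} + V/2) dν ≥ c`,
with `c` the `μ₀`-mean of `U^{μ₀} + V/2` (`IsEquilibriumMeasure.variation`). Hence no compactly
supported `ν` of finite energy lives on `{U^{μ₀} + V/2 < c}`. A measurable set of zero capacity is
Lebesgue-null, so `U^{μ₀} + V/2 = c` holds `μ₀`-a.e., and lower semicontinuity excludes values above
`c` on the whole support.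

For the splitting formula, `|∇H_n'|` is the modulus of `∑ 1/(z - p) - ∫ dM(t)/(z - t)`, where `M` is
the blown-up background. Its energy is first computed on the strips `δ < |Im z| < 1/δ`. There `Re
((z - s)⁻¹ conj (z - t)⁻¹)` has an explicit integral, `integral_strip_pairKernel`, which takes the
place of Green's formula. Neutrality removes the contribution of large `|Im z|`, and `δ → 0` leaves
the logarithmic energies and a divergence carried by the self-interactions
(`tendsto_integral_strip`).

Passing from strips to the discs in the definition of `W` uses the density `|E|² - ∑ k_p² 1_{B(p,R)}
|z - p|⁻²`, which is integrable on the whole plane. Its integral is the limit along either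
exhaustion, so the two truncations differ only through the explicit integrals of the disc kernel
(`setIntegral_compl_ball_discKernel`, `setIntegral_strip_discKernel`). This identifies `W` with `π`
times the discrete energy of the blown-up system (`integral_regularDensity_one`). Scaling by `n` and
the value of `c` turn this into the formula.

If points coincide, charges with multiplicities `k_p` have `∑ k_p² > #Λ`. The counterterm `π #Λ log
η` is then too weak, and `W = +∞`, as is `w_n`. -/

lemma eintegral_eq_coe {α : Type*} [MeasurableSpace α] {μ : Measure α} {f : α → EReal} {g : α → ℝ}
    (hg : Integrable g μ) (h : f =ᵐ[μ] fun a => (g a : EReal)) :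
    eintegral μ f = ((∫ a, g a ∂μ : ℝ) : EReal) := by
  have h1 : ∫⁻ a, (f a).toENNReal ∂μ = ∫⁻ a, ENNReal.ofReal (g a) ∂μ := by
    refine lintegral_congr_ae ?_
    filter_upwards [h] with a ha
    rw [ha, EReal.real_coe_toENNReal]
  have h2 : ∫⁻ a, (-f a).toENNReal ∂μ = ∫⁻ a, ENNReal.ofReal (-g a) ∂μ := by
    refine lintegral_congr_ae ?_
    filter_upwards [h] with a ha
    rw [ha, ← EReal.coe_neg, EReal.real_coe_toENNReal]
  have f1 : ∫⁻ a, ENNReal.ofReal (g a) ∂μ ≠ ⊤ := hg.lintegral_lt_top.ne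
  have f2 : ∫⁻ a, ENNReal.ofReal (-g a) ∂μ ≠ ⊤ := hg.neg.lintegral_lt_top.ne
  rw [eintegral, h1, h2, integral_eq_lintegral_pos_part_sub_lintegral_neg_part hg, EReal.coe_sub]
  rw [EReal.coe_ennreal_toReal f1, EReal.coe_ennreal_toReal f2]

lemma logKernel_self (x : ℝ) : logKernel x x = ⊤ := by
  simp [logKernel]

lemma logKernel_of_ne {x y : ℝ} (h : x ≠ y) :
    logKernel x y = ((-Real.log |x - y| : ℝ) : EReal) := by
  have : 0 < |x - y| := abs_pos.2 (sub_ne_zero.2 h)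
  rw [logKernel, edist_dist, Real.dist_eq, ENNReal.log_ofReal_of_pos this, EReal.coe_neg]

lemma logKernel_ne_bot (x y : ℝ) : logKernel x y ≠ ⊥ := by
  by_cases h : x = y
  · rw [h, logKernel_self]; simp
  · rw [logKernel_of_ne h]; exact EReal.coe_ne_bot _

lemma measurable_log_abs_sub : Measurable fun p : ℝ × ℝ => Real.log |p.1 - p.2| :=
  Real.measurable_log.comp (measurable_fst.sub measurable_snd).abs

lemma measurable_logKernel : Measurable fun p : ℝ × ℝ => logKernel p.1 p.2 :=
  (ENNReal.measurable_log.comp (measurable_fst.edist measurable_snd)).neg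

lemma logEnergy_eq_coe {μ : Measure ℝ}
    (hint : Integrable (fun p : ℝ × ℝ => Real.log |p.1 - p.2|) (μ.prod μ))
    (hd : ∀ᵐ p ∂μ.prod μ, p.1 ≠ p.2) :
    logEnergy μ = ((∫ p, -Real.log |p.1 - p.2| ∂μ.prod μ : ℝ) : EReal) := by
  refine eintegral_eq_coe hint.neg ?_
  filter_upwards [hd] with p hp
  exact logKernel_of_ne hp

/-- A finite measure of bounded support and finite logarithmic energy does not charge the diagonal,
and its logarithmic energy is an absolutely convergent integral. -/
lemma integrable_log_of_logEnergy_ne_top {μ : Measure ℝ} [IsFiniteMeasure μ] {L : ℝ}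
    (hL : ∀ᵐ t ∂μ, |t| ≤ L) (h : logEnergy μ ≠ ⊤) :
    Integrable (fun p : ℝ × ℝ => Real.log |p.1 - p.2|) (μ.prod μ) ∧
      ∀ᵐ p ∂μ.prod μ, p.1 ≠ p.2 := by
  have hL2 : ∀ᵐ p ∂μ.prod μ, |p.1| ≤ L ∧ |p.2| ≤ L :=
    (Measure.quasiMeasurePreserving_fst.ae hL).and (Measure.quasiMeasurePreserving_snd.ae hL)
  -- By `log u ≤ u - 1` the negative part of the kernel is bounded on a bounded support. Finite
  -- energy therefore forces the positive part to be integrable, so the kernel is a.e. finite, which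
  -- excludes the diagonal.
  have hneg : ∀ᵐ p ∂μ.prod μ, (-logKernel p.1 p.2).toENNReal ≤ ENNReal.ofReal (2 * L) := by
    filter_upwards [hL2] with p hp
    by_cases e : p.1 = p.2
    · rw [e, logKernel_self]; simp
    · rw [logKernel_of_ne e, ← EReal.coe_neg, EReal.real_coe_toENNReal, neg_neg]
      refine ENNReal.ofReal_le_ofReal ?_
      have h1 : |p.1 - p.2| ≤ 2 * L := (abs_sub _ _).trans (by linarith [hp.1, hp.2])
      have h2 : 0 < |p.1 - p.2| := abs_pos.2 (sub_ne_zero.2 e)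
      linarith [Real.log_le_sub_one_of_pos h2]
  have hnegfin : ∫⁻ p, (-logKernel p.1 p.2).toENNReal ∂μ.prod μ ≠ ⊤ := by
    refine ne_top_of_le_ne_top ?_ (lintegral_mono_ae hneg)
    rw [lintegral_const]
    exact ENNReal.mul_ne_top ENNReal.ofReal_ne_top (measure_ne_top _ _)
  have hpos : ∫⁻ p, (logKernel p.1 p.2).toENNReal ∂μ.prod μ ≠ ⊤ := by
    intro htop
    apply h
    rw [logEnergy, eintegral, htop, EReal.coe_ennreal_top, sub_eq_add_neg]
    apply EReal.top_add_of_ne_bot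
    rw [Ne, EReal.neg_eq_bot_iff]
    simpa using hnegfin
  have hmeas : Measurable fun p : ℝ × ℝ => (logKernel p.1 p.2).toENNReal :=
    measurable_logKernel.ereal_toENNReal
  have hd : ∀ᵐ p ∂μ.prod μ, p.1 ≠ p.2 := by
    filter_upwards [ae_lt_top hmeas hpos] with p hp e
    rw [e, logKernel_self] at hp
    simp at hp
  refine ⟨⟨measurable_log_abs_sub.aestronglyMeasurable, ?_⟩, hd⟩
  rw [hasFiniteIntegral_iff_norm]
  refine lt_of_le_of_lt (lintegral_mono_ae (g := fun p => (logKernel p.1 p.2).toENNReal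
    + (-logKernel p.1 p.2).toENNReal) ?_) ?_
  · filter_upwards [hd] with p hp
    rw [logKernel_of_ne hp, ← EReal.coe_neg, EReal.real_coe_toENNReal, EReal.real_coe_toENNReal,
      neg_neg, Real.norm_eq_abs]
    rcases le_total 0 (Real.log |p.1 - p.2|) with hs | hs
    · rw [abs_of_nonneg hs]; exact le_add_self
    · rw [abs_of_nonpos hs]; exact le_self_add
  · rw [lintegral_add_left hmeas]
    exact ENNReal.add_lt_top.2 ⟨hpos.lt_top, hnegfin.lt_top⟩

/-! ### Measures of bounded density and bounded support -/

/-- `μ` has a density bounded by `C` and is concentrated on `[-L, L]`. -/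
structure BoundedDensity (μ : Measure ℝ) (C : NNReal) (L : ℝ) : Prop where
  le : μ ≤ C • volume
  bdd : ∀ᵐ t ∂μ, |t| ≤ L

lemma BoundedDensity.absolutelyContinuous {μ : Measure ℝ} {C : NNReal} {L : ℝ}
    (h : BoundedDensity μ C L) : μ ≪ volume :=
  (Measure.absolutelyContinuous_of_le h.le).trans Measure.smul_absolutelyContinuous

lemma BoundedDensity.noAtoms {μ : Measure ℝ} {C : NNReal} {L : ℝ}
    (h : BoundedDensity μ C L) : NullSingletonClass μ :=
  ⟨fun _ => h.absolutelyContinuous (measure_singleton _)⟩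

/-- The kernel is cut at distance `1`. The near part is compared with Lebesgue measure, whose
translation invariance makes the bound independent of `x`; the far part costs `B` times the mass. It
is applied to `log` and to `|u|^(-3/4)`. -/
lemma BoundedDensity.lintegral_comp_sub_le {μ : Measure ℝ} {C : NNReal} {L : ℝ}
    (h : BoundedDensity μ C L) {f : ℝ → ENNReal} (x : ℝ) {B : ENNReal}
    (hB : ∀ᵐ t ∂μ, 1 < |x - t| → f (x - t) ≤ B) :
    ∫⁻ t, f (x - t) ∂μ ≤ C * (∫⁻ u in Set.Icc (-1) 1, f u) + B * μ Set.univ := by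
  have h1 : ∀ᵐ t ∂μ, f (x - t) ≤ (Set.Icc (-1) 1).indicator f (x - t) + B := by
    filter_upwards [hB] with t ht
    by_cases hm : x - t ∈ Set.Icc (-1 : ℝ) 1
    · rw [Set.indicator_of_mem hm]; exact le_self_add
    · exact (ht (by rw [← not_le, abs_le]; exact hm)).trans le_add_self
  refine (lintegral_mono_ae h1).trans ?_
  rw [lintegral_add_right _ measurable_const, lintegral_const]
  gcongr
  refine (lintegral_mono' h.le le_rfl).trans ?_
  rw [lintegral_smul_measure,
    lintegral_sub_left_eq_self (fun u => (Set.Icc (-1) 1).indicator f u) x,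
    lintegral_indicator measurableSet_Icc]
  rfl

lemma lintegral_log_unit_lt_top :
    ∫⁻ u in Set.Icc (-1 : ℝ) 1, ‖Real.log |u|‖ₑ < ⊤ := by
  have : IntegrableOn Real.log (Set.Icc (-1 : ℝ) 1) := by
    rw [integrableOn_Icc_iff_integrableOn_Ioc,
      ← intervalIntegrable_iff_integrableOn_Ioc_of_le (by norm_num)]
    exact intervalIntegral.intervalIntegrable_log'
  simpa [HasFiniteIntegral] using this.2

lemma enorm_log_le {u B : ℝ} (h1 : 1 < |u|) (h2 : |u| ≤ B) :
    ‖Real.log |u|‖ₑ ≤ ENNReal.ofReal B := by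
  rw [← ofReal_norm, Real.norm_eq_abs, abs_of_nonneg (Real.log_nonneg h1.le)]
  exact ENNReal.ofReal_le_ofReal (by linarith [Real.log_le_sub_one_of_pos (zero_lt_one.trans h1)])

lemma BoundedDensity.lintegral_log_le {μ : Measure ℝ} {C : NNReal} {L : ℝ}
    (h : BoundedDensity μ C L) (x : ℝ) :
    ∫⁻ t, ‖Real.log |x - t|‖ₑ ∂μ ≤
      C * (∫⁻ u in Set.Icc (-1 : ℝ) 1, ‖Real.log |u|‖ₑ) +
        ENNReal.ofReal (|x| + L) * μ Set.univ := by
  refine h.lintegral_comp_sub_le (f := fun u => ‖Real.log |u|‖ₑ) x ?_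
  filter_upwards [h.bdd] with t ht h1
  exact enorm_log_le h1 ((abs_sub _ _).trans (by linarith))

lemma BoundedDensity.integrable_log {μ : Measure ℝ} [IsFiniteMeasure μ] {C : NNReal} {L : ℝ}
    (h : BoundedDensity μ C L) (x : ℝ) : Integrable (fun t => Real.log |x - t|) μ := by
  refine ⟨(Real.measurable_log.comp (by fun_prop)).aestronglyMeasurable, ?_⟩
  refine (h.lintegral_log_le x).trans_lt (ENNReal.add_lt_top.2 ⟨?_, ?_⟩)
  · exact ENNReal.mul_lt_top ENNReal.coe_lt_top lintegral_log_unit_lt_top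
  · exact ENNReal.mul_lt_top ENNReal.ofReal_lt_top (measure_lt_top _ _)

/-- The logarithmic kernel is integrable against `ν ⊗ μ` if `μ` has a bounded density and both
measures have bounded support. -/
lemma BoundedDensity.integrable_log_prod {μ ν : Measure ℝ} [IsFiniteMeasure μ] [IsFiniteMeasure ν]
    {C : NNReal} {L L' : ℝ} (h : BoundedDensity μ C L) (hν : ∀ᵐ t ∂ν, |t| ≤ L') :
    Integrable (fun p : ℝ × ℝ => Real.log |p.1 - p.2|) (ν.prod μ) := by
  refine ⟨measurable_log_abs_sub.aestronglyMeasurable, ?_⟩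
  rw [HasFiniteIntegral, lintegral_prod _ measurable_log_abs_sub.enorm.aemeasurable]
  have hb : ∀ᵐ x ∂ν, ∫⁻ t, ‖Real.log |x - t|‖ₑ ∂μ ≤
      C * (∫⁻ u in Set.Icc (-1 : ℝ) 1, ‖Real.log |u|‖ₑ) +
        ENNReal.ofReal (L' + L) * μ Set.univ := by
    filter_upwards [hν] with x hx
    refine (h.lintegral_log_le x).trans ?_
    gcongr
  refine (lintegral_mono_ae hb).trans_lt ?_
  rw [lintegral_const]
  refine ENNReal.mul_lt_top (ENNReal.add_lt_top.2 ⟨?_, ?_⟩) (measure_lt_top _ _)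
  · exact ENNReal.mul_lt_top ENNReal.coe_lt_top lintegral_log_unit_lt_top
  · exact ENNReal.mul_lt_top ENNReal.ofReal_lt_top (measure_lt_top _ _)

lemma BoundedDensity.ae_prod_ne {μ ν : Measure ℝ} [IsFiniteMeasure μ] [IsFiniteMeasure ν]
    {C : NNReal} {L : ℝ} (h : BoundedDensity μ C L) : ∀ᵐ p ∂ν.prod μ, p.1 ≠ p.2 := by
  have := h.noAtoms
  have hm : MeasurableSet {p : ℝ × ℝ | p.1 ≠ p.2} :=
    (measurableSet_eq_fun measurable_fst measurable_snd).compl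
  refine (Measure.ae_prod_iff_ae_ae hm).2 (ae_of_all _ fun x => ?_)
  have : ∀ᵐ y ∂μ, y ∉ ({x} : Set ℝ) := measure_eq_zero_iff_ae_notMem.1 (measure_singleton x)
  filter_upwards [this] with y hy e
  exact hy e.symm

/-! ### The variational inequality -/

/-- The mutual logarithmic energy `∬ - log |x - y| dμ(x) dν(y)` as a real number. -/
noncomputable def mutualEnergy (μ ν : Measure ℝ) : ℝ :=
  ∫ p, -Real.log |p.1 - p.2| ∂μ.prod ν

/-- The mutual logarithmic energy is absolutely convergent and `μ ⊗ ν` does not charge the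
diagonal. -/
structure HasMutualEnergy (μ ν : Measure ℝ) : Prop where
  integrable : Integrable (fun p : ℝ × ℝ => Real.log |p.1 - p.2|) (μ.prod ν)
  ae_ne : ∀ᵐ p ∂μ.prod ν, p.1 ≠ p.2

lemma HasMutualEnergy.symm {μ ν : Measure ℝ} [SFinite μ] [SFinite ν] (h : HasMutualEnergy μ ν) :
    HasMutualEnergy ν μ := by
  refine ⟨?_, ?_⟩
  · refine h.integrable.swap.congr (ae_of_all _ fun p => ?_)
    simp only [Function.comp, Prod.fst_swap, Prod.snd_swap, abs_sub_comm]
  · have := (Measure.measurePreserving_swap (μ := ν) (ν := μ)).quasiMeasurePreserving.ae h.ae_ne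
    filter_upwards [this] with p hp e
    exact hp e.symm

lemma mutualEnergy_comm (μ ν : Measure ℝ) [SFinite μ] [SFinite ν] :
    mutualEnergy μ ν = mutualEnergy ν μ := by
  rw [mutualEnergy, ← integral_prod_swap]
  simp [mutualEnergy, abs_sub_comm]

lemma BoundedDensity.hasMutualEnergy {μ ν : Measure ℝ} [IsFiniteMeasure μ] [IsFiniteMeasure ν]
    {C : NNReal} {L L' : ℝ} (h : BoundedDensity μ C L) (hν : ∀ᵐ t ∂ν, |t| ≤ L') :
    HasMutualEnergy ν μ :=
  ⟨h.integrable_log_prod hν, h.ae_prod_ne⟩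

lemma mutualEnergy_eq_integral_logPotential {μ ν : Measure ℝ} [SFinite μ] [SFinite ν]
    (h : HasMutualEnergy ν μ) : mutualEnergy ν μ = ∫ x, logPotential μ x ∂ν := by
  simp only [mutualEnergy, logPotential, integral_neg]
  rw [integral_prod _ h.integrable]

lemma HasMutualEnergy.integrable_logPotential {μ ν : Measure ℝ} [SFinite μ] [SFinite ν]
    (h : HasMutualEnergy ν μ) : Integrable (logPotential μ) ν :=
  h.integrable.integral_prod_left.neg

lemma meanFieldEnergy_eq_coe {V : ℝ → ℝ} {μ : Measure ℝ} (h : HasMutualEnergy μ μ)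
    (hV : Integrable V μ) :
    meanFieldEnergy V μ = ((mutualEnergy μ μ + ∫ x, V x ∂μ : ℝ) : EReal) := by
  rw [meanFieldEnergy, if_neg hV.lintegral_lt_top.ne, logEnergy_eq_coe h.integrable h.ae_ne,
    eintegral_eq_coe hV (ae_eq_refl _), ← EReal.coe_add, mutualEnergy]

lemma mix_prod_mix (μ ν : Measure ℝ) [SFinite μ] [SFinite ν] (a b : ENNReal) :
    (a • μ + b • ν).prod (a • μ + b • ν) =
      (a * a) • μ.prod μ + (a * b) • μ.prod ν + ((b * a) • ν.prod μ + (b * b) • ν.prod ν) := by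
  rw [Measure.prod_add, Measure.add_prod, Measure.add_prod]
  simp only [Measure.prod_smul_left, Measure.prod_smul_right, smul_smul]
  rw [mul_comm b a]
  abel

lemma HasMutualEnergy.mix {μ ν : Measure ℝ} [SFinite μ] [SFinite ν]
    (h1 : HasMutualEnergy μ μ) (h2 : HasMutualEnergy μ ν) (h3 : HasMutualEnergy ν ν)
    {a b : ENNReal} (ha : a ≠ ⊤) (hb : b ≠ ⊤) :
    HasMutualEnergy (a • μ + b • ν) (a • μ + b • ν) ∧
      mutualEnergy (a • μ + b • ν) (a • μ + b • ν) =
        a.toReal ^ 2 * mutualEnergy μ μ + 2 * a.toReal * b.toReal * mutualEnergy ν μ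
          + b.toReal ^ 2 * mutualEnergy ν ν := by
  have i1 := h1.integrable.smul_measure (ENNReal.mul_ne_top ha ha)
  have i2 := h2.integrable.smul_measure (ENNReal.mul_ne_top ha hb)
  have i3 := h2.symm.integrable.smul_measure (ENNReal.mul_ne_top hb ha)
  have i4 := h3.integrable.smul_measure (ENNReal.mul_ne_top hb hb)
  have e : ∀ ρ : Measure (ℝ × ℝ), ∫ p : ℝ × ℝ, -Real.log |p.1 - p.2| ∂ρ =
      -∫ p : ℝ × ℝ, Real.log |p.1 - p.2| ∂ρ := fun ρ => integral_neg _
  refine ⟨⟨?_, ?_⟩, ?_⟩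
  · rw [mix_prod_mix]
    exact (i1.add_measure i2).add_measure (i3.add_measure i4)
  · rw [mix_prod_mix]
    simp only [ae_add_measure_iff]
    exact ⟨⟨Measure.ae_smul_measure h1.ae_ne _, Measure.ae_smul_measure h2.ae_ne _⟩,
      Measure.ae_smul_measure h2.symm.ae_ne _, Measure.ae_smul_measure h3.ae_ne _⟩
  · have hc := mutualEnergy_comm μ ν
    simp only [mutualEnergy, e] at hc ⊢
    rw [mix_prod_mix, integral_add_measure (i1.add_measure i2) (i3.add_measure i4),
      integral_add_measure i1 i2, integral_add_measure i3 i4]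
    simp only [integral_smul_measure, ENNReal.toReal_mul, smul_eq_mul]
    linear_combination a.toReal * b.toReal * hc

/-- After subtraction of the energy of `μ₀`, minimality along `(1 - t) μ₀ + t ν` reads `0 ≤ t (A + t
B)`, where `A` is the difference of the two sides. Dividing by `t` and letting `t → 0⁺` gives `A ≥
0`. -/
lemma IsEquilibriumMeasure.variation {V : ℝ → ℝ} {μ₀ ν : Measure ℝ}
    (hμ₀ : IsEquilibriumMeasure V μ₀) [IsProbabilityMeasure ν]
    (h1 : HasMutualEnergy μ₀ μ₀) (h2 : HasMutualEnergy μ₀ ν) (h3 : HasMutualEnergy ν ν)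
    (hV₀ : Integrable V μ₀) (hV : Integrable V ν) :
    2 * mutualEnergy μ₀ μ₀ + ∫ x, V x ∂μ₀ ≤ 2 * mutualEnergy ν μ₀ + ∫ x, V x ∂ν := by
  have := hμ₀.1
  have key : ∀ t : ℝ, t ∈ Set.Ioo (0 : ℝ) 1 →
      0 ≤ (2 * mutualEnergy ν μ₀ + ∫ x, V x ∂ν - (2 * mutualEnergy μ₀ μ₀ + ∫ x, V x ∂μ₀)) +
        t * (mutualEnergy μ₀ μ₀ - 2 * mutualEnergy ν μ₀ + mutualEnergy ν ν) := by
    intro t ht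
    set a : ENNReal := ENNReal.ofReal (1 - t) with ha
    set b : ENNReal := ENNReal.ofReal t with hb
    have ha' : a.toReal = 1 - t := ENNReal.toReal_ofReal (by linarith [ht.2])
    have hb' : b.toReal = t := ENNReal.toReal_ofReal ht.1.le
    obtain ⟨e1, e2⟩ := h1.mix h2 h3 (a := a) (b := b) ENNReal.ofReal_ne_top ENNReal.ofReal_ne_top
    have hprob : IsProbabilityMeasure (a • μ₀ + b • ν) := by
      refine ⟨?_⟩
      simp only [Measure.coe_add, Measure.coe_smul, Pi.add_apply, Pi.smul_apply, measure_univ,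
        smul_eq_mul, mul_one]
      rw [ha, hb, ← ENNReal.ofReal_add (by linarith [ht.2]) ht.1.le]
      simp
    have j1 : Integrable V (a • μ₀) := hV₀.smul_measure ENNReal.ofReal_ne_top
    have j2 : Integrable V (b • ν) := hV.smul_measure ENNReal.ofReal_ne_top
    have hle := hμ₀.2 _ hprob
    rw [meanFieldEnergy_eq_coe h1 hV₀, meanFieldEnergy_eq_coe e1 (j1.add_measure j2),
      EReal.coe_le_coe_iff, e2, integral_add_measure j1 j2, integral_smul_measure,
      integral_smul_measure, ha', hb', smul_eq_mul, smul_eq_mul] at hle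
    have : 0 ≤ t * ((2 * mutualEnergy ν μ₀ + ∫ x, V x ∂ν -
        (2 * mutualEnergy μ₀ μ₀ + ∫ x, V x ∂μ₀)) +
        t * (mutualEnergy μ₀ μ₀ - 2 * mutualEnergy ν μ₀ + mutualEnergy ν ν)) := by
      linear_combination hle
    exact nonneg_of_mul_nonneg_right this ht.1
  rw [← sub_nonneg]
  have hlim : Tendsto (fun t : ℝ => (2 * mutualEnergy ν μ₀ + ∫ x, V x ∂ν -
      (2 * mutualEnergy μ₀ μ₀ + ∫ x, V x ∂μ₀)) +
        t * (mutualEnergy μ₀ μ₀ - 2 * mutualEnergy ν μ₀ + mutualEnergy ν ν)) (𝓝[>] 0)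
      (𝓝 ((2 * mutualEnergy ν μ₀ + ∫ x, V x ∂ν -
      (2 * mutualEnergy μ₀ μ₀ + ∫ x, V x ∂μ₀)) +
        0 * (mutualEnergy μ₀ μ₀ - 2 * mutualEnergy ν μ₀ + mutualEnergy ν ν))) :=
    ((by fun_prop : Continuous fun t : ℝ => (2 * mutualEnergy ν μ₀ + ∫ x, V x ∂ν -
      (2 * mutualEnergy μ₀ μ₀ + ∫ x, V x ∂μ₀)) +
        t * (mutualEnergy μ₀ μ₀ - 2 * mutualEnergy ν μ₀ + mutualEnergy ν ν)).tendsto 0).mono_left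
      nhdsWithin_le_nhds
  rw [zero_mul, add_zero] at hlim
  refine ge_of_tendsto hlim ?_
  filter_upwards [Ioo_mem_nhdsGT one_pos] with t ht using key t ht

/-! ### Zero capacity and Lebesgue measure -/

/-- The uniform probability measure on a set of finite positive Lebesgue measure. -/
noncomputable def uniformOn (K : Set ℝ) : Measure ℝ := (volume K)⁻¹ • volume.restrict K

lemma uniformOn_compl {K : Set ℝ} (hK : MeasurableSet K) : uniformOn K Kᶜ = 0 := by
  simp [uniformOn, hK.compl]

lemma isProbabilityMeasure_uniformOn {K : Set ℝ} (h0 : volume K ≠ 0) (h : volume K ≠ ⊤) :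
    IsProbabilityMeasure (uniformOn K) :=
  ⟨by simp [uniformOn, ENNReal.inv_mul_cancel h0 h]⟩

lemma boundedDensity_uniformOn {K : Set ℝ} (hK : IsCompact K) (h0 : volume K ≠ 0) :
    ∃ L, BoundedDensity (uniformOn K) (volume K)⁻¹.toNNReal L := by
  obtain ⟨L, hL⟩ := hK.isBounded.subset_closedBall 0
  refine ⟨L, ?_, ?_⟩
  · have : ((volume K)⁻¹.toNNReal : ENNReal) = (volume K)⁻¹ :=
      ENNReal.coe_toNNReal (ENNReal.inv_ne_top.2 h0)
    have h2 : (volume K)⁻¹.toNNReal • (volume : Measure ℝ) = (volume K)⁻¹ • volume := by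
      rw [← this]; rfl
    rw [h2, uniformOn]
    gcongr
    exact Measure.restrict_le_self
  · have : ∀ᵐ t ∂uniformOn K, t ∈ K := uniformOn_compl hK.measurableSet
    filter_upwards [this] with t ht
    simpa using hL ht

/-- By inner regularity a set of positive measure contains a compact set of positive measure. The
uniform measure on the latter has a bounded density, hence finite energy. -/
lemma HasZeroCapacity.volume_eq_zero {A : Set ℝ} (hA : HasZeroCapacity A)
    (hm : MeasurableSet A) : volume A = 0 := by
  by_contra h0
  obtain ⟨K, hKA, hK, hpos⟩ := hm.exists_lt_isCompact (pos_iff_ne_zero.2 h0)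
  have := isProbabilityMeasure_uniformOn hpos.ne' hK.measure_lt_top.ne
  obtain ⟨L, hL⟩ := boundedDensity_uniformOn hK hpos.ne'
  have h1 := hA _ this K hK hKA (uniformOn_compl hK.measurableSet)
  have h2 := hL.hasMutualEnergy hL.bdd
  rw [logEnergy_eq_coe h2.integrable h2.ae_ne] at h1
  exact EReal.coe_ne_top _ h1

lemma HasZeroCapacity.mono {A B : Set ℝ} (hB : HasZeroCapacity B) (h : A ⊆ B) :
    HasZeroCapacity A :=
  fun μ hμ K hK hKA hμK => hB μ hμ K hK (hKA.trans h) hμK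

/-! ### The Euler–Lagrange conditions -/

lemma exists_lower_bound_on {V : ℝ → ℝ} (hV : LowerSemicontinuous V) {K : Set ℝ}
    (hK : IsCompact K) : ∃ B, ∀ x ∈ K, B ≤ V x := by
  obtain ⟨B, hB⟩ := (hV.lowerSemicontinuousOn K).bddBelow_of_isCompact hK
  exact ⟨B, fun x hx => hB (Set.mem_image_of_mem _ hx)⟩

/-- The equilibrium measure has finite mean-field energy. -/
lemma IsEquilibriumMeasure.meanFieldEnergy_ne_top {V : ℝ → ℝ} (hV : LowerSemicontinuous V)
    {μ₀ : Measure ℝ} (hμ₀ : IsEquilibriumMeasure V μ₀) : meanFieldEnergy V μ₀ ≠ ⊤ := by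
  -- A competitor of finite energy: `V` is real-valued, so its sublevel sets exhaust `[0, 1]` and
  -- one of them has positive measure there. It is compact by lower semicontinuity, and its uniform
  -- measure has bounded density.
  obtain ⟨N, hN⟩ : ∃ N : ℕ, volume ({x | V x ≤ N} ∩ Set.Icc 0 1) ≠ 0 := by
    by_contra! hcon
    have hU : (⋃ N : ℕ, ({x | V x ≤ N} ∩ Set.Icc (0 : ℝ) 1)) = Set.Icc 0 1 := by
      ext x
      simp only [Set.mem_iUnion, Set.mem_inter_iff, Set.mem_ofPred_eq]
      exact ⟨fun ⟨_, h⟩ => h.2, fun h => (exists_nat_ge (V x)).imp fun _ h' => ⟨h', h⟩⟩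
    have h0 : volume (⋃ N : ℕ, ({x | V x ≤ N} ∩ Set.Icc (0 : ℝ) 1)) = 0 :=
      measure_iUnion_null hcon
    rw [hU] at h0
    simp at h0
  set K := {x | V x ≤ N} ∩ Set.Icc (0 : ℝ) 1 with hKdef
  have hK : IsCompact K := isCompact_Icc.inter_left (hV.isClosed_preimage (N : ℝ))
  have := isProbabilityMeasure_uniformOn hN hK.measure_lt_top.ne
  obtain ⟨L, hL⟩ := boundedDensity_uniformOn hK hN
  obtain ⟨B, hB⟩ := exists_lower_bound_on hV hK
  have hmem : ∀ᵐ t ∂uniformOn K, t ∈ K := uniformOn_compl hK.measurableSet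
  have hint : Integrable V (uniformOn K) := by
    refine Integrable.of_bound hV.measurable.aestronglyMeasurable (max |B| N) ?_
    filter_upwards [hmem] with t ht
    rw [Real.norm_eq_abs, abs_le]
    have h1 := hB t ht
    have h2 : V t ≤ N := ht.1
    refine ⟨?_, h2.trans (le_max_right _ _)⟩
    linarith [neg_abs_le B, le_max_left |B| (N : ℝ)]
  have hle := hμ₀.2 _ this
  rw [meanFieldEnergy_eq_coe (hL.hasMutualEnergy hL.bdd) hint] at hle
  exact ne_top_of_le_ne_top (EReal.coe_ne_top _) hle

/-- An infinite integral of the positive part of `V` would make the energy infinite by convention;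
lower semicontinuity bounds `V` below on `[-L, L]`. -/
lemma IsEquilibriumMeasure.integrable_potential {V : ℝ → ℝ} (hV : LowerSemicontinuous V)
    {μ₀ : Measure ℝ} (hμ₀ : IsEquilibriumMeasure V μ₀) {L : ℝ} (hL : ∀ᵐ t ∂μ₀, |t| ≤ L) :
    Integrable V μ₀ := by
  have := hμ₀.1
  have hfin : ∫⁻ x, ENNReal.ofReal (V x) ∂μ₀ ≠ ⊤ := by
    intro h
    apply hμ₀.meanFieldEnergy_ne_top hV
    rw [meanFieldEnergy, if_pos h]
  obtain ⟨B, hB⟩ := exists_lower_bound_on hV (isCompact_Icc (a := -L) (b := L))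
  refine ⟨hV.measurable.aestronglyMeasurable, ?_⟩
  have hle : ∀ᵐ t ∂μ₀, ‖V t‖ₑ ≤ ENNReal.ofReal (V t) + ENNReal.ofReal |B| := by
    filter_upwards [hL] with t ht
    have h1 := hB t (abs_le.1 ht)
    rw [← ofReal_norm, Real.norm_eq_abs]
    rcases le_total 0 (V t) with h | h
    · rw [abs_of_nonneg h]; exact le_self_add
    · refine le_trans (ENNReal.ofReal_le_ofReal ?_) le_add_self
      rw [abs_of_nonpos h]
      linarith [neg_abs_le B]
  refine (lintegral_mono_ae hle).trans_lt ?_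
  rw [lintegral_add_right _ measurable_const, lintegral_const]
  exact ENNReal.add_lt_top.2 ⟨hfin.lt_top,
    ENNReal.mul_lt_top ENNReal.ofReal_lt_top (measure_lt_top _ _)⟩

/-- The constant of the Euler–Lagrange conditions. -/
noncomputable def robinConstant (V : ℝ → ℝ) (μ : Measure ℝ) : ℝ :=
  mutualEnergy μ μ + (∫ x, V x ∂μ) / 2

section EulerLagrange

variable {V : ℝ → ℝ} (hV : LowerSemicontinuous V) {μ₀ : Measure ℝ}
  (hμ₀ : IsEquilibriumMeasure V μ₀) {C : NNReal} {L : ℝ} (hb : BoundedDensity μ₀ C L)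
  (hU : Continuous (logPotential μ₀))

include hV hμ₀ hb hU

/-- A measure `ν` of finite energy on a compact part of this set would satisfy `∫ (U + V/2) dν ≥ c`
by the variational inequality, while the integrand is everywhere below `c` on that part. -/
lemma hasZeroCapacity_lt_robinConstant :
    HasZeroCapacity {x | logPotential μ₀ x + V x / 2 < robinConstant V μ₀} := by
  intro ν hν K hK hKA hνK
  by_contra hne
  have := hμ₀.1
  have hmem : ∀ᵐ t ∂ν, t ∈ K := hνK
  obtain ⟨L', hL'⟩ := hK.isBounded.subset_closedBall 0
  have hbd : ∀ᵐ t ∂ν, |t| ≤ L' := by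
    filter_upwards [hmem] with t ht
    simpa using hL' ht
  obtain ⟨B, hB⟩ := exists_lower_bound_on hV hK
  obtain ⟨B', hB'⟩ := hK.exists_bound_of_continuousOn hU.continuousOn
  -- `V` is bounded on `K`: below by lower semicontinuity, above because `U + V/2 < c` there and `U`
  -- is bounded on `K`.
  have hVint : Integrable V ν := by
    refine Integrable.of_bound hV.measurable.aestronglyMeasurable
      (|B| + 2 * (|robinConstant V μ₀| + B')) ?_
    filter_upwards [hmem] with t ht
    have h1 := hB t ht
    have h2 := hB' t ht
    have h3 : logPotential μ₀ t + V t / 2 < robinConstant V μ₀ := hKA ht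
    rw [Real.norm_eq_abs] at h2
    have h4 := abs_le.1 h2
    rw [Real.norm_eq_abs, abs_le]
    constructor
    · linarith [neg_abs_le B, abs_nonneg (robinConstant V μ₀)]
    · linarith [le_abs_self (robinConstant V μ₀), abs_nonneg B]
  have hνe : HasMutualEnergy ν ν := by
    obtain ⟨h1, h2⟩ := integrable_log_of_logEnergy_ne_top hbd hne
    exact ⟨h1, h2⟩
  have hmix : HasMutualEnergy ν μ₀ := hb.hasMutualEnergy hbd
  have hvar := hμ₀.variation (hb.hasMutualEnergy hb.bdd) hmix.symm hνe
    (hμ₀.integrable_potential hV hb.bdd) hVint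
  have hi' : Integrable (fun x => logPotential μ₀ x + V x / 2) ν :=
    hmix.integrable_logPotential.add (hVint.div_const 2)
  have hi : Integrable (fun x => robinConstant V μ₀ - (logPotential μ₀ x + V x / 2)) ν :=
    (integrable_const _).sub hi'
  have hval : ∫ x, (robinConstant V μ₀ - (logPotential μ₀ x + V x / 2)) ∂ν ≤ 0 := by
    rw [integral_sub (integrable_const _) hi',
      integral_add hmix.integrable_logPotential (hVint.div_const 2), integral_div,
      ← mutualEnergy_eq_integral_logPotential hmix, integral_const, probReal_univ, one_smul,
      robinConstant]
    linarith
  have hpos : ∀ᵐ x ∂ν, 0 < robinConstant V μ₀ - (logPotential μ₀ x + V x / 2) := by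
    filter_upwards [hmem] with t ht
    have h3 : logPotential μ₀ t + V t / 2 < robinConstant V μ₀ := hKA ht
    linarith
  have h0 := (integral_eq_zero_iff_of_nonneg_ae (hpos.mono fun x hx => hx.le) hi).1
    (le_antisymm hval (integral_nonneg_of_ae (hpos.mono fun x hx => hx.le)))
  obtain ⟨x, hx1, hx2⟩ := (hpos.and h0).exists
  exact hx1.ne' hx2

lemma ae_robinConstant_le :
    ∀ᵐ x, robinConstant V μ₀ ≤ logPotential μ₀ x + V x / 2 := by
  have hm : Measurable fun x => logPotential μ₀ x + V x / 2 :=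
    hU.measurable.add (hV.measurable.div_const 2)
  have := (hasZeroCapacity_lt_robinConstant hV hμ₀ hb hU).volume_eq_zero
    (measurableSet_lt hm measurable_const)
  rw [ae_iff]
  simpa using this

/-- The constant is the `μ₀`-mean of `U + V/2`, and a function that is a.e. at least its mean is
a.e. equal to it. -/
lemma ae_eq_robinConstant :
    ∀ᵐ x ∂μ₀, logPotential μ₀ x + V x / 2 = robinConstant V μ₀ := by
  have := hμ₀.1
  have h1 : ∀ᵐ x ∂μ₀, robinConstant V μ₀ ≤ logPotential μ₀ x + V x / 2 :=
    hb.absolutelyContinuous.ae_le (ae_robinConstant_le hV hμ₀ hb hU)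
  have he := hb.hasMutualEnergy hb.bdd
  have hVi := hμ₀.integrable_potential hV hb.bdd
  have hi : Integrable (fun x => logPotential μ₀ x + V x / 2) μ₀ :=
    he.integrable_logPotential.add (hVi.div_const 2)
  have h2 : ∫ x, (logPotential μ₀ x + V x / 2 - robinConstant V μ₀) ∂μ₀ = 0 := by
    rw [integral_sub hi (integrable_const _),
      integral_add he.integrable_logPotential (hVi.div_const 2), integral_div,
      ← mutualEnergy_eq_integral_logPotential he, integral_const, probReal_univ, one_smul,
      robinConstant, sub_self]
  have h3 := (integral_eq_zero_iff_of_nonneg_ae (h1.mono fun x hx => sub_nonneg.2 hx)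
    (hi.sub (integrable_const _))).1 h2
  filter_upwards [h3] with x hx
  exact sub_eq_zero.1 hx

/-- Both exceptional sets lie in `{U + V/2 < c}`. On the support this holds because `{U + V/2 > c}`
is open by lower semicontinuity and `μ₀`-null, hence disjoint from the support. -/
lemma isEquilibriumConstant_robinConstant :
    IsEquilibriumConstant V μ₀ (robinConstant V μ₀) := by
  have hz := hasZeroCapacity_lt_robinConstant hV hμ₀ hb hU
  refine ⟨hz.mono ?_, hz.mono ?_⟩
  · rintro x ⟨hx, hne⟩
    have hlsc : LowerSemicontinuous fun x => logPotential μ₀ x + V x / 2 := by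
      refine hU.lowerSemicontinuous.add ?_
      have := (continuous_id.div_const (2 : ℝ)).comp_lowerSemicontinuous hV
        (fun a b h => by simpa using div_le_div_of_nonneg_right h zero_le_two)
      exact this
    have hopen : IsOpen {x | robinConstant V μ₀ < logPotential μ₀ x + V x / 2} :=
      hlsc.isOpen_preimage _
    have hnull : μ₀ {x | robinConstant V μ₀ < logPotential μ₀ x + V x / 2} = 0 := by
      refine measure_mono_null ?_ (ae_iff.1 (ae_eq_robinConstant hV hμ₀ hb hU))
      intro y hy e
      exact (ne_of_lt hy) e.symm
    have := Measure.subset_compl_support_of_isOpen hopen hnull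
    rcases lt_trichotomy (logPotential μ₀ x + V x / 2) (robinConstant V μ₀) with h | h | h
    · exact h
    · exact absurd h hne
    · exact absurd hx (this h)
  · rintro x ⟨-, hx⟩
    exact not_le.1 hx

/-- The exceptional set in the support is Lebesgue-null, hence `μ₀`-null. So some point of the
support realises both constants. -/
lemma IsEquilibriumConstant.eq_robinConstant {c : ℝ} (hc : IsEquilibriumConstant V μ₀ c) :
    c = robinConstant V μ₀ := by
  have := hμ₀.1
  have hm : Measurable fun x => logPotential μ₀ x + V x / 2 :=
    hU.measurable.add (hV.measurable.div_const 2)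
  have hz := hc.1.volume_eq_zero (Measure.isClosed_support.measurableSet.inter
    (measurableSet_eq_fun hm measurable_const).compl)
  have h1 : ∀ᵐ x ∂μ₀, ¬ (x ∈ μ₀.support ∧ ¬ logPotential μ₀ x + V x / 2 = c) :=
    hb.absolutelyContinuous.ae_le (measure_eq_zero_iff_ae_notMem.1 hz)
  have h2 : ∀ᵐ x ∂μ₀, x ∈ μ₀.support := Measure.support_mem_ae
  obtain ⟨x, ⟨hx1, hx2⟩, hx3⟩ := ((h1.and h2).and (ae_eq_robinConstant hV hμ₀ hb hU)).exists
  rw [← hx3]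
  by_contra h
  exact hx1 ⟨hx2, fun e => h e.symm⟩

end EulerLagrange

/-! ### The kernel `Re ((z - s)⁻¹ conj (z - t)⁻¹)` on horizontal strips -/

/-- The symmetric strip `δ < |Im z| < Y`. -/
def strip (δ Y : ℝ) : Set ℂ := {z | |z.im| ∈ Set.Ioo δ Y}

lemma measurableSet_strip (δ Y : ℝ) : MeasurableSet (strip δ Y) :=
  measurableSet_preimage (Complex.measurable_im.abs) measurableSet_Ioo

/-- The real part of `(z - s)⁻¹ conj (z - t)⁻¹` at `z = x + i y`. -/
noncomputable def pairKernel (s t x y : ℝ) : ℝ :=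
  ((x - s) * (x - t) + y ^ 2) / (((x - s) ^ 2 + y ^ 2) * ((x - t) ^ 2 + y ^ 2))

lemma re_inv_mul_conj_inv (s t : ℝ) (z : ℂ) :
    ((z - s)⁻¹ * (starRingEnd ℂ) ((z - t)⁻¹)).re = pairKernel s t z.re z.im := by
  rw [pairKernel, div_eq_mul_inv, mul_inv]
  simp [Complex.inv_re, Complex.inv_im, Complex.normSq_apply]
  ring

/-- From `|Re (a conj b)| ≤ |a| |b| ≤ |a|² + |b|²`. The bound separates `s` from `t`, so
integrability need only be checked for the diagonal kernel. -/
lemma abs_pairKernel_le (s t x y : ℝ) :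
    |pairKernel s t x y| ≤ ((x - s) ^ 2 + y ^ 2)⁻¹ + ((x - t) ^ 2 + y ^ 2)⁻¹ := by
  have e := re_inv_mul_conj_inv s t ⟨x, y⟩
  have hn : ∀ u : ℝ, ‖((⟨x, y⟩ : ℂ) - u)⁻¹‖ ^ 2 = ((x - u) ^ 2 + y ^ 2)⁻¹ := by
    intro u
    rw [← Complex.normSq_eq_norm_sq, map_inv₀, Complex.normSq_apply]
    simp [sq]
  rw [← e, ← hn, ← hn]
  refine (Complex.abs_re_le_norm _).trans ?_
  rw [norm_mul, RCLike.norm_conj]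
  nlinarith [sq_nonneg (‖((⟨x, y⟩ : ℂ) - s)⁻¹‖ - ‖((⟨x, y⟩ : ℂ) - t)⁻¹‖),
    norm_nonneg ((⟨x, y⟩ : ℂ) - s)⁻¹, norm_nonneg ((⟨x, y⟩ : ℂ) - t)⁻¹]

lemma integrable_inv_sq_add_sq (s : ℝ) {y : ℝ} (hy : y ≠ 0) :
    Integrable fun x : ℝ => ((x - s) ^ 2 + y ^ 2)⁻¹ := by
  have h := ((integrable_inv_one_add_sq.comp_div hy).const_mul (y ^ 2)⁻¹).comp_sub_right s
  refine h.congr (ae_of_all _ fun x => ?_)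
  simp only
  rw [← mul_inv]
  congr 1
  field_simp
  ring

lemma measurable_pairKernel (s t : ℝ) :
    Measurable fun p : ℝ × ℝ => pairKernel s t p.1 p.2 := by
  unfold pairKernel; fun_prop

lemma integrable_pairKernel (s t : ℝ) {y : ℝ} (hy : y ≠ 0) :
    Integrable fun x : ℝ => pairKernel s t x y := by
  refine ((integrable_inv_sq_add_sq s hy).add (integrable_inv_sq_add_sq t hy)).mono' ?_
    (ae_of_all _ fun x => abs_pairKernel_le s t x y)
  exact ((measurable_pairKernel s t).comp (measurable_id.prodMk measurable_const)).aestronglyMeasurable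

/-- The factor `x²` comes out of both logarithms and cancels. The filter is general so that both
ends of the line are covered. -/
lemma tendsto_log_ratio (s t y : ℝ) {l : Filter ℝ} (hl : Tendsto (fun x : ℝ => x⁻¹) l (𝓝 0))
    (hl' : ∀ᶠ x in l, x ≠ 0) :
    Tendsto (fun x : ℝ => Real.log ((x - t) ^ 2 + y ^ 2) - Real.log ((x - s) ^ 2 + y ^ 2)) l
      (𝓝 0) := by
  have h : ∀ u : ℝ, Tendsto (fun x : ℝ => Real.log ((1 - u * x⁻¹) ^ 2 + (y * x⁻¹) ^ 2)) l (𝓝 0) := by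
    intro u
    have h1 : Tendsto (fun x : ℝ => (1 - u * x⁻¹) ^ 2 + (y * x⁻¹) ^ 2) l
        (𝓝 ((1 - u * 0) ^ 2 + (y * 0) ^ 2)) :=
      (((hl.const_mul u).const_sub 1).pow 2).add ((hl.const_mul y).pow 2)
    have h2 := h1.log (by simp)
    simpa using h2
  have h3 := (h t).sub (h s)
  rw [sub_zero] at h3
  have hne : ∀ u : ℝ, ∀ᶠ x in l, (1 - u * x⁻¹) ^ 2 + (y * x⁻¹) ^ 2 ≠ 0 := by
    intro u
    have h1 : Tendsto (fun x : ℝ => (1 - u * x⁻¹) ^ 2 + (y * x⁻¹) ^ 2) l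
        (𝓝 ((1 - u * 0) ^ 2 + (y * 0) ^ 2)) :=
      (((hl.const_mul u).const_sub 1).pow 2).add ((hl.const_mul y).pow 2)
    exact h1.eventually_ne (by simp)
  refine h3.congr' ?_
  filter_upwards [hl', hne s, hne t] with x hx hs ht
  have e : ∀ u : ℝ, (x - u) ^ 2 + y ^ 2 = x ^ 2 * ((1 - u * x⁻¹) ^ 2 + (y * x⁻¹) ^ 2) := by
    intro u; field_simp
  rw [e s, e t, Real.log_mul (pow_ne_zero 2 hx) hs, Real.log_mul (pow_ne_zero 2 hx) ht]
  ring

lemma integral_pairKernel_of_pos (s t : ℝ) {y : ℝ} (hy : 0 < y) :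
    ∫ x : ℝ, pairKernel s t x y = 4 * Real.pi * y / ((s - t) ^ 2 + 4 * y ^ 2) := by
  set D := (s - t) ^ 2 + 4 * y ^ 2 with hD
  have hDpos : 0 < D := by positivity
  have hQ : ∀ u x : ℝ, 0 < (x - u) ^ 2 + y ^ 2 := fun u x => by positivity
  -- A primitive found by partial fractions. The logarithms cancel at `±∞`, so only the arctangents
  -- contribute; the formula is also valid for `s = t`.
  have hderiv : ∀ x : ℝ, HasDerivAt (fun x : ℝ =>
      D⁻¹ * ((t - s) / 2 * (Real.log ((x - t) ^ 2 + y ^ 2) - Real.log ((x - s) ^ 2 + y ^ 2)) +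
        2 * y * (Real.arctan ((x - t) / y) + Real.arctan ((x - s) / y)))) (pairKernel s t x y) x := by
    intro x
    have hq : ∀ u : ℝ, HasDerivAt (fun x : ℝ => Real.log ((x - u) ^ 2 + y ^ 2))
        (2 * (x - u) / ((x - u) ^ 2 + y ^ 2)) x := by
      intro u
      have h1 : HasDerivAt (fun x : ℝ => (x - u) ^ 2 + y ^ 2) (2 * (x - u)) x := by
        have := (((hasDerivAt_id x).sub_const u).pow 2).add_const (y ^ 2)
        simpa using this
      exact h1.log (hQ u x).ne'
    have ha : ∀ u : ℝ, HasDerivAt (fun x : ℝ => Real.arctan ((x - u) / y))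
        (1 / (1 + ((x - u) / y) ^ 2) * (1 / y)) x := by
      intro u
      have h1 : HasDerivAt (fun x : ℝ => (x - u) / y) (1 / y) x :=
        ((hasDerivAt_id x).sub_const u).div_const y
      exact h1.arctan
    have h := ((((hq t).sub (hq s)).const_mul ((t - s) / 2)).add
      (((ha t).add (ha s)).const_mul (2 * y))).const_mul D⁻¹
    refine h.congr_deriv ?_
    have e : ∀ u : ℝ, 1 / (1 + ((x - u) / y) ^ 2) * (1 / y) = y / ((x - u) ^ 2 + y ^ 2) := by
      intro u
      have := (hQ u x).ne'
      have h2 : 1 + ((x - u) / y) ^ 2 = ((x - u) ^ 2 + y ^ 2) / y ^ 2 := by field_simp; ring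
      rw [h2]
      field_simp
    rw [e, e, pairKernel, inv_mul_eq_div, div_eq_iff hDpos.ne']
    have h1 := (hQ s x).ne'
    have h2 := (hQ t x).ne'
    rw [hD]
    field_simp
    ring
  have hlim : ∀ (l : Filter ℝ) (c : ℝ), Tendsto (fun x : ℝ => x⁻¹) l (𝓝 0) →
      (∀ᶠ x in l, x ≠ 0) → (∀ u : ℝ, Tendsto (fun x => Real.arctan ((x - u) / y)) l (𝓝 c)) →
      Tendsto (fun x : ℝ =>
        D⁻¹ * ((t - s) / 2 * (Real.log ((x - t) ^ 2 + y ^ 2) - Real.log ((x - s) ^ 2 + y ^ 2)) +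
        2 * y * (Real.arctan ((x - t) / y) + Real.arctan ((x - s) / y)))) l
        (𝓝 (D⁻¹ * ((t - s) / 2 * 0 + 2 * y * (c + c)))) := by
    intro l c h1 h2 h3
    exact (((tendsto_log_ratio s t y h1 h2).const_mul _).add
      (((h3 t).add (h3 s)).const_mul _)).const_mul _
  have htop := hlim atTop (Real.pi / 2) tendsto_inv_atTop_zero (eventually_ne_atTop 0) fun u =>
    (Real.tendsto_arctan_atTop.mono_right nhdsWithin_le_nhds).comp
      ((tendsto_atTop_add_const_right _ (-u) tendsto_id).atTop_div_const hy)
  have hbot := hlim atBot (-(Real.pi / 2)) tendsto_inv_atBot_zero (eventually_ne_atBot 0) fun u =>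
    (Real.tendsto_arctan_atBot.mono_right nhdsWithin_le_nhds).comp
      ((tendsto_atBot_add_const_right _ (-u) tendsto_id).atBot_div_const hy)
  rw [integral_of_hasDerivAt_of_tendsto hderiv (integrable_pairKernel s t hy.ne') hbot htop]
  field_simp
  ring

lemma integral_pairKernel (s t : ℝ) {y : ℝ} (hy : y ≠ 0) :
    ∫ x : ℝ, pairKernel s t x y = 4 * Real.pi * |y| / ((s - t) ^ 2 + 4 * |y| ^ 2) := by
  rw [← integral_pairKernel_of_pos s t (abs_pos.2 hy)]
  simp [pairKernel]

lemma integral_complex_eq_prod {E : Type*} [NormedAddCommGroup E] [NormedSpace ℝ E]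
    (f : ℝ × ℝ → E) : ∫ z : ℂ, f (z.re, z.im) = ∫ p, f p :=
  Complex.volume_preserving_equiv_real_prod.integral_comp
    Complex.measurableEquivRealProd.measurableEmbedding f

lemma integrable_complex_iff_prod {E : Type*} [NormedAddCommGroup E] (f : ℝ × ℝ → E) :
    Integrable (fun z : ℂ => f (z.re, z.im)) ↔ Integrable f :=
  Complex.volume_preserving_equiv_real_prod.integrable_comp_emb
    Complex.measurableEquivRealProd.measurableEmbedding

lemma strip_indicator_eq {E : Type*} [Zero E] (δ Y : ℝ) (f : ℝ × ℝ → E) :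
    (strip δ Y).indicator (fun z : ℂ => f (z.re, z.im)) =
      fun z => (fun p : ℝ × ℝ => {p : ℝ × ℝ | |p.2| ∈ Set.Ioo δ Y}.indicator f p) (z.re, z.im) := by
  ext z
  by_cases h : |z.im| ∈ Set.Ioo δ Y
  · rw [Set.indicator_of_mem (show z ∈ strip δ Y from h)]
    simp only
    rw [Set.indicator_of_mem (show (z.re, z.im) ∈ {p : ℝ × ℝ | |p.2| ∈ Set.Ioo δ Y} from h)]
  · rw [Set.indicator_of_notMem (show z ∉ strip δ Y from h)]
    simp only
    rw [Set.indicator_of_notMem (show (z.re, z.im) ∉ {p : ℝ × ℝ | |p.2| ∈ Set.Ioo δ Y} from h)]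

lemma measurableSet_abs_snd (δ Y : ℝ) : MeasurableSet {p : ℝ × ℝ | |p.2| ∈ Set.Ioo δ Y} :=
  measurableSet_preimage measurable_snd.abs measurableSet_Ioo

lemma integrable_strip_inv_sq (s : ℝ) {δ Y : ℝ} (hδ : 0 < δ) :
    Integrable ({p : ℝ × ℝ | |p.2| ∈ Set.Ioo δ Y}.indicator
      fun p => ((p.1 - s) ^ 2 + p.2 ^ 2)⁻¹) := by
  have hT : Integrable ({y : ℝ | |y| ∈ Set.Ioo δ Y}.indicator fun _ => (1 : ℝ)) := by
    refine (integrable_indicator_iff (measurableSet_preimage measurable_id.abs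
      measurableSet_Ioo)).2 (integrableOn_const ?_)
    refine ne_top_of_le_ne_top ?_ (measure_mono (t := Set.Icc (-Y) Y) fun y hy => abs_le.1 hy.2.le)
    simp
  refine ((integrable_inv_sq_add_sq s hδ.ne').mul_prod hT).mono' ?_ (ae_of_all _ fun p => ?_)
  · exact ((by fun_prop : Measurable fun p : ℝ × ℝ => ((p.1 - s) ^ 2 + p.2 ^ 2)⁻¹).indicator
      (measurableSet_abs_snd δ Y)).aestronglyMeasurable
  · by_cases h : |p.2| ∈ Set.Ioo δ Y
    · rw [Set.indicator_of_mem (show p ∈ {p : ℝ × ℝ | |p.2| ∈ Set.Ioo δ Y} from h),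
        Set.indicator_of_mem (show p.2 ∈ {y : ℝ | |y| ∈ Set.Ioo δ Y} from h), mul_one,
        Real.norm_of_nonneg (by positivity), ← sq_abs p.2]
      have := h.1
      gcongr
    · rw [Set.indicator_of_notMem (show p ∉ {p : ℝ × ℝ | |p.2| ∈ Set.Ioo δ Y} from h), norm_zero]
      refine mul_nonneg (by positivity) (Set.indicator_nonneg (fun _ _ => zero_le_one) _)

lemma integrable_strip_pairKernel (s t : ℝ) {δ Y : ℝ} (hδ : 0 < δ) :
    Integrable ({p : ℝ × ℝ | |p.2| ∈ Set.Ioo δ Y}.indicator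
      fun p => pairKernel s t p.1 p.2) := by
  refine ((integrable_strip_inv_sq s (Y := Y) hδ).add
    (integrable_strip_inv_sq t (Y := Y) hδ)).mono'
    ((measurable_pairKernel s t).indicator (measurableSet_abs_snd δ Y)).aestronglyMeasurable
    (ae_of_all _ fun p => ?_)
  by_cases h : p ∈ {p : ℝ × ℝ | |p.2| ∈ Set.Ioo δ Y}
  · simp only [Pi.add_apply, Set.indicator_of_mem h]
    exact abs_pairKernel_le s t p.1 p.2
  · simp only [Pi.add_apply, Set.indicator_of_notMem h, norm_zero, add_zero, le_refl]

/-- On the half-line a primitive is `(π/2) log (a² + 4 y²)`; the two components of the strip double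
it. -/
lemma integral_inner_strip (a : ℝ) {δ Y : ℝ} (hδ : 0 < δ) (hY : δ ≤ Y) :
    ∫ y : ℝ, (Set.Ioo δ Y).indicator (fun y => 4 * Real.pi * y / (a ^ 2 + 4 * y ^ 2)) |y| =
      Real.pi * (Real.log (a ^ 2 + 4 * Y ^ 2) - Real.log (a ^ 2 + 4 * δ ^ 2)) := by
  rw [integral_comp_abs (f := (Set.Ioo δ Y).indicator
    fun y => 4 * Real.pi * y / (a ^ 2 + 4 * y ^ 2)),
    setIntegral_indicator measurableSet_Ioo,
    Set.inter_eq_right.2 (show Set.Ioo δ Y ⊆ Set.Ioi 0 from fun y hy => hδ.trans hy.1),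
    ← integral_Ioc_eq_integral_Ioo,
    ← intervalIntegral.integral_of_le hY]
  have hpos : ∀ y ∈ Set.uIcc δ Y, 0 < a ^ 2 + 4 * y ^ 2 := by
    intro y hy
    rw [Set.uIcc_of_le hY] at hy
    have := hδ.trans_le hy.1
    positivity
  rw [intervalIntegral.integral_eq_sub_of_hasDerivAt
    (f := fun y => Real.pi / 2 * Real.log (a ^ 2 + 4 * y ^ 2))]
  · ring
  · intro y hy
    have h1 : HasDerivAt (fun y : ℝ => a ^ 2 + 4 * y ^ 2) (8 * y) y := by
      have := (((hasDerivAt_id y).pow 2).const_mul 4).const_add (a ^ 2)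
      refine this.congr_deriv ?_
      simp; ring
    refine ((h1.log (hpos y hy).ne').const_mul (Real.pi / 2)).congr_deriv ?_
    ring
  · refine ContinuousOn.intervalIntegrable ?_
    exact ContinuousOn.div (by fun_prop) (by fun_prop) fun y hy => (hpos y hy).ne'

/-- Horizontal integration first, then vertical. The logarithmic interaction of two charges appears
as the limit `δ → 0` of `log ((s - t)² + 4 δ²)`, which is finite for `δ > 0` even when `s = t`. -/
lemma integral_strip_pairKernel (s t : ℝ) {δ Y : ℝ} (hδ : 0 < δ) (hY : δ ≤ Y) :
    ∫ z in strip δ Y, pairKernel s t z.re z.im =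
      Real.pi * (Real.log ((s - t) ^ 2 + 4 * Y ^ 2) - Real.log ((s - t) ^ 2 + 4 * δ ^ 2)) := by
  rw [← integral_indicator (measurableSet_strip δ Y),
    strip_indicator_eq δ Y (fun p : ℝ × ℝ => pairKernel s t p.1 p.2), integral_complex_eq_prod,
    Measure.volume_eq_prod, integral_prod_symm _ (integrable_strip_pairKernel s t hδ),
    ← integral_inner_strip (s - t) hδ hY]
  congr 1 with y
  by_cases h : |y| ∈ Set.Ioo δ Y
  · rw [Set.indicator_of_mem h, ← integral_pairKernel s t (abs_pos.1 (hδ.trans h.1))]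
    congr 1 with x
    exact Set.indicator_of_mem (show (x, y) ∈ {p : ℝ × ℝ | |p.2| ∈ Set.Ioo δ Y} from h) _
  · rw [Set.indicator_of_notMem h, ← integral_zero ℝ ℝ]
    congr 1 with x
    exact Set.indicator_of_notMem (show (x, y) ∉ {p : ℝ × ℝ | |p.2| ∈ Set.Ioo δ Y} from h) _

lemma integrableOn_strip_pairKernel (s t : ℝ) {δ Y : ℝ} (hδ : 0 < δ) :
    IntegrableOn (fun z : ℂ => pairKernel s t z.re z.im) (strip δ Y) := by
  rw [← integrable_indicator_iff (measurableSet_strip δ Y),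
    strip_indicator_eq δ Y (fun p : ℝ × ℝ => pairKernel s t p.1 p.2), integrable_complex_iff_prod]
  exact integrable_strip_pairKernel s t hδ

/-! ### The energy of Cauchy transforms on horizontal strips -/

/-- The Cauchy transform `∫ dμ(t) / (z - t)`. -/
noncomputable def cauchyTransform (μ : Measure ℝ) (z : ℂ) : ℂ := ∫ t, (z - (t : ℂ))⁻¹ ∂μ

lemma abs_im_le_norm_sub (z : ℂ) (t : ℝ) : |z.im| ≤ ‖z - t‖ := by
  simpa using Complex.abs_im_le_norm (z - t)

lemma abs_re_sub_le_norm_sub (z : ℂ) (t : ℝ) : |z.re - t| ≤ ‖z - t‖ := by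
  simpa using Complex.abs_re_le_norm (z - t)

lemma measurable_inv_sub : Measurable fun p : ℂ × ℝ => (p.1 - (p.2 : ℂ))⁻¹ := by fun_prop

lemma integrable_inv_sub (μ : Measure ℝ) [IsFiniteMeasure μ] {z : ℂ} (hz : z.im ≠ 0) :
    Integrable (fun t : ℝ => (z - (t : ℂ))⁻¹) μ := by
  refine Integrable.of_bound (by fun_prop) |z.im|⁻¹ (ae_of_all _ fun t => ?_)
  rw [norm_inv]
  exact inv_anti₀ (abs_pos.2 hz) (abs_im_le_norm_sub z t)

lemma stronglyMeasurable_cauchyTransform (μ : Measure ℝ) [SFinite μ] :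
    StronglyMeasurable (cauchyTransform μ) :=
  measurable_inv_sub.stronglyMeasurable.integral_prod_right

lemma re_cauchyTransform_mul_conj (μ ν : Measure ℝ) [IsFiniteMeasure μ] [IsFiniteMeasure ν]
    {z : ℂ} (hz : z.im ≠ 0) :
    (cauchyTransform μ z * (starRingEnd ℂ) (cauchyTransform ν z)).re =
      ∫ p, pairKernel p.1 p.2 z.re z.im ∂μ.prod ν := by
  have h1 := integrable_inv_sub μ hz
  have h2 := (Complex.conjCLE.toContinuousLinearMap).integrable_comp (integrable_inv_sub ν hz)
  have h3 : Integrable (fun p : ℝ × ℝ => (z - (p.1 : ℂ))⁻¹ * (starRingEnd ℂ) ((z - (p.2 : ℂ))⁻¹))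
      (μ.prod ν) := h1.mul_prod h2
  rw [cauchyTransform, cauchyTransform, ← integral_conj, ← integral_prod_mul]
  have := Complex.reCLM.integral_comp_comm h3
  simp only [Complex.reCLM_apply] at this
  rw [← this]
  exact integral_congr_ae (ae_of_all _ fun p => re_inv_mul_conj_inv p.1 p.2 z)

lemma pairKernel_self (s x : ℝ) {y : ℝ} (hy : y ≠ 0) :
    pairKernel s s x y = ((x - s) ^ 2 + y ^ 2)⁻¹ := by
  have : (x - s) ^ 2 + y ^ 2 ≠ 0 := by positivity
  rw [pairKernel, ← sq (x - s), div_mul_cancel_left₀ this]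

lemma ne_zero_of_mem_strip {δ Y : ℝ} (hδ : 0 < δ) {z : ℂ} (hz : z ∈ strip δ Y) : z.im ≠ 0 :=
  abs_pos.1 (hδ.trans hz.1)

lemma measurable_pairKernel_prod :
    Measurable fun q : ℂ × (ℝ × ℝ) => pairKernel q.2.1 q.2.2 q.1.re q.1.im := by
  unfold pairKernel; fun_prop

/-- The kernel is dominated by the sum of the two diagonal kernels, whose integrals over the strip
do not depend on the position of the charge. A constant bound suffices against finite measures. -/
lemma integrable_strip_prod (μ ν : Measure ℝ) [IsFiniteMeasure μ] [IsFiniteMeasure ν] {δ Y : ℝ}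
    (hδ : 0 < δ) (hY : δ ≤ Y) :
    Integrable (fun q : ℂ × (ℝ × ℝ) => pairKernel q.2.1 q.2.2 q.1.re q.1.im)
      ((volume.restrict (strip δ Y)).prod (μ.prod ν)) := by
  rw [integrable_prod_iff' measurable_pairKernel_prod.aestronglyMeasurable]
  refine ⟨ae_of_all _ fun p => integrableOn_strip_pairKernel p.1 p.2 hδ, ?_⟩
  refine Integrable.of_bound
    measurable_pairKernel_prod.stronglyMeasurable.norm.integral_prod_left.aestronglyMeasurable
    (2 * (Real.pi * (Real.log (4 * Y ^ 2) - Real.log (4 * δ ^ 2)))) (ae_of_all _ fun p => ?_)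
  rw [Real.norm_of_nonneg (integral_nonneg fun _ => norm_nonneg _)]
  have e : ∀ s : ℝ, ∫ z in strip δ Y, pairKernel s s z.re z.im =
      Real.pi * (Real.log (4 * Y ^ 2) - Real.log (4 * δ ^ 2)) := by
    intro s
    rw [integral_strip_pairKernel s s hδ hY]
    simp
  have i := fun s t => integrableOn_strip_pairKernel s t (Y := Y) hδ
  calc ∫ z in strip δ Y, ‖pairKernel p.1 p.2 z.re z.im‖
      ≤ ∫ z in strip δ Y, (pairKernel p.1 p.1 z.re z.im + pairKernel p.2 p.2 z.re z.im) := by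
        refine setIntegral_mono_on (i _ _).norm ((i _ _).add (i _ _)) (measurableSet_strip δ Y)
          fun z hz => ?_
        rw [pairKernel_self _ _ (ne_zero_of_mem_strip hδ hz),
          pairKernel_self _ _ (ne_zero_of_mem_strip hδ hz)]
        exact abs_pairKernel_le _ _ _ _
    _ = _ := by
        rw [integral_add (i _ _) (i _ _), e, e]; ring

/-- `∬ log ((s - t)² + 4 ε²) dμ(s) dν(t)`. -/
noncomputable def smearedEnergy (ε : ℝ) (μ ν : Measure ℝ) : ℝ :=
  ∫ p, Real.log ((p.1 - p.2) ^ 2 + 4 * ε ^ 2) ∂μ.prod ν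

lemma ae_abs_sub_le {μ ν : Measure ℝ} [SFinite μ] [SFinite ν] {L : ℝ} (hμ : ∀ᵐ t ∂μ, |t| ≤ L)
    (hν : ∀ᵐ t ∂ν, |t| ≤ L) : ∀ᵐ p ∂μ.prod ν, |p.1 - p.2| ≤ 2 * L := by
  filter_upwards [(Measure.quasiMeasurePreserving_fst (μ := μ) (ν := ν)).ae hμ,
    (Measure.quasiMeasurePreserving_snd (μ := μ) (ν := ν)).ae hν] with p h1 h2
  exact (abs_sub _ _).trans (by linarith)

lemma measurable_log_smeared (ε : ℝ) :
    Measurable fun p : ℝ × ℝ => Real.log ((p.1 - p.2) ^ 2 + 4 * ε ^ 2) :=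
  Real.measurable_log.comp (by fun_prop)

lemma log_smeared_sub (u : ℝ) {ε : ℝ} (hε : 0 < ε) :
    |Real.log (u ^ 2 + 4 * ε ^ 2) - Real.log (4 * ε ^ 2)| ≤ u ^ 2 / (4 * ε ^ 2) := by
  rw [← Real.log_div (by positivity) (by positivity), abs_of_nonneg]
  · refine (Real.log_le_sub_one_of_pos (by positivity)).trans (le_of_eq ?_)
    field_simp
    ring
  · refine Real.log_nonneg ?_
    rw [le_div_iff₀ (by positivity)]
    nlinarith [sq_nonneg u]

section

variable {μ ν : Measure ℝ} [IsFiniteMeasure μ] [IsFiniteMeasure ν] {L : ℝ}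
  (hμ : ∀ᵐ t ∂μ, |t| ≤ L) (hν : ∀ᵐ t ∂ν, |t| ≤ L)

include hμ hν

lemma ae_log_smeared_sub_le {ε : ℝ} (hε : 0 < ε) : ∀ᵐ p ∂μ.prod ν,
    ‖Real.log ((p.1 - p.2) ^ 2 + 4 * ε ^ 2) - Real.log (4 * ε ^ 2)‖ ≤ L ^ 2 / ε ^ 2 := by
  filter_upwards [ae_abs_sub_le hμ hν] with p hp
  refine (log_smeared_sub _ hε).trans ?_
  have h : (p.1 - p.2) ^ 2 ≤ 4 * L ^ 2 := by
    rw [← sq_abs]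
    calc |p.1 - p.2| ^ 2 ≤ (2 * L) ^ 2 := by gcongr
      _ = _ := by ring
  rw [div_le_div_iff₀ (by positivity) (by positivity)]
  nlinarith [sq_nonneg ε]

lemma integrable_log_smeared {ε : ℝ} (hε : 0 < ε) :
    Integrable (fun p : ℝ × ℝ => Real.log ((p.1 - p.2) ^ 2 + 4 * ε ^ 2)) (μ.prod ν) := by
  have h : Integrable (fun p : ℝ × ℝ => Real.log ((p.1 - p.2) ^ 2 + 4 * ε ^ 2) -
      Real.log (4 * ε ^ 2)) (μ.prod ν) :=
    Integrable.of_bound ((measurable_log_smeared ε).sub_const _).aestronglyMeasurable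
      (L ^ 2 / ε ^ 2) (ae_log_smeared_sub_le hμ hν hε)
  refine (h.add (integrable_const (Real.log (4 * ε ^ 2)))).congr (ae_of_all _ fun p => ?_)
  simp

lemma integral_strip_cauchyTransform {δ Y : ℝ} (hδ : 0 < δ) (hY : δ ≤ Y) :
    IntegrableOn (fun z => (cauchyTransform μ z * (starRingEnd ℂ) (cauchyTransform ν z)).re)
      (strip δ Y) ∧
    ∫ z in strip δ Y, (cauchyTransform μ z * (starRingEnd ℂ) (cauchyTransform ν z)).re =
      Real.pi * (smearedEnergy Y μ ν - smearedEnergy δ μ ν) := by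
  have hI := integrable_strip_prod μ ν hδ hY
  have hae : (fun z : ℂ => ∫ p, pairKernel p.1 p.2 z.re z.im ∂μ.prod ν)
      =ᵐ[volume.restrict (strip δ Y)]
      fun z => (cauchyTransform μ z * (starRingEnd ℂ) (cauchyTransform ν z)).re := by
    filter_upwards [ae_restrict_mem (measurableSet_strip δ Y)] with z hz
    exact (re_cauchyTransform_mul_conj μ ν (ne_zero_of_mem_strip hδ hz)).symm
  refine ⟨hI.integral_prod_left.congr hae, ?_⟩
  rw [← integral_congr_ae hae, integral_integral_swap hI]
  simp only [integral_strip_pairKernel _ _ hδ hY]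
  rw [integral_const_mul, integral_sub (integrable_log_smeared hμ hν (hδ.trans_le hY))
    (integrable_log_smeared hμ hν hδ)]
  rfl

/-- For `Y` much larger than the supports all pairs interact equally up to `O(Y⁻²)`, so only the
product of the masses is seen. -/
lemma tendsto_smearedEnergy_atTop :
    Tendsto (fun Y => smearedEnergy Y μ ν - Real.log (4 * Y ^ 2) * (μ.prod ν).real Set.univ)
      atTop (𝓝 0) := by
  have h0 : Tendsto (fun Y : ℝ => L ^ 2 / Y ^ 2 * (μ.prod ν).real Set.univ) atTop (𝓝 0) := by
    have := (tendsto_const_nhds (x := L ^ 2)).div_atTop (tendsto_pow_atTop (α := ℝ) two_ne_zero)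
    simpa using this.mul_const ((μ.prod ν).real Set.univ)
  refine squeeze_zero_norm' ?_ h0
  filter_upwards [eventually_gt_atTop 0] with Y hY
  have e : smearedEnergy Y μ ν - Real.log (4 * Y ^ 2) * (μ.prod ν).real Set.univ =
      ∫ p, (Real.log ((p.1 - p.2) ^ 2 + 4 * Y ^ 2) - Real.log (4 * Y ^ 2)) ∂μ.prod ν := by
    rw [integral_sub (integrable_log_smeared hμ hν hY) (integrable_const _), integral_const,
      smul_eq_mul, mul_comm, smearedEnergy]
  rw [e]
  exact norm_integral_le_of_norm_le_const (ae_log_smeared_sub_le hμ hν hY)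

/-- Dominated convergence: for `δ < 1` the integrand lies between `2 log |s - t|` and `log (4 L² +
4)`. -/
lemma tendsto_smearedEnergy_zero (h : HasMutualEnergy μ ν) :
    Tendsto (fun δ => smearedEnergy δ μ ν) (𝓝[>] 0) (𝓝 (-2 * mutualEnergy μ ν)) := by
  have hval : -2 * mutualEnergy μ ν = ∫ p, 2 * Real.log |p.1 - p.2| ∂μ.prod ν := by
    rw [mutualEnergy, integral_neg, integral_const_mul]; ring
  rw [hval]
  refine tendsto_integral_filter_of_dominated_convergence
    (fun p : ℝ × ℝ => 2 * abs (Real.log (abs (p.1 - p.2))) + abs (Real.log (4 * L ^ 2 + 4)))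
    (Eventually.of_forall fun δ => (measurable_log_smeared δ).aestronglyMeasurable) ?_
    ((h.integrable.abs.const_mul 2).add (integrable_const _)) ?_
  · filter_upwards [Ioo_mem_nhdsGT one_pos] with δ hδ
    filter_upwards [h.ae_ne, ae_abs_sub_le hμ hν] with p hp hpL
    have hpos : 0 < |p.1 - p.2| := abs_pos.2 (sub_ne_zero.2 hp)
    have h1 : 2 * Real.log |p.1 - p.2| ≤ Real.log ((p.1 - p.2) ^ 2 + 4 * δ ^ 2) := by
      rw [← sq_abs (p.1 - p.2), ← Nat.cast_ofNat, ← Real.log_pow]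
      exact Real.log_le_log (by positivity) (by nlinarith [sq_nonneg δ])
    have h2 : Real.log ((p.1 - p.2) ^ 2 + 4 * δ ^ 2) ≤ Real.log (4 * L ^ 2 + 4) := by
      refine Real.log_le_log (by rw [← sq_abs (p.1 - p.2)]; positivity) ?_
      have := hδ.1
      have : δ ^ 2 ≤ 1 := pow_le_one₀ hδ.1.le hδ.2.le
      have h : (p.1 - p.2) ^ 2 ≤ 4 * L ^ 2 := by
        rw [← sq_abs]
        calc |p.1 - p.2| ^ 2 ≤ (2 * L) ^ 2 := by gcongr
          _ = _ := by ring
      linarith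
    rw [Real.norm_eq_abs, abs_le]
    constructor
    · linarith [neg_abs_le (Real.log |p.1 - p.2|), abs_nonneg (Real.log (4 * L ^ 2 + 4))]
    · linarith [le_abs_self (Real.log (4 * L ^ 2 + 4)), abs_nonneg (Real.log |p.1 - p.2|)]
  · filter_upwards [h.ae_ne] with p hp
    have hpos : 0 < |p.1 - p.2| := abs_pos.2 (sub_ne_zero.2 hp)
    have hc : Tendsto (fun δ : ℝ => (p.1 - p.2) ^ 2 + 4 * δ ^ 2) (𝓝[>] 0)
        (𝓝 ((p.1 - p.2) ^ 2 + 4 * 0 ^ 2)) :=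
      ((by fun_prop : Continuous fun δ : ℝ => (p.1 - p.2) ^ 2 + 4 * δ ^ 2).tendsto 0).mono_left
        nhdsWithin_le_nhds
    have e : (p.1 - p.2) ^ 2 + 4 * 0 ^ 2 = |p.1 - p.2| ^ 2 := by rw [sq_abs]; ring
    rw [e] at hc
    have := hc.log (by positivity)
    rwa [Real.log_pow, Nat.cast_ofNat] at this

end

/-! ### Finite sums of point charges -/

/-- The sum of unit point charges at the points of `Λ`. -/
noncomputable def pointMeasure (Λ : Finset ℝ) : Measure ℝ := ∑ p ∈ Λ, Measure.dirac p

instance (Λ : Finset ℝ) : IsFiniteMeasure (pointMeasure Λ) := by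
  unfold pointMeasure; infer_instance

lemma integral_pointMeasure {E : Type*} [NormedAddCommGroup E] [NormedSpace ℝ E] [CompleteSpace E]
    (Λ : Finset ℝ) (f : ℝ → E) : ∫ t, f t ∂pointMeasure Λ = ∑ p ∈ Λ, f p := by
  rw [pointMeasure, integral_finsetSum_measure fun p _ => integrable_dirac (by simp)]
  simp

lemma pointMeasure_univ (Λ : Finset ℝ) : (pointMeasure Λ).real Set.univ = Λ.card := by
  have := integral_pointMeasure Λ (fun _ => (1 : ℝ))
  simpa using this

lemma ae_pointMeasure {Λ : Finset ℝ} {P : ℝ → Prop} (h : ∀ p ∈ Λ, P p) :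
    ∀ᵐ t ∂pointMeasure Λ, P t := by
  rw [ae_iff, pointMeasure, Measure.finsetSum_apply, Finset.sum_eq_zero]
  intro p hp
  simp [Measure.dirac_apply, h p hp]

lemma smearedEnergy_pointMeasure {Λ : Finset ℝ} {L : ℝ} (hΛ : ∀ p ∈ Λ, |p| ≤ L) {ε : ℝ}
    (hε : 0 < ε) : smearedEnergy ε (pointMeasure Λ) (pointMeasure Λ) =
      ∑ p ∈ Λ, ∑ q ∈ Λ.erase p, Real.log ((p - q) ^ 2 + 4 * ε ^ 2) +
        Λ.card * Real.log (4 * ε ^ 2) := by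
  have h := integrable_log_smeared (ae_pointMeasure hΛ) (ae_pointMeasure hΛ) hε
  rw [smearedEnergy, integral_prod _ h]
  simp only [integral_pointMeasure]
  rw [← nsmul_eq_mul, ← Finset.sum_const, ← Finset.sum_add_distrib]
  refine Finset.sum_congr rfl fun p hp => ?_
  rw [← Finset.add_sum_erase _ _ hp, add_comm]
  simp

lemma mutualEnergy_pointMeasure {Λ : Finset ℝ} {μ : Measure ℝ} [IsFiniteMeasure μ]
    (h : HasMutualEnergy (pointMeasure Λ) μ) :
    mutualEnergy (pointMeasure Λ) μ = ∑ p ∈ Λ, logPotential μ p := by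
  rw [mutualEnergy_eq_integral_logPotential h, integral_pointMeasure]

/-- The asymptotics of the energy on strips, of a neutral system of distinct unit charges with a
background of bounded density. -/
lemma tendsto_integral_strip {Λ : Finset ℝ} {M : Measure ℝ} [IsFiniteMeasure M] {C : NNReal}
    {L : ℝ} (hΛ : ∀ p ∈ Λ, |p| ≤ L) (hM : BoundedDensity M C L)
    (hneutral : M.real Set.univ = Λ.card) :
    Tendsto (fun δ : ℝ => (∫ z in strip δ δ⁻¹,
        ‖cauchyTransform (pointMeasure Λ) z - cauchyTransform M z‖ ^ 2) +
          2 * Real.pi * Λ.card * Real.log δ) (𝓝[>] 0)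
      (𝓝 (2 * Real.pi * (-∑ p ∈ Λ, ∑ q ∈ Λ.erase p, Real.log |p - q| -
        2 * ∑ p ∈ Λ, logPotential M p + mutualEnergy M M - Λ.card * Real.log 2))) := by
  set P := pointMeasure Λ
  have hP : ∀ᵐ t ∂P, |t| ≤ L := ae_pointMeasure hΛ
  have hPM : HasMutualEnergy P M := hM.hasMutualEnergy hP
  have hMM : HasMutualEnergy M M := hM.hasMutualEnergy hM.bdd
  have hformula : ∀ δ Y : ℝ, 0 < δ → δ ≤ Y →
      ∫ z in strip δ Y, ‖cauchyTransform P z - cauchyTransform M z‖ ^ 2 =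
        Real.pi * ((smearedEnergy Y P P - 2 * smearedEnergy Y P M + smearedEnergy Y M M) -
          (smearedEnergy δ P P - 2 * smearedEnergy δ P M + smearedEnergy δ M M)) := by
    intro δ Y hδ hY
    obtain ⟨i1, e1⟩ := integral_strip_cauchyTransform hP hP hδ hY
    obtain ⟨i2, e2⟩ := integral_strip_cauchyTransform hP hM.bdd hδ hY
    obtain ⟨i3, e3⟩ := integral_strip_cauchyTransform hM.bdd hM.bdd hδ hY
    have : ∀ z, ‖cauchyTransform P z - cauchyTransform M z‖ ^ 2 =
        ((cauchyTransform P z * (starRingEnd ℂ) (cauchyTransform P z)).re -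
          2 * (cauchyTransform P z * (starRingEnd ℂ) (cauchyTransform M z)).re) +
          (cauchyTransform M z * (starRingEnd ℂ) (cauchyTransform M z)).re := by
      intro z
      rw [← Complex.normSq_eq_norm_sq, Complex.normSq_apply]
      simp
      ring
    have i12 : IntegrableOn (fun z => (cauchyTransform P z *
        (starRingEnd ℂ) (cauchyTransform P z)).re -
        2 * (cauchyTransform P z * (starRingEnd ℂ) (cauchyTransform M z)).re) (strip δ Y) :=
      i1.sub (i2.const_mul 2)
    simp only [this]
    rw [integral_add i12 i3, integral_sub i1 (i2.const_mul 2),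
      integral_const_mul, e1, e2, e3]
    ring
  -- Neutrality: the coefficient of `log (4 Y²)` is the square of the difference of the two masses,
  -- which is zero.
  have hY : Tendsto (fun Y => smearedEnergy Y P P - 2 * smearedEnergy Y P M +
      smearedEnergy Y M M) atTop (𝓝 0) := by
    have h := ((tendsto_smearedEnergy_atTop hP hP).sub
      ((tendsto_smearedEnergy_atTop hP hM.bdd).const_mul 2)).add
      (tendsto_smearedEnergy_atTop hM.bdd hM.bdd)
    have mass : ∀ (μ ν : Measure ℝ) [IsFiniteMeasure μ] [IsFiniteMeasure ν],
        (μ.prod ν).real Set.univ = μ.real Set.univ * ν.real Set.univ := by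
      intro μ ν _ _
      rw [← Set.univ_prod_univ, measureReal_prod_prod]
    simp only [mass, hneutral, P, pointMeasure_univ] at h
    refine (h.congr fun Y => ?_).trans (by simp)
    ring
  -- Only the self-interactions of the point charges diverge, and they contribute exactly `Λ.card *
  -- log (4 δ²)`.
  have hδ : Tendsto (fun δ => smearedEnergy δ P P - Λ.card * Real.log (4 * δ ^ 2) -
      2 * smearedEnergy δ P M + smearedEnergy δ M M) (𝓝[>] 0)
      (𝓝 (∑ p ∈ Λ, ∑ q ∈ Λ.erase p, 2 * Real.log |p - q| - 2 * (-2 * mutualEnergy P M) +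
        (-2 * mutualEnergy M M))) := by
    refine Tendsto.add (Tendsto.sub ?_ ((tendsto_smearedEnergy_zero hP hM.bdd hPM).const_mul 2))
      (tendsto_smearedEnergy_zero hM.bdd hM.bdd hMM)
    have hsum : Tendsto (fun δ : ℝ =>
        ∑ p ∈ Λ, ∑ q ∈ Λ.erase p, Real.log ((p - q) ^ 2 + 4 * δ ^ 2)) (𝓝[>] 0)
        (𝓝 (∑ p ∈ Λ, ∑ q ∈ Λ.erase p, 2 * Real.log |p - q|)) := by
      refine tendsto_finsetSum _ fun p hp => tendsto_finsetSum _ fun q hq => ?_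
      have hne : 0 < |p - q| := abs_pos.2 (sub_ne_zero.2 (Finset.ne_of_mem_erase hq).symm)
      have hc : Tendsto (fun δ : ℝ => (p - q) ^ 2 + 4 * δ ^ 2) (𝓝[>] 0)
          (𝓝 ((p - q) ^ 2 + 4 * 0 ^ 2)) :=
        ((by fun_prop : Continuous fun δ : ℝ => (p - q) ^ 2 + 4 * δ ^ 2).tendsto 0).mono_left
          nhdsWithin_le_nhds
      have e : (p - q) ^ 2 + 4 * 0 ^ 2 = |p - q| ^ 2 := by rw [sq_abs]; ring
      rw [e] at hc
      have := hc.log (by positivity)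
      rwa [Real.log_pow, Nat.cast_ofNat] at this
    refine hsum.congr' ?_
    filter_upwards [self_mem_nhdsWithin] with δ hδ
    rw [smearedEnergy_pointMeasure hΛ hδ]
    ring
  -- With `Y = δ⁻¹`. Writing `log (4 δ²) = log 4 + 2 log δ`, the second term is balanced by the
  -- counterterm and the first leaves the constant in `log 2`.
  have hlim := (((hY.comp tendsto_inv_nhdsGT_zero).sub hδ).const_mul Real.pi).sub_const
    (Real.pi * Λ.card * Real.log 4)
  have hval : Real.pi * (0 - (∑ p ∈ Λ, ∑ q ∈ Λ.erase p, 2 * Real.log |p - q| -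
      2 * (-2 * mutualEnergy P M) + (-2 * mutualEnergy M M))) - Real.pi * Λ.card * Real.log 4 =
      2 * Real.pi * (-∑ p ∈ Λ, ∑ q ∈ Λ.erase p, Real.log |p - q| -
        2 * ∑ p ∈ Λ, logPotential M p + mutualEnergy M M - Λ.card * Real.log 2) := by
    have h4 : Real.log 4 = 2 * Real.log 2 := by
      rw [show (4 : ℝ) = 2 ^ 2 by norm_num, Real.log_pow]; norm_num
    rw [mutualEnergy_pointMeasure hPM, h4]
    simp only [← Finset.mul_sum]
    ring
  rw [hval] at hlim
  refine hlim.congr' ?_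
  filter_upwards [Ioo_mem_nhdsGT one_pos] with δ hδ
  have hle : δ ≤ δ⁻¹ := hδ.2.le.trans ((one_le_inv₀ hδ.1).2 hδ.2.le)
  rw [hformula δ δ⁻¹ hδ.1 hle, Real.log_mul (by norm_num) (pow_ne_zero 2 hδ.1.ne'), Real.log_pow]
  simp only [Function.comp_apply, Nat.cast_ofNat]
  ring

/-! ### The inverse square kernel of a disc -/

/-- The kernel `‖z - p‖⁻²` cut off outside the disc of radius `R` about `p`. -/
noncomputable def discKernel (R p : ℝ) : ℂ → ℝ :=
  (Metric.ball (p : ℂ) R).indicator fun z => (‖z - p‖ ^ 2)⁻¹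

lemma measurable_discKernel (R p : ℝ) : Measurable (discKernel R p) :=
  Measurable.indicator (by fun_prop) Metric.isOpen_ball.measurableSet

lemma discKernel_nonneg (R p : ℝ) (z : ℂ) : 0 ≤ discKernel R p z :=
  Set.indicator_nonneg (fun _ _ => by positivity) _

lemma discKernel_of_notMem {R p : ℝ} {z : ℂ} (h : R ≤ ‖z - p‖) : discKernel R p z = 0 :=
  Set.indicator_of_notMem (by simpa [dist_eq_norm] using h) _

lemma integrableOn_discKernel {R p η : ℝ} (hη : 0 < η) {S : Set ℂ} (hS : MeasurableSet S)
    (h : ∀ z ∈ S, η ≤ ‖z - p‖) : IntegrableOn (discKernel R p) S := by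
  have : IntegrableOn (fun _ => (η ^ 2)⁻¹) (Metric.ball (p : ℂ) R) :=
    integrableOn_const (by exact measure_ball_lt_top.ne)
  refine (((integrable_indicator_iff Metric.isOpen_ball.measurableSet).2 this).integrableOn
    (s := S)).mono' (measurable_discKernel R p).aestronglyMeasurable ?_
  filter_upwards [ae_restrict_mem hS] with z hz
  rw [Real.norm_of_nonneg (discKernel_nonneg _ _ _), discKernel]
  refine Set.indicator_le_indicator ?_
  have := h z hz
  gcongr

lemma norm_polar {r θ : ℝ} (hr : 0 < r) : ‖Complex.polarCoord.symm (r, θ)‖ = r := by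
  rw [Complex.norm_polarCoord_symm, abs_of_pos hr]

lemma im_polar (r θ : ℝ) : (Complex.polarCoord.symm (r, θ)).im = r * Real.sin θ := by
  rw [Complex.polarCoord_symm_apply]
  simp [-Complex.ofReal_cos, -Complex.ofReal_sin]

lemma integral_inv_indicator {a b : ℝ} (ha : 0 < a) (hab : a ≤ b) :
    ∫ r in Set.Ioi (0 : ℝ), (Set.Ioo a b).indicator (fun r => r⁻¹) r = Real.log (b / a) := by
  rw [setIntegral_indicator measurableSet_Ioo,
    Set.inter_eq_right.2 (show Set.Ioo a b ⊆ Set.Ioi 0 from fun y hy => ha.trans hy.1),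
    ← integral_Ioc_eq_integral_Ioo, ← intervalIntegral.integral_of_le hab,
    integral_inv_of_pos ha (ha.trans_le hab)]

/-- In polar coordinates about `p` the integrand becomes `1/r` on `[η, R)`. -/
lemma setIntegral_compl_ball_discKernel {R p η : ℝ} (hη : 0 < η) (hR : η ≤ R) :
    ∫ z in (Metric.ball (p : ℂ) η)ᶜ, discKernel R p z = 2 * Real.pi * Real.log (R / η) := by
  rw [← integral_indicator Metric.isOpen_ball.measurableSet.compl,
    ← integral_add_right_eq_self _ (p : ℂ), ← Complex.integral_comp_polarCoord_symm]
  have e : ∀ q ∈ polarCoord.target, q.1 • (Metric.ball (p : ℂ) η)ᶜ.indicator (discKernel R p)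
      (Complex.polarCoord.symm q + p) = (Set.Ico η R).indicator (fun r => r⁻¹) q.1 * 1 := by
    rintro ⟨r, θ⟩ hq
    have hr : 0 < r := hq.1
    by_cases h1 : η ≤ r
    · rw [Set.indicator_of_mem (by simpa [dist_eq_norm, abs_of_pos hr] using h1)]
      by_cases h2 : r < R
      · rw [discKernel, Set.indicator_of_mem (by simpa [dist_eq_norm, abs_of_pos hr] using h2),
          Set.indicator_of_mem (show (r, θ).1 ∈ Set.Ico η R from ⟨h1, h2⟩), add_sub_cancel_right,
          norm_polar hr, smul_eq_mul]
        field_simp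
      · rw [discKernel_of_notMem (by simpa [abs_of_pos hr] using h2),
          Set.indicator_of_notMem (show (r, θ).1 ∉ Set.Ico η R from fun h => h2 h.2)]
        simp
    · rw [Set.indicator_of_notMem (by simpa [dist_eq_norm, abs_of_pos hr] using h1),
        Set.indicator_of_notMem (show (r, θ).1 ∉ Set.Ico η R from fun h => h1 h.1)]
      simp
  have e2 : ∫ r in Set.Ioi (0 : ℝ), (Set.Ico η R).indicator (fun r => r⁻¹) r =
      Real.log (R / η) := by
    rw [← integral_inv_indicator hη hR]
    refine integral_congr_ae (ae_restrict_of_ae ?_)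
    exact (indicator_ae_eq_of_ae_eq_set Ioo_ae_eq_Ico).symm
  rw [setIntegral_congr_fun polarCoord.open_target.measurableSet e, polarCoord_target,
    Measure.volume_eq_prod, setIntegral_prod_mul _ (fun _ => (1 : ℝ)), e2]
  simp [Real.pi_pos.le]
  ring

lemma integral_Ioo_pi_log_abs_sin :
    IntegrableOn (fun θ => Real.log |Real.sin θ|) (Set.Ioo (-Real.pi) Real.pi) ∧
    ∫ θ in Set.Ioo (-Real.pi) Real.pi, Real.log |Real.sin θ| = -(2 * Real.pi * Real.log 2) := by
  have hle : -Real.pi ≤ Real.pi := by linarith [Real.pi_pos]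
  have hi : ∀ a b, IntervalIntegrable (fun θ => Real.log (Real.sin θ)) volume a b :=
    fun a b => intervalIntegrable_log_sin
  simp only [Real.log_abs]
  constructor
  · exact (((intervalIntegrable_iff_integrableOn_Ioc_of_le hle).1 (hi _ _))).mono_set
      Set.Ioo_subset_Ioc_self
  · rw [← integral_Ioc_eq_integral_Ioo, ← intervalIntegral.integral_of_le hle,
      ← intervalIntegral.integral_add_adjacent_intervals (hi (-Real.pi) 0) (hi 0 Real.pi),
      integral_log_sin_zero_pi]
    have := intervalIntegral.integral_comp_neg (a := 0) (b := Real.pi)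
      (fun θ => Real.log (Real.sin θ))
    simp only [Real.sin_neg, Real.log_neg_eq_log, neg_zero] at this
    rw [← this, integral_log_sin_zero_pi]
    ring

lemma tendsto_integral_max_log_sin :
    Tendsto (fun ε : ℝ => ∫ θ in Set.Ioo (-Real.pi) Real.pi,
      max (Real.log ε) (Real.log |Real.sin θ|)) (𝓝[>] 0) (𝓝 (-(2 * Real.pi * Real.log 2))) := by
  rw [← integral_Ioo_pi_log_abs_sin.2]
  refine tendsto_integral_filter_of_dominated_convergence
    (fun θ : ℝ => ‖Real.log (abs (Real.sin θ))‖) (Eventually.of_forall fun ε => ?_) ?_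
    integral_Ioo_pi_log_abs_sin.1.norm (ae_of_all _ fun θ => ?_)
  · exact (measurable_const.max
      (Real.measurable_log.comp Real.measurable_sin.abs)).aestronglyMeasurable
  · filter_upwards [Ioo_mem_nhdsGT one_pos] with ε hε
    refine ae_of_all _ fun θ => ?_
    have h1 : Real.log ε ≤ 0 := Real.log_nonpos hε.1.le hε.2.le
    have h2 : Real.log |Real.sin θ| ≤ 0 := Real.log_nonpos (abs_nonneg _) (Real.abs_sin_le_one θ)
    rw [Real.norm_eq_abs, Real.norm_eq_abs, abs_of_nonpos (max_le h1 h2), abs_of_nonpos h2]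
    exact neg_le_neg (le_max_right _ _)
  · refine tendsto_const_nhds.congr' ?_
    have := Real.tendsto_log_nhdsGT_zero.eventually_le_atBot (Real.log |Real.sin θ|)
    filter_upwards [this] with ε hε
    exact (max_eq_right hε).symm

/-- The ray of angle `θ` from `p` meets the strip inside the disc for `δ / |sin θ| < r < R`, the
upper edge being out of reach since `R ≤ Y`. The integral of `dr/r` is the positive part of `log (R
|sin θ| / δ)`, written here with a `max`. -/
lemma setIntegral_strip_discKernel {R p δ Y : ℝ} (hδ : 0 < δ) (hδR : δ < R) (hY : R ≤ Y) :
    ∫ z in strip δ Y, discKernel R p z =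
      (∫ θ in Set.Ioo (-Real.pi) Real.pi, max (Real.log (δ / R)) (Real.log |Real.sin θ|)) -
        2 * Real.pi * Real.log (δ / R) := by
  have hR : 0 < R := hδ.trans hδR
  set G : ℝ × ℝ → ℝ := fun q =>
    {q : ℝ × ℝ | δ < q.1 * |Real.sin q.2| ∧ q.1 < R}.indicator (fun q => q.1⁻¹) q with hG
  have hGm : Measurable G := by
    refine Measurable.indicator (by fun_prop) ?_
    exact (measurableSet_lt measurable_const
      (measurable_fst.mul (Real.measurable_sin.comp measurable_snd).abs)).inter
      (measurableSet_lt measurable_fst measurable_const)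
  have e : ∀ q ∈ polarCoord.target, q.1 • (strip δ Y).indicator (discKernel R p)
      (Complex.polarCoord.symm q + p) = G q := by
    rintro ⟨r, θ⟩ hq
    have hr : 0 < r := hq.1
    have him : |(Complex.polarCoord.symm (r, θ) + (p : ℂ)).im| = r * |Real.sin θ| := by
      rw [Complex.add_im, Complex.ofReal_im, add_zero, im_polar, abs_mul, abs_of_pos hr]
    by_cases h2 : r < R
    · by_cases h1 : δ < r * |Real.sin θ|
      · have hlt : r * |Real.sin θ| < Y :=
          (mul_le_of_le_one_right hr.le (Real.abs_sin_le_one θ)).trans_lt (h2.trans_le hY)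
        rw [Set.indicator_of_mem (show _ ∈ strip δ Y by
            rw [strip, Set.mem_ofPred_eq, him]; exact ⟨h1, hlt⟩), discKernel,
          Set.indicator_of_mem (by simpa [dist_eq_norm, abs_of_pos hr] using h2), hG]
        simp only
        rw [Set.indicator_of_mem (show (r, θ) ∈ {q : ℝ × ℝ | δ < q.1 * |Real.sin q.2| ∧ q.1 < R}
          from ⟨h1, h2⟩), add_sub_cancel_right, norm_polar hr, smul_eq_mul]
        field_simp
      · rw [Set.indicator_of_notMem (show _ ∉ strip δ Y by
            rw [strip, Set.mem_ofPred_eq, him]; exact fun h => h1 h.1), hG]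
        simp only
        rw [Set.indicator_of_notMem (show (r, θ) ∉
          {q : ℝ × ℝ | δ < q.1 * |Real.sin q.2| ∧ q.1 < R} from fun h => h1 h.1), smul_zero]
    · have h0 : discKernel R p (Complex.polarCoord.symm (r, θ) + p) = 0 :=
        discKernel_of_notMem (by simpa [abs_of_pos hr] using h2)
      have h3 : (strip δ Y).indicator (discKernel R p) (Complex.polarCoord.symm (r, θ) + p) = 0 :=
        Set.indicator_apply_eq_zero.2 fun _ => h0
      rw [h3, hG]
      simp only
      rw [Set.indicator_of_notMem (show (r, θ) ∉
          {q : ℝ × ℝ | δ < q.1 * |Real.sin q.2| ∧ q.1 < R} from fun h => h2 h.2), smul_zero]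
  -- Where `G` is nonzero, `δ < r |sin θ| ≤ r`, so `δ⁻¹` bounds it on a bounded set.
  have hGint : IntegrableOn G (Set.Ioi 0 ×ˢ Set.Ioo (-Real.pi) Real.pi) := by
    have hc : IntegrableOn (fun _ : ℝ × ℝ => δ⁻¹) (Set.Ioo 0 R ×ˢ Set.Ioo (-Real.pi) Real.pi) := by
      refine integrableOn_const ?_
      rw [Measure.volume_eq_prod, Measure.prod_prod]
      exact ENNReal.mul_ne_top (by simp) (by simp)
    have hc' := ((integrable_indicator_iff (measurableSet_Ioo.prod measurableSet_Ioo)).2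
      hc).integrableOn (s := Set.Ioi 0 ×ˢ Set.Ioo (-Real.pi) Real.pi)
    refine hc'.mono' hGm.aestronglyMeasurable ?_
    filter_upwards [ae_restrict_mem (measurableSet_Ioi.prod measurableSet_Ioo)] with q hq
    have hq1 : 0 < q.1 := hq.1
    by_cases h : q ∈ {q : ℝ × ℝ | δ < q.1 * |Real.sin q.2| ∧ q.1 < R}
    · rw [hG]
      simp only
      rw [Set.indicator_of_mem h, Set.indicator_of_mem (show q ∈ Set.Ioo 0 R ×ˢ Set.Ioo (-Real.pi) Real.pi from
          ⟨⟨hq1, h.2⟩, hq.2⟩),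
        Real.norm_of_nonneg (inv_nonneg.2 hq1.le)]
      have := h.1.le.trans (mul_le_of_le_one_right hq1.le (Real.abs_sin_le_one q.2))
      gcongr
    · rw [hG]
      simp only
      rw [Set.indicator_of_notMem h, norm_zero]
      exact Set.indicator_nonneg (fun _ _ => by positivity) _
  rw [← integral_indicator (measurableSet_strip δ Y),
    ← integral_add_right_eq_self _ (p : ℂ), ← Complex.integral_comp_polarCoord_symm,
    setIntegral_congr_fun polarCoord.open_target.measurableSet e, polarCoord_target]
  have hinner : ∀ θ : ℝ, Real.sin θ ≠ 0 → ∫ r in Set.Ioi (0 : ℝ), G (r, θ) =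
      max (Real.log (δ / R)) (Real.log |Real.sin θ|) - Real.log (δ / R) := by
    intro θ hs
    have hs' : 0 < |Real.sin θ| := abs_pos.2 hs
    have hGe : ∀ r, G (r, θ) = (Set.Ioo (δ / |Real.sin θ|) R).indicator (fun r => r⁻¹) r := by
      intro r
      rw [hG]
      simp only [Set.indicator_apply, Set.mem_ofPred_eq, Set.mem_Ioo, div_lt_iff₀ hs']
    simp only [hGe]
    rcases le_total (δ / |Real.sin θ|) R with h | h
    · rw [integral_inv_indicator (by positivity) h, max_eq_right]
      · rw [← Real.log_div (by positivity) (by positivity)]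
        congr 1
        field_simp
      · refine Real.log_le_log (by positivity) ?_
        rw [div_le_iff₀ hR]
        rw [div_le_iff₀ hs'] at h
        linarith
    · rw [Set.Ioo_eq_empty (not_lt.2 h), Set.indicator_empty, max_eq_left]
      · simp
      · refine Real.log_le_log (by positivity) ?_
        rw [le_div_iff₀ hR]
        rw [le_div_iff₀ hs'] at h
        linarith
  have hae : ∀ᵐ θ ∂volume.restrict (Set.Ioo (-Real.pi) Real.pi), Real.sin θ ≠ 0 := by
    have h0 : ∀ᵐ θ : ℝ, θ ∉ ({0} : Set ℝ) :=
      measure_eq_zero_iff_ae_notMem.1 (measure_singleton 0)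
    filter_upwards [ae_restrict_mem measurableSet_Ioo, ae_restrict_of_ae h0] with θ h1 h2 h3
    exact h2 ((Real.sin_eq_zero_iff_of_lt_of_lt h1.1 h1.2).1 h3)
  have hswap : ∫ q in Set.Ioi 0 ×ˢ Set.Ioo (-Real.pi) Real.pi, G q =
      ∫ θ in Set.Ioo (-Real.pi) Real.pi, ∫ r in Set.Ioi (0 : ℝ), G (r, θ) := by
    rw [IntegrableOn, Measure.volume_eq_prod, ← Measure.prod_restrict] at hGint
    rw [Measure.volume_eq_prod, ← Measure.prod_restrict, integral_prod_symm _ hGint]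
  have hmax : IntegrableOn (fun θ => max (Real.log (δ / R)) (Real.log |Real.sin θ|))
      (Set.Ioo (-Real.pi) Real.pi) :=
    Integrable.sup (integrableOn_const (by simp)) integral_Ioo_pi_log_abs_sin.1
  rw [hswap, integral_congr_ae (hae.mono hinner), integral_sub hmax (integrableOn_const (by simp)),
    setIntegral_const, Measure.real, Real.volume_Ioo, ENNReal.toReal_ofReal (by linarith [Real.pi_pos]),
    smul_eq_mul]
  ring

/-- The term `-2π log 2`, the integral of `log |sin|`, is the cost of removing a strip instead of a
disc. It matches the `log 2` in `tendsto_integral_strip`. -/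
lemma tendsto_setIntegral_strip_discKernel {R : ℝ} (hR : 0 < R) (p : ℝ) :
    Tendsto (fun δ : ℝ => (∫ z in strip δ δ⁻¹, discKernel R p z) + 2 * Real.pi * Real.log δ)
      (𝓝[>] 0) (𝓝 (2 * Real.pi * Real.log R - 2 * Real.pi * Real.log 2)) := by
  have h1 : Tendsto (fun δ : ℝ => δ / R) (𝓝[>] 0) (𝓝[>] 0) := by
    refine tendsto_nhdsWithin_iff.2 ⟨?_, ?_⟩
    · have : Tendsto (fun δ : ℝ => δ / R) (𝓝 0) (𝓝 (0 / R)) := tendsto_id.div_const R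
      rw [zero_div] at this
      exact this.mono_left nhdsWithin_le_nhds
    · filter_upwards [self_mem_nhdsWithin] with δ hδ
      exact div_pos hδ hR
  have h2 := (tendsto_integral_max_log_sin.comp h1).add_const (2 * Real.pi * Real.log R)
  have e : -(2 * Real.pi * Real.log 2) + 2 * Real.pi * Real.log R =
      2 * Real.pi * Real.log R - 2 * Real.pi * Real.log 2 := by ring
  rw [e] at h2
  refine h2.congr' ?_
  filter_upwards [Ioo_mem_nhdsGT hR, Ioo_mem_nhdsGT (inv_pos.2 hR)] with δ hδ hδ'
  have hY : R ≤ δ⁻¹ := (le_inv_comm₀ hR hδ.1).2 hδ'.2.le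
  rw [setIntegral_strip_discKernel hδ.1 hδ.2 hY, Real.log_div hδ.1.ne' hR.ne']
  simp only [Function.comp_apply]
  rw [Real.log_div hδ.1.ne' hR.ne']
  ring

/-! ### Local integrability of negative powers -/

lemma intervalIntegrable_abs_rpow {r : ℝ} (hr : -1 < r) {S : ℝ} (hS : 0 ≤ S) :
    IntervalIntegrable (fun x : ℝ => |x| ^ r) volume (-S) S := by
  have h1 : IntervalIntegrable (fun x : ℝ => |x| ^ r) volume 0 S := by
    refine (intervalIntegral.intervalIntegrable_rpow' hr).congr fun x hx => ?_
    rw [Set.uIoc_of_le hS] at hx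
    rw [abs_of_pos hx.1]
  have h2 : IntervalIntegrable (fun x : ℝ => |x| ^ r) volume 0 (-S) := by
    simpa using (IntervalIntegrable.iff_comp_neg (by simp)).1 h1
  exact h2.symm.trans h1

lemma integrableOn_abs_rpow {r : ℝ} (hr : -1 < r) (S : ℝ) :
    IntegrableOn (fun x : ℝ => |x| ^ r) (Set.Icc (-S) S) := by
  rcases le_total 0 S with h | h
  · rw [integrableOn_Icc_iff_integrableOn_Ioc,
      ← intervalIntegrable_iff_integrableOn_Ioc_of_le (by linarith)]
    exact intervalIntegrable_abs_rpow hr h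
  · refine (integrableOn_singleton (x := (0 : ℝ)) (by simp) (by simp)).mono_set fun x hx => ?_
    have := hx.1.trans hx.2
    simp only [Set.mem_singleton_iff]
    linarith [hx.1, hx.2]

lemma integrable_indicator_abs_sub_rpow {r : ℝ} (hr : -1 < r) (p T : ℝ) :
    Integrable ((Set.Icc (-T) T).indicator fun x : ℝ => |x - p| ^ r) := by
  have h := ((integrable_indicator_iff measurableSet_Icc).2
    (integrableOn_abs_rpow hr (T + |p|))).comp_sub_right p
  refine ((h.integrableOn (s := Set.Icc (-T) T)).congr_fun ?_ measurableSet_Icc).integrable_indicator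
    measurableSet_Icc
  intro x hx
  refine Set.indicator_of_mem ?_ _
  constructor
  · linarith [le_abs_self p, hx.1]
  · linarith [neg_abs_le p, hx.2]

lemma integrableOn_ball_rpow {a b : ℝ} (ha : -1 < a) (hb : -1 < b) (p T : ℝ) :
    IntegrableOn (fun z : ℂ => |z.re - p| ^ a * |z.im| ^ b) (Metric.ball 0 T) := by
  have h := (integrable_indicator_abs_sub_rpow ha p T).mul_prod
    (integrable_indicator_abs_sub_rpow hb 0 T)
  rw [← Measure.volume_eq_prod, ← integrable_complex_iff_prod] at h
  refine (h.integrableOn (s := Metric.ball 0 T)).congr_fun ?_ Metric.isOpen_ball.measurableSet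
  intro z hz
  have hz' : ‖z‖ < T := by simpa using hz
  simp only
  rw [Set.indicator_of_mem (Set.mem_Icc.2 (abs_le.1 ((Complex.abs_re_le_norm z).trans hz'.le))),
    Set.indicator_of_mem (Set.mem_Icc.2 (abs_le.1 ((Complex.abs_im_le_norm z).trans hz'.le))),
    sub_zero]

lemma ae_re_ne_im_ne (p : ℝ) : ∀ᵐ z : ℂ, z.re ≠ p ∧ z.im ≠ 0 := by
  have h1 : ∀ᵐ q : ℝ × ℝ, q.1 ≠ p ∧ q.2 ≠ 0 := by
    have e : ∀ c : ℝ, ∀ᵐ x : ℝ, x ≠ c := fun c =>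
      measure_eq_zero_iff_ae_notMem.1 (measure_singleton c)
    rw [Measure.volume_eq_prod]
    exact ((Measure.quasiMeasurePreserving_fst (μ := volume) (ν := volume)).ae (e p)).and
      ((Measure.quasiMeasurePreserving_snd (μ := volume) (ν := volume)).ae (e 0))
  exact Complex.volume_preserving_equiv_real_prod.quasiMeasurePreserving.ae h1

/-- `r ≥ |x|^α |y|^(1 - α)` in the form of a bound for the inverse. -/
lemma norm_sub_inv_le {z : ℂ} {t α : ℝ} (h0 : 0 ≤ α) (h1 : α ≤ 1) (hre : z.re ≠ t)
    (him : z.im ≠ 0) : ‖z - t‖⁻¹ ≤ |z.re - t| ^ (-α) * |z.im| ^ (α - 1) := by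
  have hx : 0 < |z.re - t| := abs_pos.2 (sub_ne_zero.2 hre)
  have hy : 0 < |z.im| := abs_pos.2 him
  have hr : 0 < ‖z - t‖ := hy.trans_le (abs_im_le_norm_sub z t)
  have e : ‖z - t‖⁻¹ = ‖z - t‖ ^ (-α) * ‖z - t‖ ^ (α - 1) := by
    rw [← Real.rpow_add hr, ← Real.rpow_neg_one]
    congr 1; ring
  rw [e]
  exact mul_le_mul
    (Real.rpow_le_rpow_of_nonpos hx (abs_re_sub_le_norm_sub z t) (by linarith))
    (Real.rpow_le_rpow_of_nonpos hy (abs_im_le_norm_sub z t) (by linarith))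
    (by positivity) (by positivity)

lemma integrableOn_ball_inv (p T : ℝ) :
    IntegrableOn (fun z : ℂ => ‖z - p‖⁻¹) (Metric.ball 0 T) := by
  refine (integrableOn_ball_rpow (a := -(1 / 2)) (b := 1 / 2 - 1) (by norm_num) (by norm_num)
    p T).mono' (by fun_prop) (ae_restrict_of_ae ?_)
  filter_upwards [ae_re_ne_im_ne p] with z hz
  rw [Real.norm_of_nonneg (by positivity)]
  exact norm_sub_inv_le (by norm_num) (by norm_num) hz.1 hz.2

/-! ### Bounds for Cauchy transforms -/

/-- From `|z - t|⁻¹ ≤ |x - t|^(-3/4) |y|^(-1/4)`, whose first factor has a bounded integral against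
a bounded density, uniformly in `x`. The exponent `1/4` is small enough that both the square of the
transform and its product with `|z - p|⁻¹` stay locally integrable. -/
lemma BoundedDensity.exists_norm_cauchyTransform_le {M : Measure ℝ} [IsFiniteMeasure M]
    {C : NNReal} {L : ℝ} (h : BoundedDensity M C L) :
    ∃ K : ℝ, 0 ≤ K ∧ ∀ z : ℂ, z.im ≠ 0 →
      ‖cauchyTransform M z‖ ≤ K * |z.im| ^ (-(1 / 4) : ℝ) := by
  set φ : ℝ → ENNReal := fun u => ENNReal.ofReal (|u| ^ (-(3 / 4) : ℝ)) with hφ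
  set A : ENNReal := C * (∫⁻ u in Set.Icc (-1) 1, φ u) + 1 * M Set.univ with hA
  have hAfin : A ≠ ⊤ := by
    refine ENNReal.add_ne_top.2 ⟨ENNReal.mul_ne_top ENNReal.coe_ne_top ?_,
      ENNReal.mul_ne_top ENNReal.one_ne_top (measure_ne_top _ _)⟩
    exact (integrableOn_abs_rpow (r := -(3 / 4)) (by norm_num) 1).lintegral_lt_top.ne
  refine ⟨A.toReal, ENNReal.toReal_nonneg, fun z hz => ?_⟩
  have hna := h.noAtoms
  have hne : ∀ᵐ t ∂M, z.re ≠ t := by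
    have : ∀ᵐ t ∂M, t ∉ ({z.re} : Set ℝ) :=
      measure_eq_zero_iff_ae_notMem.1 (measure_singleton _)
    filter_upwards [this] with t ht e
    exact ht e.symm
  have hbound : ∫⁻ t, φ (z.re - t) ∂M ≤ A := by
    refine h.lintegral_comp_sub_le z.re (ae_of_all _ fun t ht => ?_)
    rw [hφ, ← ENNReal.ofReal_one]
    exact ENNReal.ofReal_le_ofReal (Real.rpow_le_one_of_one_le_of_nonpos ht.le (by norm_num))
  have hle : ‖cauchyTransform M z‖ₑ ≤ ENNReal.ofReal (|z.im| ^ (-(1 / 4) : ℝ)) * A := by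
    calc ‖cauchyTransform M z‖ₑ ≤ ∫⁻ t, ‖(z - (t : ℂ))⁻¹‖ₑ ∂M := enorm_integral_le_lintegral_enorm _
      _ ≤ ∫⁻ t, ENNReal.ofReal (|z.im| ^ (-(1 / 4) : ℝ)) * φ (z.re - t) ∂M := by
          refine lintegral_mono_ae ?_
          filter_upwards [hne] with t ht
          rw [hφ, ← ENNReal.ofReal_mul (by positivity), ← ofReal_norm, norm_inv]
          refine ENNReal.ofReal_le_ofReal ?_
          have := norm_sub_inv_le (α := 3 / 4) (by norm_num) (by norm_num) ht hz
          rw [mul_comm]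
          convert this using 3
          norm_num
      _ = ENNReal.ofReal (|z.im| ^ (-(1 / 4) : ℝ)) * ∫⁻ t, φ (z.re - t) ∂M :=
          lintegral_const_mul' _ _ ENNReal.ofReal_ne_top
      _ ≤ _ := by gcongr
  have := ENNReal.toReal_mono (ENNReal.mul_ne_top ENNReal.ofReal_ne_top hAfin) hle
  rwa [toReal_enorm, ENNReal.toReal_mul, ENNReal.toReal_ofReal (by positivity), mul_comm] at this

/-- The electric field, as a complex number, of charges `k p` at the points `p ∈ Λ` and of a
negative background `M`. -/
noncomputable def chargeField (Λ : Finset ℝ) (k : ℝ → ℝ) (M : Measure ℝ) (z : ℂ) : ℂ :=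
  ∑ p ∈ Λ, (k p : ℂ) * (z - p)⁻¹ - cauchyTransform M z

lemma stronglyMeasurable_chargeField (Λ : Finset ℝ) (k : ℝ → ℝ) (M : Measure ℝ) [SFinite M] :
    StronglyMeasurable (chargeField Λ k M) := by
  refine StronglyMeasurable.sub ?_ (stronglyMeasurable_cauchyTransform M)
  exact (by fun_prop : Measurable fun z : ℂ => ∑ p ∈ Λ, (k p : ℂ) * (z - p)⁻¹).stronglyMeasurable

/-- The energy density from which the singular part at each charge is removed. -/
noncomputable def regularDensity (R : ℝ) (Λ : Finset ℝ) (k : ℝ → ℝ) (M : Measure ℝ) (z : ℂ) : ℝ :=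
  ‖chargeField Λ k M z‖ ^ 2 - ∑ p ∈ Λ, k p ^ 2 * discKernel R p z

lemma measurable_regularDensity (R : ℝ) (Λ : Finset ℝ) (k : ℝ → ℝ) (M : Measure ℝ) [SFinite M] :
    Measurable (regularDensity R Λ k M) := by
  refine ((stronglyMeasurable_chargeField Λ k M).measurable.norm.pow_const 2).sub ?_
  exact Finset.measurable_sum _ fun p _ => (measurable_discKernel R p).const_mul _

lemma norm_inv_sub_inv_le {z : ℂ} {t L : ℝ} (ht : |t| ≤ L) (hL : 0 < L) (hz : 2 * L ≤ ‖z‖) :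
    ‖(z - t)⁻¹ - z⁻¹‖ ≤ 2 * L / ‖z‖ ^ 2 := by
  have h0 : 0 < ‖z‖ := by linarith
  have h1 : ‖z‖ / 2 ≤ ‖z - t‖ := by
    have := norm_sub_norm_le z (t : ℂ)
    rw [Complex.norm_real, Real.norm_eq_abs] at this
    linarith
  have hz0 : z ≠ 0 := norm_pos_iff.1 h0
  have hzt : z - t ≠ 0 := norm_pos_iff.1 (by linarith)
  have e : (z - t)⁻¹ - z⁻¹ = t / ((z - t) * z) := by
    field_simp
    ring
  rw [e, norm_div, norm_mul, Complex.norm_real, Real.norm_eq_abs, div_le_div_iff₀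
    (mul_pos (by linarith) h0) (by positivity)]
  calc |t| * ‖z‖ ^ 2 ≤ L * ‖z‖ ^ 2 := by gcongr
    _ = 2 * L * (‖z‖ / 2 * ‖z‖) := by ring
    _ ≤ 2 * L * (‖z - t‖ * ‖z‖) := by gcongr

/-- Neutrality permits the subtraction of `1/z` from every kernel, which improves the decay from
`|z|⁻¹` to `|z|⁻²`. -/
lemma norm_chargeField_le {Λ : Finset ℝ} {k : ℝ → ℝ} {M : Measure ℝ} [IsFiniteMeasure M] {L : ℝ}
    (hL : 0 < L) (hk : ∀ p, 0 ≤ k p) (hΛ : ∀ p ∈ Λ, |p| ≤ L) (hM : ∀ᵐ t ∂M, |t| ≤ L)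
    (hneutral : M.real Set.univ = ∑ p ∈ Λ, k p) {z : ℂ} (hz : 2 * L ≤ ‖z‖) (him : z.im ≠ 0) :
    ‖chargeField Λ k M z‖ ≤ 4 * L * M.real Set.univ / ‖z‖ ^ 2 := by
  have h1 : ∑ p ∈ Λ, (k p : ℂ) * (z - p)⁻¹ =
      ∑ p ∈ Λ, (k p : ℂ) * ((z - p)⁻¹ - z⁻¹) + M.real Set.univ * z⁻¹ := by
    rw [hneutral]
    simp only [mul_sub, Finset.sum_sub_distrib, ← Finset.sum_mul]
    push_cast
    ring
  have h2 : cauchyTransform M z =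
      ∫ t : ℝ, ((z - (t : ℂ))⁻¹ - z⁻¹) ∂M + M.real Set.univ * z⁻¹ := by
    rw [integral_sub (integrable_inv_sub M him) (integrable_const _), integral_const,
      cauchyTransform, Complex.real_smul]
    ring
  have e : chargeField Λ k M z = ∑ p ∈ Λ, (k p : ℂ) * ((z - p)⁻¹ - z⁻¹) -
      ∫ t : ℝ, ((z - (t : ℂ))⁻¹ - z⁻¹) ∂M := by
    rw [chargeField, h1, h2]; ring
  have b1 : ‖∑ p ∈ Λ, (k p : ℂ) * ((z - p)⁻¹ - z⁻¹)‖ ≤ M.real Set.univ * (2 * L / ‖z‖ ^ 2) := by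
    rw [hneutral, Finset.sum_mul]
    refine norm_sum_le_of_le _ fun p hp => ?_
    rw [norm_mul, Complex.norm_real, Real.norm_of_nonneg (hk p)]
    exact mul_le_mul_of_nonneg_left (norm_inv_sub_inv_le (hΛ p hp) hL hz) (hk p)
  have b2 : ‖∫ t : ℝ, ((z - (t : ℂ))⁻¹ - z⁻¹) ∂M‖ ≤ 2 * L / ‖z‖ ^ 2 * M.real Set.univ := by
    refine norm_integral_le_of_norm_le_const ?_
    filter_upwards [hM] with t ht using norm_inv_sub_inv_le ht hL hz
  rw [e]
  refine (norm_sub_le _ _).trans ((add_le_add b1 b2).trans (le_of_eq ?_))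
  ring

/-- The real axis carries all the charges and is negligible in the plane. -/
lemma ae_im_ne_zero : ∀ᵐ z : ℂ, z.im ≠ 0 := (ae_re_ne_im_ne 0).mono fun _ h => h.2

lemma integrableOn_compl_ball_regularDensity {Λ : Finset ℝ} {k : ℝ → ℝ} {M : Measure ℝ}
    [IsFiniteMeasure M] {L R T : ℝ} (hL : 0 < L) (hk : ∀ p, 0 ≤ k p) (hΛ : ∀ p ∈ Λ, |p| ≤ L)
    (hM : ∀ᵐ t ∂M, |t| ≤ L) (hneutral : M.real Set.univ = ∑ p ∈ Λ, k p) (hT1 : 1 ≤ T)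
    (hT2 : 2 * L ≤ T) (hT3 : L + R ≤ T) :
    IntegrableOn (regularDensity R Λ k M) (Metric.ball 0 T)ᶜ := by
  -- The discs lie inside the ball since `L + R ≤ T`, so the density is the squared field, of order
  -- `|z|⁻⁴`, which is integrable in dimension two. The factor `16` comes from `1 + |z| ≤ 2 |z|`.
  have hi : Integrable fun z : ℂ => (4 * L * M.real Set.univ) ^ 2 * 16 * (1 + ‖z‖) ^ (-(4 : ℝ)) :=
    (integrable_one_add_norm (by rw [Complex.finrank_real_complex]; norm_num)).const_mul _
  refine hi.integrableOn.mono' (measurable_regularDensity R Λ k M).aestronglyMeasurable ?_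
  filter_upwards [ae_restrict_mem Metric.isOpen_ball.measurableSet.compl,
    ae_restrict_of_ae ae_im_ne_zero] with z hz him
  have hzT : T ≤ ‖z‖ := by simpa using hz
  have hd : ∑ p ∈ Λ, k p ^ 2 * discKernel R p z = 0 := by
    refine Finset.sum_eq_zero fun p hp => ?_
    rw [discKernel_of_notMem, mul_zero]
    have := norm_sub_norm_le z (p : ℂ)
    rw [Complex.norm_real, Real.norm_eq_abs] at this
    linarith [hΛ p hp]
  rw [regularDensity, hd, sub_zero, Real.norm_of_nonneg (by positivity),
    Real.rpow_neg (by positivity)]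
  have h0 : 0 < ‖z‖ := by linarith
  calc ‖chargeField Λ k M z‖ ^ 2 ≤ (4 * L * M.real Set.univ / ‖z‖ ^ 2) ^ 2 := by
        have := norm_chargeField_le hL hk hΛ hM hneutral (hT2.trans hzT) him
        gcongr
    _ = (4 * L * M.real Set.univ) ^ 2 * (‖z‖ ^ 4)⁻¹ := by field_simp
    _ ≤ (4 * L * M.real Set.univ) ^ 2 * (16 * ((1 + ‖z‖) ^ (4 : ℝ))⁻¹) := by
        gcongr
        rw [← div_eq_mul_inv, inv_eq_one_div, div_le_div_iff₀ (by positivity) (by positivity)]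
        have : (1 + ‖z‖) ^ (4 : ℝ) = (1 + ‖z‖) ^ 4 := by norm_cast
        rw [this]
        calc 1 * (1 + ‖z‖) ^ 4 ≤ 1 * (2 * ‖z‖) ^ 4 := by gcongr; linarith
          _ = 16 * ‖z‖ ^ 4 := by ring
    _ = _ := by ring

/-! ### Local integrability of the regularised energy density -/

lemma integrableOn_ball_inv_sq_sub_discKernel {R : ℝ} (hR : 0 < R) (p T : ℝ) :
    IntegrableOn (fun z : ℂ => ‖(z - (p : ℂ))⁻¹‖ ^ 2 - discKernel R p z) (Metric.ball 0 T) := by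
  refine IntegrableOn.of_bound measure_ball_lt_top ?_ (R ^ 2)⁻¹ (ae_of_all _ fun z => ?_)
  · exact ((by fun_prop : Measurable fun z : ℂ => ‖(z - (p : ℂ))⁻¹‖ ^ 2).sub
      (measurable_discKernel R p)).aestronglyMeasurable
  · rw [norm_inv, inv_pow]
    by_cases h : ‖z - p‖ < R
    · rw [discKernel, Set.indicator_of_mem (by simpa [dist_eq_norm] using h), sub_self, norm_zero]
      positivity
    · rw [discKernel_of_notMem (not_lt.1 h), sub_zero, Real.norm_of_nonneg (by positivity)]
      have := not_lt.1 h
      gcongr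

/-- Since `|p - q| ≤ |z - p| + |z - q|`, the product of two distinct poles is at most `|p - q|⁻¹`
times their sum, and simple poles are locally integrable. -/
lemma integrableOn_ball_pairKernel {p q : ℝ} (hpq : p ≠ q) (T : ℝ) :
    IntegrableOn (fun z : ℂ => ((z - (p : ℂ))⁻¹ * (starRingEnd ℂ) ((z - (q : ℂ))⁻¹)).re)
      (Metric.ball 0 T) := by
  have hd : 0 < |p - q| := abs_pos.2 (sub_ne_zero.2 hpq)
  refine (((integrableOn_ball_inv p T).add (integrableOn_ball_inv q T)).const_mul
    |p - q|⁻¹).mono' (by fun_prop) (ae_restrict_of_ae ?_)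
  filter_upwards [ae_im_ne_zero] with z hz
  have h1 : 0 < ‖z - p‖ := (abs_pos.2 hz).trans_le (abs_im_le_norm_sub z p)
  have h2 : 0 < ‖z - q‖ := (abs_pos.2 hz).trans_le (abs_im_le_norm_sub z q)
  refine (Complex.abs_re_le_norm _).trans ?_
  rw [norm_mul, RCLike.norm_conj, norm_inv, norm_inv]
  simp only [Pi.add_apply]
  rw [inv_add_inv h1.ne' h2.ne', inv_mul_eq_div |p - q|, le_div_iff₀ hd, ← mul_inv, inv_mul_eq_div]
  gcongr
  have e : ((p - q : ℝ) : ℂ) = (z - q) - (z - p) := by push_cast; ring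
  calc |p - q| = ‖((p - q : ℝ) : ℂ)‖ := by rw [Complex.norm_real, Real.norm_eq_abs]
    _ ≤ ‖z - q‖ + ‖z - p‖ := by rw [e]; exact norm_sub_le _ _
    _ = ‖z - p‖ + ‖z - q‖ := add_comm _ _

lemma BoundedDensity.integrableOn_ball_cross {M : Measure ℝ} [IsFiniteMeasure M] {C : NNReal}
    {L : ℝ} (h : BoundedDensity M C L) (p T : ℝ) :
    IntegrableOn (fun z : ℂ => ((z - (p : ℂ))⁻¹ * (starRingEnd ℂ) (cauchyTransform M z)).re)
      (Metric.ball 0 T) := by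
  obtain ⟨K, hK0, hK⟩ := h.exists_norm_cauchyTransform_le
  refine ((integrableOn_ball_rpow (a := -(1 / 2)) (b := -(3 / 4)) (by norm_num) (by norm_num)
    p T).const_mul K).mono' ?_ (ae_restrict_of_ae ?_)
  · refine (Complex.measurable_re.comp (Measurable.mul (by fun_prop) ?_)).aestronglyMeasurable
    exact Complex.continuous_conj.measurable.comp (stronglyMeasurable_cauchyTransform M).measurable
  · filter_upwards [ae_re_ne_im_ne p] with z hz
    refine (Complex.abs_re_le_norm _).trans ?_
    rw [norm_mul, RCLike.norm_conj, norm_inv]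
    have h1 := norm_sub_inv_le (α := 1 / 2) (by norm_num) (by norm_num) hz.1 hz.2
    have h2 := hK z hz.2
    have hy : 0 < |z.im| := abs_pos.2 hz.2
    calc ‖z - p‖⁻¹ * ‖cauchyTransform M z‖
        ≤ (|z.re - p| ^ (-(1 / 2) : ℝ) * |z.im| ^ (1 / 2 - 1 : ℝ)) *
          (K * |z.im| ^ (-(1 / 4) : ℝ)) := by gcongr
      _ = K * (|z.re - p| ^ (-(1 / 2) : ℝ) *
          (|z.im| ^ (1 / 2 - 1 : ℝ) * |z.im| ^ (-(1 / 4) : ℝ))) := by ring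
      _ = _ := by
          rw [← Real.rpow_add hy]
          norm_num

lemma BoundedDensity.integrableOn_ball_sq {M : Measure ℝ} [IsFiniteMeasure M] {C : NNReal}
    {L : ℝ} (h : BoundedDensity M C L) (T : ℝ) :
    IntegrableOn (fun z : ℂ => ‖cauchyTransform M z‖ ^ 2) (Metric.ball 0 T) := by
  obtain ⟨K, hK0, hK⟩ := h.exists_norm_cauchyTransform_le
  refine ((integrableOn_ball_rpow (a := 0) (b := -(1 / 2)) (by norm_num) (by norm_num)
    0 T).const_mul (K ^ 2)).mono'
    ((stronglyMeasurable_cauchyTransform M).measurable.norm.pow_const 2).aestronglyMeasurable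
    (ae_restrict_of_ae ?_)
  filter_upwards [ae_im_ne_zero] with z hz
  have hy : 0 < |z.im| := abs_pos.2 hz
  rw [Real.norm_of_nonneg (by positivity), Real.rpow_zero, one_mul]
  calc ‖cauchyTransform M z‖ ^ 2 ≤ (K * |z.im| ^ (-(1 / 4) : ℝ)) ^ 2 := by
        have := hK z hz
        gcongr
    _ = K ^ 2 * (|z.im| ^ (-(1 / 4) : ℝ) * |z.im| ^ (-(1 / 4) : ℝ)) := by ring
    _ = _ := by
        rw [← Real.rpow_add hy]
        norm_num

/-- Of the terms of the expanded square, only the diagonal `|z - p|⁻²` fail to be locally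
integrable; they are paired with the disc kernels. -/
lemma regularDensity_eq (R : ℝ) (Λ : Finset ℝ) (k : ℝ → ℝ) (M : Measure ℝ) (z : ℂ) :
    regularDensity R Λ k M z =
      ∑ p ∈ Λ, k p ^ 2 * (‖(z - (p : ℂ))⁻¹‖ ^ 2 - discKernel R p z) +
      ∑ p ∈ Λ, ∑ q ∈ Λ.erase p,
        k p * k q * ((z - (p : ℂ))⁻¹ * (starRingEnd ℂ) ((z - (q : ℂ))⁻¹)).re -
      ∑ p ∈ Λ, 2 * k p * ((z - (p : ℂ))⁻¹ * (starRingEnd ℂ) (cauchyTransform M z)).re +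
      ‖cauchyTransform M z‖ ^ 2 := by
  have hn : ∀ w : ℂ, ‖w‖ ^ 2 = (w * (starRingEnd ℂ) w).re := by
    intro w
    rw [Complex.mul_conj, Complex.ofReal_re, Complex.normSq_eq_norm_sq]
  set A := ∑ p ∈ Λ, (k p : ℂ) * (z - p)⁻¹ with hA
  set B := cauchyTransform M z with hB
  have e1 : ‖A - B‖ ^ 2 = (A * (starRingEnd ℂ) A).re - 2 * (A * (starRingEnd ℂ) B).re +
      ‖B‖ ^ 2 := by
    rw [← Complex.normSq_eq_norm_sq, ← Complex.normSq_eq_norm_sq, Complex.normSq_apply,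
      Complex.normSq_apply]
    simp
    ring
  have e2 : (A * (starRingEnd ℂ) A).re = ∑ p ∈ Λ, ∑ q ∈ Λ,
      k p * k q * ((z - (p : ℂ))⁻¹ * (starRingEnd ℂ) ((z - (q : ℂ))⁻¹)).re := by
    rw [hA, map_sum, Finset.sum_mul_sum, Complex.re_sum]
    refine Finset.sum_congr rfl fun p _ => ?_
    rw [Complex.re_sum]
    refine Finset.sum_congr rfl fun q _ => ?_
    rw [← Complex.re_ofReal_mul]
    congr 1
    rw [map_mul, Complex.conj_ofReal]
    push_cast
    ring
  have e3 : 2 * (A * (starRingEnd ℂ) B).re =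
      ∑ p ∈ Λ, 2 * k p * ((z - (p : ℂ))⁻¹ * (starRingEnd ℂ) B).re := by
    rw [hA, Finset.sum_mul, Complex.re_sum, Finset.mul_sum]
    refine Finset.sum_congr rfl fun p _ => ?_
    rw [mul_assoc, mul_assoc, Complex.re_ofReal_mul]
  rw [regularDensity, chargeField, ← hA, ← hB, e1, e2, e3]
  have e4 : ∑ p ∈ Λ, ∑ q ∈ Λ,
      k p * k q * ((z - (p : ℂ))⁻¹ * (starRingEnd ℂ) ((z - (q : ℂ))⁻¹)).re =
      ∑ p ∈ Λ, k p ^ 2 * ‖(z - (p : ℂ))⁻¹‖ ^ 2 + ∑ p ∈ Λ, ∑ q ∈ Λ.erase p,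
        k p * k q * ((z - (p : ℂ))⁻¹ * (starRingEnd ℂ) ((z - (q : ℂ))⁻¹)).re := by
    rw [← Finset.sum_add_distrib]
    refine Finset.sum_congr rfl fun p hp => ?_
    rw [← Finset.add_sum_erase _ _ hp, hn, sq]
  rw [e4]
  simp only [mul_sub, Finset.sum_sub_distrib]
  ring

lemma BoundedDensity.integrableOn_ball_regularDensity {M : Measure ℝ} [IsFiniteMeasure M]
    {C : NNReal} {L : ℝ} (h : BoundedDensity M C L) (Λ : Finset ℝ) (k : ℝ → ℝ) {R : ℝ}
    (hR : 0 < R) (T : ℝ) :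
    IntegrableOn (regularDensity R Λ k M) (Metric.ball 0 T) := by
  have e : regularDensity R Λ k M = _ := funext (regularDensity_eq R Λ k M)
  rw [e]
  refine Integrable.add (Integrable.sub (Integrable.add ?_ ?_) ?_) (h.integrableOn_ball_sq T)
  · exact integrable_finsetSum _ fun p _ =>
      (integrableOn_ball_inv_sq_sub_discKernel hR p T).const_mul _
  · exact integrable_finsetSum _ fun p _ => integrable_finsetSum _ fun q hq =>
      (integrableOn_ball_pairKernel (Finset.ne_of_mem_erase hq).symm T).const_mul _
  · exact integrable_finsetSum _ fun p _ => (h.integrableOn_ball_cross p T).const_mul _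

/-- The regularised energy density of a neutral system is integrable. -/
lemma BoundedDensity.integrable_regularDensity {M : Measure ℝ} [IsFiniteMeasure M]
    {C : NNReal} {L : ℝ} (h : BoundedDensity M C L) {Λ : Finset ℝ} {k : ℝ → ℝ} (hL : 0 < L)
    (hk : ∀ p, 0 ≤ k p) (hΛ : ∀ p ∈ Λ, |p| ≤ L) (hneutral : M.real Set.univ = ∑ p ∈ Λ, k p)
    {R : ℝ} (hR : 0 < R) : Integrable (regularDensity R Λ k M) := by
  rw [← integrableOn_univ, ← Set.union_compl_self (Metric.ball (0 : ℂ) (1 + 2 * L + R))]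
  exact (h.integrableOn_ball_regularDensity Λ k hR _).union
    (integrableOn_compl_ball_regularDensity hL hk hΛ h.bdd hneutral (by linarith) (by linarith)
      (by linarith))

/-! ### The renormalized energy in the complex plane -/

/-- The complement of the discs of radius `η` about the points of `Λ`. -/
def outerDomain (Λ : Finset ℝ) (η : ℝ) : Set ℂ := (⋃ p ∈ Λ, Metric.ball (p : ℂ) η)ᶜ

lemma mem_outerDomain {Λ : Finset ℝ} {η : ℝ} {z : ℂ} :
    z ∈ outerDomain Λ η ↔ ∀ p ∈ Λ, η ≤ ‖z - p‖ := by
  simp [outerDomain, dist_eq_norm]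

lemma measurableSet_outerDomain (Λ : Finset ℝ) (η : ℝ) : MeasurableSet (outerDomain Λ η) :=
  (Λ.measurableSet_biUnion fun _ _ => Metric.isOpen_ball.measurableSet).compl

lemma exists_separation (Λ : Finset ℝ) :
    ∃ R : ℝ, 0 < R ∧ ∀ p ∈ Λ, ∀ q ∈ Λ, p ≠ q → 2 * R ≤ |p - q| := by
  -- `C` may be `⊤` when `Λ` has at most one point; the minimum with `1` keeps the real value
  -- positive.
  obtain ⟨C, hC, h⟩ := Set.einfsep_pos.1 Λ.finite_toSet.einfsep_pos
  refine ⟨(min C 1).toReal / 2, half_pos (ENNReal.toReal_pos (lt_min hC one_pos).ne'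
    (by simp)), fun p hp q hq hpq => ?_⟩
  have h1 : min C 1 ≤ ENNReal.ofReal |p - q| := by
    rw [← Real.dist_eq, ← edist_dist]
    exact (min_le_left _ _).trans (h p hp q hq hpq)
  have h2 := ENNReal.toReal_mono ENNReal.ofReal_ne_top h1
  rw [ENNReal.toReal_ofReal (abs_nonneg _)] at h2
  linarith

/-- For `q ≠ p` the disc `B(q, η)` does not meet `B(p, R)`, because `η + R ≤ 2 R ≤ |p - q|`. Only
the hole about `p` matters. -/
lemma setIntegral_outerDomain_discKernel {Λ : Finset ℝ} {R η p : ℝ} (hp : p ∈ Λ)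
    (hsep : ∀ q ∈ Λ, p ≠ q → 2 * R ≤ |p - q|) (hη : 0 < η) (hR : η ≤ R) :
    ∫ z in outerDomain Λ η, discKernel R p z = 2 * Real.pi * Real.log (R / η) := by
  rw [← setIntegral_compl_ball_discKernel (p := p) hη hR,
    ← integral_indicator (measurableSet_outerDomain Λ η),
    ← integral_indicator Metric.isOpen_ball.measurableSet.compl]
  congr 1 with z
  by_cases hz : z ∈ outerDomain Λ η
  · rw [Set.indicator_of_mem hz, Set.indicator_of_mem]
    simpa [dist_eq_norm] using mem_outerDomain.1 hz p hp
  · rw [Set.indicator_of_notMem hz]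
    by_cases h1 : z ∈ (Metric.ball (p : ℂ) η)ᶜ
    · rw [Set.indicator_of_mem h1]
      have h1' : η ≤ ‖z - p‖ := by simpa [dist_eq_norm] using h1
      rw [mem_outerDomain] at hz
      push Not at hz
      obtain ⟨q, hq, hzq⟩ := hz
      have hpq : p ≠ q := by
        rintro rfl
        exact absurd h1' (not_le.2 hzq)
      rw [discKernel_of_notMem]
      have h2 := hsep q hq hpq
      have e : ((p - q : ℝ) : ℂ) = (z - q) - (z - p) := by push_cast; ring
      have h3 : |p - q| ≤ ‖z - q‖ + ‖z - p‖ := by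
        rw [← Real.norm_eq_abs, ← Complex.norm_real, e]
        exact norm_sub_le _ _
      linarith
    · rw [Set.indicator_of_notMem h1]

lemma sq_norm_chargeField_eq (R : ℝ) (Λ : Finset ℝ) (k : ℝ → ℝ) (M : Measure ℝ) (z : ℂ) :
    ‖chargeField Λ k M z‖ ^ 2 =
      regularDensity R Λ k M z + ∑ p ∈ Λ, k p ^ 2 * discKernel R p z := by
  rw [regularDensity, sub_add_cancel]

lemma setIntegral_sq_norm_chargeField {Λ : Finset ℝ} {k : ℝ → ℝ} {M : Measure ℝ} {R : ℝ}
    (hg : Integrable (regularDensity R Λ k M)) {S : Set ℂ}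
    (hS : ∀ p ∈ Λ, IntegrableOn (discKernel R p) S) :
    IntegrableOn (fun z => ‖chargeField Λ k M z‖ ^ 2) S ∧
    ∫ z in S, ‖chargeField Λ k M z‖ ^ 2 =
      (∫ z in S, regularDensity R Λ k M z) +
        ∑ p ∈ Λ, k p ^ 2 * ∫ z in S, discKernel R p z := by
  have i2 : ∀ p ∈ Λ, IntegrableOn (fun z => k p ^ 2 * discKernel R p z) S :=
    fun p hp => (hS p hp).const_mul _
  simp only [sq_norm_chargeField_eq R]
  refine ⟨hg.integrableOn.add (integrable_finsetSum _ i2), ?_⟩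
  rw [integral_add hg.integrableOn (integrable_finsetSum _ i2), integral_finsetSum _ i2]
  simp only [integral_const_mul]

lemma integrableOn_outerDomain_discKernel {Λ : Finset ℝ} {R η p : ℝ} (hp : p ∈ Λ) (hη : 0 < η) :
    IntegrableOn (discKernel R p) (outerDomain Λ η) :=
  integrableOn_discKernel hη (measurableSet_outerDomain Λ η) fun _ hz => mem_outerDomain.1 hz p hp

lemma integrableOn_strip_discKernel (R p : ℝ) {δ : ℝ} (hδ : 0 < δ) (Y : ℝ) :
    IntegrableOn (discKernel R p) (strip δ Y) :=
  integrableOn_discKernel hδ (measurableSet_strip δ Y) fun z hz =>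
    hz.1.le.trans (abs_im_le_norm_sub z p)

/-- The bridge between the two truncations: outer domains and strips both eventually contain every
point off the axis, so an integrable function has the same limit along both. -/
lemma tendsto_setIntegral_of_eventually_mem {g : ℂ → ℝ} (hg : Integrable g) {S : ℝ → Set ℂ}
    (hS : ∀ η, MeasurableSet (S η)) (h : ∀ᵐ z : ℂ, ∀ᶠ η in 𝓝[>] (0 : ℝ), z ∈ S η) :
    Tendsto (fun η => ∫ z in S η, g z) (𝓝[>] 0) (𝓝 (∫ z, g z)) := by
  simp only [← fun η => integral_indicator (μ := volume) (f := g) (hS η)]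
  refine tendsto_integral_filter_of_dominated_convergence (fun z => ‖g z‖)
    (Eventually.of_forall fun η => hg.aestronglyMeasurable.indicator (hS η))
    (Eventually.of_forall fun η => ae_of_all _ fun z => norm_indicator_le_norm_self _ _) hg.norm ?_
  filter_upwards [h] with z hz
  refine tendsto_const_nhds.congr' ?_
  filter_upwards [hz] with η hη
  rw [Set.indicator_of_mem hη]

lemma eventually_mem_outerDomain (Λ : Finset ℝ) {z : ℂ} (hz : z.im ≠ 0) :
    ∀ᶠ η in 𝓝[>] (0 : ℝ), z ∈ outerDomain Λ η := by
  filter_upwards [Ioo_mem_nhdsGT (abs_pos.2 hz)] with η hη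
  exact mem_outerDomain.2 fun p _ => hη.2.le.trans (abs_im_le_norm_sub z p)

lemma eventually_mem_strip {z : ℂ} (hz : z.im ≠ 0) :
    ∀ᶠ δ in 𝓝[>] (0 : ℝ), z ∈ strip δ δ⁻¹ := by
  filter_upwards [Ioo_mem_nhdsGT (abs_pos.2 hz), Ioo_mem_nhdsGT (inv_pos.2 (abs_pos.2 hz))]
    with δ h1 h2
  exact ⟨h1.2, (lt_inv_comm₀ (abs_pos.2 hz) h1.1).2 h2.2⟩

section

variable {M : Measure ℝ} [IsFiniteMeasure M] {C : NNReal} {L : ℝ} (h : BoundedDensity M C L)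
  {Λ : Finset ℝ} {k : ℝ → ℝ} (hL : 0 < L) (hk : ∀ p, 0 ≤ k p) (hΛ : ∀ p ∈ Λ, |p| ≤ L)
  (hneutral : M.real Set.univ = ∑ p ∈ Λ, k p)

include h hL hk hΛ hneutral

lemma integrableOn_outerDomain_sq_norm_chargeField {η : ℝ} (hη : 0 < η) :
    IntegrableOn (fun z => ‖chargeField Λ k M z‖ ^ 2) (outerDomain Λ η) :=
  (setIntegral_sq_norm_chargeField (h.integrable_regularDensity hL hk hΛ hneutral one_pos)
    fun _ hp => integrableOn_outerDomain_discKernel hp hη).1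

/-- The regular part converges and each disc kernel contributes exactly `2π k_p² log (R/η)`. General
charges `k` are needed for coinciding points. -/
lemma exists_tendsto_truncated :
    ∃ R : ℝ, 0 < R ∧ Tendsto (fun η => 1 / 2 * (∫ z in outerDomain Λ η, ‖chargeField Λ k M z‖ ^ 2) +
        Real.pi * (∑ p ∈ Λ, k p ^ 2) * Real.log η) (𝓝[>] 0)
      (𝓝 (1 / 2 * (∫ z, regularDensity R Λ k M z) + Real.pi * (∑ p ∈ Λ, k p ^ 2) * Real.log R)) := by
  obtain ⟨R, hR, hsep⟩ := exists_separation Λ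
  have hg := h.integrable_regularDensity hL hk hΛ hneutral hR
  refine ⟨R, hR, ?_⟩
  have h1 := tendsto_setIntegral_of_eventually_mem hg (measurableSet_outerDomain Λ)
    (ae_im_ne_zero.mono fun z hz => eventually_mem_outerDomain Λ hz)
  have h2 := (h1.const_mul (1 / 2)).add_const (Real.pi * (∑ p ∈ Λ, k p ^ 2) * Real.log R)
  refine h2.congr' ?_
  filter_upwards [Ioo_mem_nhdsGT hR] with η hη
  rw [(setIntegral_sq_norm_chargeField hg
    fun p hp => integrableOn_outerDomain_discKernel hp hη.1).2]
  have e : ∑ p ∈ Λ, k p ^ 2 * ∫ z in outerDomain Λ η, discKernel R p z =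
      (∑ p ∈ Λ, k p ^ 2) * (2 * Real.pi * Real.log (R / η)) := by
    rw [Finset.sum_mul]
    refine Finset.sum_congr rfl fun p hp => ?_
    rw [setIntegral_outerDomain_discKernel hp (hsep p hp) hη.1 hη.2.le]
  rw [e, Real.log_div hR.ne' hη.1.ne']
  ring

end

lemma chargeField_one (Λ : Finset ℝ) (M : Measure ℝ) (z : ℂ) :
    chargeField Λ (fun _ => 1) M z =
      cauchyTransform (pointMeasure Λ) z - cauchyTransform M z := by
  rw [chargeField, show cauchyTransform (pointMeasure Λ) z = _ from integral_pointMeasure Λ _]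
  simp

/-- The renormalized energy of distinct unit charges, in terms of the mutual energies. -/
lemma integral_regularDensity_one {M : Measure ℝ} [IsFiniteMeasure M] {C : NNReal} {L : ℝ}
    (h : BoundedDensity M C L) {Λ : Finset ℝ} (hL : 0 < L) (hΛ : ∀ p ∈ Λ, |p| ≤ L)
    (hneutral : M.real Set.univ = Λ.card) {R : ℝ} (hR : 0 < R) :
    1 / 2 * (∫ z, regularDensity R Λ (fun _ => 1) M z) + Real.pi * Λ.card * Real.log R =
      Real.pi * (-∑ p ∈ Λ, ∑ q ∈ Λ.erase p, Real.log |p - q| -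
        2 * ∑ p ∈ Λ, logPotential M p + mutualEnergy M M) := by
  have hg := h.integrable_regularDensity hL (k := fun _ => 1) (fun _ => zero_le_one) hΛ
    (by simpa using hneutral) hR
  have h1 := tendsto_setIntegral_of_eventually_mem hg (fun δ => measurableSet_strip δ δ⁻¹)
    (ae_im_ne_zero.mono fun z hz => eventually_mem_strip hz)
  have h2 : Tendsto (fun δ : ℝ => ∑ p ∈ Λ, ((∫ z in strip δ δ⁻¹, discKernel R p z) +
      2 * Real.pi * Real.log δ)) (𝓝[>] 0)
      (𝓝 (∑ p ∈ Λ, (2 * Real.pi * Real.log R - 2 * Real.pi * Real.log 2))) :=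
    tendsto_finsetSum _ fun p _ => tendsto_setIntegral_strip_discKernel hR p
  have h3 := tendsto_integral_strip hΛ h hneutral
  -- The strip energy split into its regular part and disc kernels. Comparison with
  -- `tendsto_integral_strip` determines the integral of the regular part, and the `log 2` terms
  -- cancel.
  have h4 := (h1.add h2).congr' (f₂ := fun δ : ℝ => (∫ z in strip δ δ⁻¹,
      ‖cauchyTransform (pointMeasure Λ) z - cauchyTransform M z‖ ^ 2) +
        2 * Real.pi * Λ.card * Real.log δ) (by
    filter_upwards [self_mem_nhdsWithin] with δ hδ
    simp only [← chargeField_one]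
    rw [(setIntegral_sq_norm_chargeField hg
      fun p _ => integrableOn_strip_discKernel R p hδ δ⁻¹).2, Finset.sum_add_distrib]
    simp only [one_pow, one_mul, Finset.sum_const, nsmul_eq_mul]
    ring)
  have h5 := tendsto_nhds_unique h4 h3
  rw [Finset.sum_const, nsmul_eq_mul] at h5
  linear_combination (1 / 2) * h5

/-! ### The gradient of the blown-up potential -/

/-- The real-linear form `v ↦ Re (c v)`, depending linearly on `c`. -/
noncomputable def reMul : ℂ →L[ℝ] ℂ →L[ℝ] ℝ :=
  (ContinuousLinearMap.compL ℝ ℂ ℂ ℝ Complex.reCLM).comp (ContinuousLinearMap.mul ℝ ℂ)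

lemma reMul_apply (c v : ℂ) : reMul c v = (c * v).re := rfl

lemma norm_reMul (c : ℂ) : ‖reMul c‖ = ‖c‖ := by
  refine le_antisymm (ContinuousLinearMap.opNorm_le_bound _ (norm_nonneg _) fun v => ?_) ?_
  · rw [reMul_apply, ← norm_mul]
    exact Complex.abs_re_le_norm _
  · rcases eq_or_ne c 0 with rfl | hc
    · simp
    have h := (reMul c).le_opNorm ((starRingEnd ℂ) c)
    rw [reMul_apply, Complex.mul_conj, Complex.ofReal_re, Complex.normSq_eq_norm_sq,
      RCLike.norm_conj, Real.norm_of_nonneg (by positivity), sq] at h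
    exact le_of_mul_le_mul_right h (norm_pos_iff.2 hc)

/-- Locally `log |w - t|` is the real part of a holomorphic logarithm with derivative `1/(w - t)`.
The computation goes through the squared norm, which is smooth. -/
lemma hasFDerivAt_log_norm_sub {w t : ℂ} (h : w ≠ t) :
    HasFDerivAt (fun w : ℂ => Real.log ‖w - t‖) (reMul (w - t)⁻¹) w := by
  have hne : w - t ≠ 0 := sub_ne_zero.2 h
  have hpos : 0 < ‖w - t‖ := norm_pos_iff.2 hne
  have h1 : HasFDerivAt (fun w : ℂ => ‖w - t‖ ^ 2) _ w :=
    ((hasFDerivAt_id w).sub_const t).norm_sq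
  have h2 := (h1.log (pow_pos hpos 2).ne').const_mul (1 / 2)
  have e : (fun w : ℂ => Real.log ‖w - t‖) = fun w => 1 / 2 * Real.log (‖w - t‖ ^ 2) := by
    ext w
    rw [Real.log_pow]
    push_cast
    ring
  rw [e]
  refine h2.congr_fderiv ?_
  ext v
  simp [reMul_apply, Complex.inner, Complex.inv_re, Complex.inv_im, Complex.normSq_eq_norm_sq]
  field_simp
  ring

lemma measurable_log_norm_sub (w : ℂ) : Measurable fun t : ℝ => Real.log ‖w - (t : ℂ)‖ :=
  Real.measurable_log.comp (by fun_prop)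

lemma integrable_log_norm_sub {M : Measure ℝ} [IsFiniteMeasure M] {L : ℝ}
    (hM : ∀ᵐ t ∂M, |t| ≤ L) {w : ℂ} (hw : w.im ≠ 0) :
    Integrable (fun t : ℝ => Real.log ‖w - (t : ℂ)‖) M := by
  refine Integrable.of_bound (measurable_log_norm_sub w).aestronglyMeasurable
    (abs (Real.log (abs w.im)) + abs (Real.log (‖w‖ + L))) ?_
  filter_upwards [hM] with t ht
  have h0 : 0 < |w.im| := abs_pos.2 hw
  have h1 : |w.im| ≤ ‖w - t‖ := abs_im_le_norm_sub w t
  have h2 : ‖w - t‖ ≤ ‖w‖ + L := by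
    refine (norm_sub_le _ _).trans ?_
    rw [Complex.norm_real, Real.norm_eq_abs]
    linarith
  have h3 := Real.log_le_log h0 h1
  have h4 := Real.log_le_log (h0.trans_le h1) h2
  rw [Real.norm_eq_abs, abs_le]
  constructor
  · linarith [neg_abs_le (Real.log |w.im|), abs_nonneg (Real.log (‖w‖ + L))]
  · linarith [le_abs_self (Real.log (‖w‖ + L)), abs_nonneg (Real.log |w.im|)]

lemma ne_ofReal_of_im_ne_zero {w : ℂ} (hw : w.im ≠ 0) (t : ℝ) : w ≠ t := by
  rintro rfl
  simp at hw

lemma hasFDerivAt_integral_log {M : Measure ℝ} [IsFiniteMeasure M] {L : ℝ}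
    (hM : ∀ᵐ t ∂M, |t| ≤ L) {w : ℂ} (hw : w.im ≠ 0) :
    HasFDerivAt (fun w : ℂ => ∫ t : ℝ, Real.log ‖w - (t : ℂ)‖ ∂M)
      (reMul (cauchyTransform M w)) w := by
  have h0 : 0 < |w.im| := abs_pos.2 hw
  -- On this ball the distance to the axis stays at least `|Im w| / 2`, which gives a constant bound
  -- for differentiation under the integral.
  have him : ∀ w' ∈ Metric.ball w (|w.im| / 2), |w.im| / 2 ≤ |w'.im| := by
    intro w' hw'
    have h1 : ‖w' - w‖ < |w.im| / 2 := by simpa [dist_eq_norm] using hw'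
    have h2 := (Complex.abs_im_le_norm (w' - w)).trans_lt h1
    rw [Complex.sub_im] at h2
    have h3 := abs_sub_abs_le_abs_sub w.im w'.im
    rw [abs_sub_comm] at h2
    linarith
  have key := hasFDerivAt_integral_of_dominated_of_fderiv_le (𝕜 := ℝ) (μ := M)
    (F := fun (w : ℂ) (t : ℝ) => Real.log ‖w - (t : ℂ)‖)
    (F' := fun (w : ℂ) (t : ℝ) => reMul (w - (t : ℂ))⁻¹)
    (bound := fun _ => (|w.im| / 2)⁻¹) (x₀ := w)
    (Metric.ball_mem_nhds w (half_pos h0))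
    (Eventually.of_forall fun w' => (measurable_log_norm_sub w').aestronglyMeasurable)
    (integrable_log_norm_sub hM hw)
    (reMul.continuous.comp_aestronglyMeasurable (integrable_inv_sub M hw).aestronglyMeasurable)
    (ae_of_all _ fun t w' hw' => by
      rw [norm_reMul, norm_inv]
      exact inv_anti₀ (half_pos h0) ((him w' hw').trans (abs_im_le_norm_sub w' t)))
    (integrable_const _)
    (ae_of_all _ fun t w' hw' => hasFDerivAt_log_norm_sub (ne_ofReal_of_im_ne_zero
      (abs_pos.1 ((half_pos h0).trans_le (him w' hw'))) t))
  rwa [reMul.integral_comp_comm (integrable_inv_sub M hw)] at key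

/-- The identification of `ℂ` with the plane. -/
noncomputable def planeEquiv : ℂ ≃ₗᵢ[ℝ] Plane := Complex.orthonormalBasisOneI.repr

lemma planeEquiv_ofReal (t : ℝ) : planeEquiv t = onLine t := by
  ext i
  fin_cases i <;> simp [planeEquiv, onLine, Complex.orthonormalBasisOneI_repr_apply]

lemma norm_planeEquiv_sub_onLine (w : ℂ) (t : ℝ) : ‖planeEquiv w - onLine t‖ = ‖w - t‖ := by
  rw [← planeEquiv_ofReal, ← map_sub, LinearIsometryEquiv.norm_map]

lemma measurable_onLine : Measurable onLine := by
  have : onLine = fun t : ℝ => planeEquiv (t : ℂ) := funext fun t => (planeEquiv_ofReal t).symm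
  rw [this]
  exact planeEquiv.continuous.measurable.comp Complex.measurable_ofReal

lemma blownUpPotential_planeEquiv (m₀ : ℝ → ℝ) (n : ℕ) (x : Fin n → ℝ) (w : ℂ) :
    blownUpPotential m₀ n x (planeEquiv w) =
      -(∑ i, Real.log ‖w - ((n * x i : ℝ) : ℂ)‖ -
        ∫ t : ℝ, Real.log ‖w - (t : ℂ)‖
          ∂(volume.withDensity fun t => ENNReal.ofReal (m₀ (t / n)))) := by
  have h1 : ∫ y, Real.log ‖planeEquiv w - y‖ ∂(∑ i, Measure.dirac (onLine (n * x i))) =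
      ∑ i, Real.log ‖w - ((n * x i : ℝ) : ℂ)‖ := by
    rw [integral_finsetSum_measure fun i _ => integrable_dirac (by simp)]
    simp only [integral_dirac, norm_planeEquiv_sub_onLine]
  have h2 : ∫ y, Real.log ‖planeEquiv w - y‖ ∂(lineMeasure fun t => m₀ (t / n)) =
      ∫ t : ℝ, Real.log ‖w - (t : ℂ)‖
          ∂(volume.withDensity fun t => ENNReal.ofReal (m₀ (t / n))) := by
    have hm : Measurable fun y : Plane => Real.log ‖planeEquiv w - y‖ :=
      Real.measurable_log.comp (by fun_prop)
    rw [lineMeasure, integral_map measurable_onLine.aemeasurable hm.aestronglyMeasurable]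
    simp only [norm_planeEquiv_sub_onLine]
  rw [blownUpPotential, invLaplacian, invLaplacian, h1, h2]
  field_simp

/-- The multiplicity of the charge at `p`. -/
noncomputable def multiplicity {n : ℕ} (y : Fin n → ℝ) (p : ℝ) : ℝ :=
  (Finset.univ.filter fun i => y i = p).card

lemma sum_eq_sum_multiplicity {n : ℕ} (y : Fin n → ℝ) (f : ℝ → ℂ) :
    ∑ i, f (y i) = ∑ p ∈ Finset.univ.image y, (multiplicity y p : ℂ) * f p := by
  rw [Finset.sum_comp]
  simp [multiplicity]

/-- Off the axis the differential is `v ↦ -Re (E v)`, with `E` the complex field, and has norm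
`|E|`; the isometry with the plane preserves norms. -/
lemma norm_gradient_blownUpPotential {m₀ : ℝ → ℝ} {n : ℕ} (x : Fin n → ℝ) {M : Measure ℝ}
    (hMdef : M = volume.withDensity fun t => ENNReal.ofReal (m₀ (t / n))) [IsFiniteMeasure M]
    {L : ℝ} (hM : ∀ᵐ t ∂M, |t| ≤ L) {w : ℂ} (hw : w.im ≠ 0) :
    ‖gradient (blownUpPotential m₀ n x) (planeEquiv w)‖ =
      ‖chargeField (Finset.univ.image fun i => (n : ℝ) * x i)
        (multiplicity fun i => (n : ℝ) * x i) M w‖ := by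
  have h1 : HasFDerivAt (blownUpPotential m₀ n x ∘ planeEquiv)
      (-(∑ i, reMul (w - ((n * x i : ℝ) : ℂ))⁻¹ - reMul (cauchyTransform M w))) w := by
    have h2 := (HasFDerivAt.fun_sum (u := Finset.univ) fun i _ => hasFDerivAt_log_norm_sub
      (ne_ofReal_of_im_ne_zero hw (n * x i))).sub (hasFDerivAt_integral_log hM hw)
    refine h2.neg.congr_of_eventuallyEq (Eventually.of_forall fun w' => ?_)
    rw [Function.comp_apply, blownUpPotential_planeEquiv, ← hMdef]
    rfl
  have h3 := h1.fderiv
  have h4 : fderiv ℝ (blownUpPotential m₀ n x ∘ planeEquiv) w =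
      (fderiv ℝ (blownUpPotential m₀ n x) (planeEquiv w)).comp
        (planeEquiv.toContinuousLinearEquiv : ℂ →L[ℝ] Plane) :=
    planeEquiv.toContinuousLinearEquiv.comp_right_fderiv
  have h5 : ‖fderiv ℝ (blownUpPotential m₀ n x) (planeEquiv w)‖ =
      ‖fderiv ℝ (blownUpPotential m₀ n x ∘ planeEquiv) w‖ := by
    rw [h4]
    exact (ContinuousLinearMap.opNorm_comp_linearIsometryEquiv _ planeEquiv).symm
  rw [gradient, LinearIsometryEquiv.norm_map, h5, h3, norm_neg, ← map_sum, ← map_sub, norm_reMul,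
    chargeField, sum_eq_sum_multiplicity (fun i => (n : ℝ) * x i) fun p => (w - (p : ℂ))⁻¹]

/-- Integrability makes the extended integral an ordinary one. The field carries multiplicities,
while the counterterm counts distinct points only. -/
lemma truncatedEnergy_blownUpPotential {m₀ : ℝ → ℝ} {n : ℕ} (x : Fin n → ℝ) {M : Measure ℝ}
    (hMdef : M = volume.withDensity fun t => ENNReal.ofReal (m₀ (t / n))) [IsFiniteMeasure M]
    {C : NNReal} {L : ℝ} (h : BoundedDensity M C L) (hL : 0 < L) (hx : ∀ i, |(n : ℝ) * x i| ≤ L)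
    (hneutral : M.real Set.univ = n) {η : ℝ} (hη : 0 < η) :
    truncatedEnergy (gradient (blownUpPotential m₀ n x))
      (Finset.univ.image fun i => (n : ℝ) * x i) (fun _ => 1) η =
      ((1 / 2 * (∫ z in outerDomain (Finset.univ.image fun i => (n : ℝ) * x i) η,
        ‖chargeField (Finset.univ.image fun i => (n : ℝ) * x i)
          (multiplicity fun i => (n : ℝ) * x i) M z‖ ^ 2) +
        Real.pi * Real.log η * (Finset.univ.image fun i => (n : ℝ) * x i).card : ℝ) : EReal) := by
  set y : Fin n → ℝ := fun i => (n : ℝ) * x i with hy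
  set Λ := Finset.univ.image y with hΛ
  have hΛL : ∀ p ∈ Λ, |p| ≤ L := by
    intro p hp
    obtain ⟨i, -, rfl⟩ := Finset.mem_image.1 hp
    exact hx i
  have hmult : M.real Set.univ = ∑ p ∈ Λ, multiplicity y p := by
    have := sum_eq_sum_multiplicity y fun _ => 1
    simp only [mul_one, Finset.sum_const, Finset.card_univ, Fintype.card_fin, nsmul_eq_mul] at this
    rw [hneutral]
    exact_mod_cast this
  have hint := integrableOn_outerDomain_sq_norm_chargeField h hL
    (k := multiplicity y) (fun p => Nat.cast_nonneg _) hΛL hmult hη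
  have hpre : planeEquiv ⁻¹' (⋃ p ∈ Λ, Metric.ball (onLine p) η)ᶜ = outerDomain Λ η := by
    ext z
    rw [mem_outerDomain]
    simp [dist_eq_norm, norm_planeEquiv_sub_onLine]
  have hemb : MeasurableEmbedding planeEquiv :=
    planeEquiv.toHomeomorph.measurableEmbedding
  have hae : (fun z => ‖chargeField Λ (multiplicity y) M z‖ ^ 2) =ᵐ[volume.restrict (outerDomain Λ η)]
      fun z => (1 : ℝ) * ‖gradient (blownUpPotential m₀ n x) (planeEquiv z)‖ ^ 2 := by
    refine ae_restrict_of_ae (ae_im_ne_zero.mono fun z hz => ?_)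
    simp only
    rw [norm_gradient_blownUpPotential x hMdef h.bdd hz, one_mul]
  have hint' : IntegrableOn (fun z => (1 : ℝ) * ‖gradient (blownUpPotential m₀ n x) z‖ ^ 2)
      (⋃ p ∈ Λ, Metric.ball (onLine p) η)ᶜ := by
    rw [← planeEquiv.measurePreserving.integrableOn_comp_preimage hemb, hpre]
    exact hint.congr hae
  rw [truncatedEnergy, eintegral_eq_coe hint' (ae_eq_refl _),
    ← planeEquiv.measurePreserving.setIntegral_preimage_emb hemb, hpre, ← integral_congr_ae hae,
    ← EReal.coe_mul, ← EReal.coe_add]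
  simp

/-! ### Measures with a bounded continuous density -/

lemma boundedDensity_withDensity {m : ℝ → ℝ} {mbar L : ℝ} (hle : ∀ x, m x ≤ mbar)
    (hL : ∀ᵐ t ∂volume.withDensity (fun x => ENNReal.ofReal (m x)), |t| ≤ L) :
    BoundedDensity (volume.withDensity fun x => ENNReal.ofReal (m x)) mbar.toNNReal L := by
  refine ⟨?_, hL⟩
  have h : (mbar.toNNReal : NNReal) • (volume : Measure ℝ) =
      volume.withDensity fun _ => ENNReal.ofReal mbar := by
    rw [withDensity_const]; rfl
  rw [h]
  exact withDensity_mono (ae_of_all _ fun x => ENNReal.ofReal_le_ofReal (hle x))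

/-- The density vanishes a.e. on the open complement of the support, hence everywhere there by
continuity. -/
lemma eq_zero_of_notMem_support {m : ℝ → ℝ} (hm : Continuous m) (h0 : ∀ x, 0 ≤ m x) {x : ℝ}
    (hx : x ∉ (volume.withDensity fun x => ENNReal.ofReal (m x)).support) : m x = 0 := by
  set μ := volume.withDensity fun x => ENNReal.ofReal (m x) with hμ
  have hmeas : Measurable fun x => ENNReal.ofReal (m x) := hm.measurable.ennreal_ofReal
  have hnull : ∫⁻ x in μ.supportᶜ, ENNReal.ofReal (m x) = 0 := by
    rw [← withDensity_apply _ Measure.isOpen_compl_support.measurableSet]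
    exact Measure.measure_compl_support
  rw [lintegral_eq_zero_iff hmeas] at hnull
  have hae : m =ᵐ[volume.restrict μ.supportᶜ] fun _ => 0 := by
    filter_upwards [hnull] with y hy
    exact le_antisymm (ENNReal.ofReal_eq_zero.1 hy) (h0 y)
  exact Measure.eqOn_open_of_ae_eq hae Measure.isOpen_compl_support hm.continuousOn
    continuousOn_const hx

/-- Up to sign, the potential is the convolution of the locally integrable `log` with a continuous
compactly supported density. -/
lemma continuous_logPotential {m : ℝ → ℝ} (hm : Continuous m) (h0 : ∀ x, 0 ≤ m x)
    (hc : HasCompactSupport m) :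
    Continuous (logPotential (volume.withDensity fun x => ENNReal.ofReal (m x))) := by
  have hlog : LocallyIntegrable Real.log volume := by
    rw [locallyIntegrable_iff]
    intro K hK
    obtain ⟨R, hR⟩ := hK.isBounded.subset_closedBall 0
    refine IntegrableOn.mono_set ?_ hR
    rw [Real.closedBall_eq_Icc, integrableOn_Icc_iff_integrableOn_Ioc]
    exact intervalIntegral.intervalIntegrable_log'.1
  have h := hc.continuous_convolution_right (ContinuousLinearMap.mul ℝ ℝ) hlog hm
  refine h.neg.congr fun x => ?_
  rw [logPotential, Pi.neg_apply, convolution_def, integral_withDensity_eq_integral_toReal_smul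
    hm.measurable.ennreal_ofReal (ae_of_all _ fun _ => ENNReal.ofReal_lt_top),
    ← integral_sub_left_eq_self _ volume x]
  congr 1
  refine integral_congr_ae (ae_of_all _ fun y => ?_)
  simp [ENNReal.toReal_ofReal (h0 _), Real.log_abs, mul_comm]

/-! ### Dilations -/

lemma withDensity_dilation {m : ℝ → ℝ} (hm : Measurable m) {n : ℕ} (hn : 1 ≤ n) :
    (volume.withDensity fun t => ENNReal.ofReal (m (t / n))) =
      (n : ENNReal) • (volume.withDensity fun x => ENNReal.ofReal (m x)).map fun s => (n : ℝ) * s := by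
  have hn0 : (0 : ℝ) < n := by exact_mod_cast hn
  ext s hs
  have hmul : Measurable fun s : ℝ => (n : ℝ) * s := by fun_prop
  have hg : Measurable fun t => s.indicator (fun t => ENNReal.ofReal (m (t / n))) t :=
    ((hm.comp (by fun_prop)).ennreal_ofReal).indicator hs
  have h1 := lintegral_map (μ := (volume : Measure ℝ)) hg hmul
  rw [Real.map_volume_mul_left hn0.ne', lintegral_smul_measure, lintegral_indicator hs] at h1
  have e : ∀ u : ℝ, s.indicator (fun t => ENNReal.ofReal (m (t / n))) ((n : ℝ) * u) =
      ((fun s : ℝ => (n : ℝ) * s) ⁻¹' s).indicator (fun x => ENNReal.ofReal (m x)) u := by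
    intro u
    by_cases hu : (n : ℝ) * u ∈ s
    · rw [Set.indicator_of_mem hu,
        Set.indicator_of_mem (show u ∈ (fun s : ℝ => (n : ℝ) * s) ⁻¹' s from hu),
        mul_div_cancel_left₀ u hn0.ne']
    · rw [Set.indicator_of_notMem hu,
        Set.indicator_of_notMem (show u ∉ (fun s : ℝ => (n : ℝ) * s) ⁻¹' s from hu)]
  simp only [e] at h1
  rw [lintegral_indicator (hmul hs)] at h1
  rw [Measure.smul_apply, Measure.map_apply hmul hs, withDensity_apply _ hs,
    withDensity_apply _ (hmul hs), ← h1, smul_eq_mul, smul_eq_mul, ← mul_assoc,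
    abs_of_pos (inv_pos.2 hn0), ENNReal.ofReal_inv_of_pos hn0, ENNReal.ofReal_natCast,
    ENNReal.mul_inv_cancel (by exact_mod_cast (by omega : n ≠ 0)) (ENNReal.natCast_ne_top n),
    one_mul]

section Dilation

variable {μ : Measure ℝ} {n : ℕ} (hn : 1 ≤ n) {M : Measure ℝ}
  (hM : M = (n : ENNReal) • μ.map fun s => (n : ℝ) * s)

include hM in
lemma isFiniteMeasure_dilation [IsProbabilityMeasure μ] : IsFiniteMeasure M := by
  have : IsProbabilityMeasure (μ.map fun s => (n : ℝ) * s) :=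
    Measure.isProbabilityMeasure_map (by fun_prop)
  rw [hM]
  exact Measure.smul_finite _ (ENNReal.natCast_ne_top n)

include hM in
lemma integral_dilation {f : ℝ → ℝ} (hf : Measurable f) :
    ∫ t, f t ∂M = n * ∫ s, f (n * s) ∂μ := by
  rw [hM, integral_smul_measure, integral_map (by fun_prop) hf.aestronglyMeasurable]
  simp

include hM in
lemma real_univ_dilation [IsProbabilityMeasure μ] : M.real Set.univ = n := by
  have := isFiniteMeasure_dilation hM
  have h := integral_dilation hM (f := fun _ => 1) measurable_const
  simpa using h

include hM in
lemma ae_abs_le_dilation {L : ℝ} (h : ∀ᵐ t ∂μ, |t| ≤ L) : ∀ᵐ t ∂M, |t| ≤ n * L := by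
  rw [hM]
  refine Measure.ae_smul_measure ?_ _
  rw [ae_map_iff (by fun_prop) (measurableSet_le (by fun_prop) measurable_const)]
  filter_upwards [h] with t ht
  rw [abs_mul, Nat.abs_cast]
  gcongr

include hn hM in
-- `log |n x - n s| = log n + log |x - s|` except at `s = x`, which carries no mass.
lemma logPotential_dilation [IsProbabilityMeasure μ] {C : NNReal} {L : ℝ} (h : BoundedDensity μ C L) (x : ℝ) :
    logPotential M (n * x) = n * (logPotential μ x - Real.log n) := by
  have hn0 : (0 : ℝ) < n := by exact_mod_cast hn
  have hm : Measurable fun t : ℝ => Real.log |n * x - t| := Real.measurable_log.comp (by fun_prop)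
  rw [logPotential, integral_dilation hM hm]
  have hna := h.noAtoms
  have hne : ∀ᵐ s ∂μ, s ∉ ({x} : Set ℝ) := measure_eq_zero_iff_ae_notMem.1 (measure_singleton x)
  have e : ∫ s, Real.log |n * x - n * s| ∂μ = ∫ s, (Real.log n + Real.log |x - s|) ∂μ := by
    refine integral_congr_ae ?_
    filter_upwards [hne] with s hs
    have : 0 < |x - s| := abs_pos.2 (sub_ne_zero.2 fun e => hs e.symm)
    rw [← mul_sub, abs_mul, Nat.abs_cast, Real.log_mul hn0.ne' this.ne']
  rw [e, integral_add (integrable_const _) (h.integrable_log x), integral_const, probReal_univ,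
    one_smul, logPotential]
  ring

include hn hM in
lemma mutualEnergy_dilation [IsProbabilityMeasure μ] {C : NNReal} {L : ℝ} (h : BoundedDensity μ C L)
    (hMM : HasMutualEnergy M M) :
    mutualEnergy M M = n ^ 2 * (mutualEnergy μ μ - Real.log n) := by
  have := isFiniteMeasure_dilation hM
  have hμμ := h.hasMutualEnergy h.bdd
  have hmeas : Measurable (logPotential M) := by
    have : StronglyMeasurable fun x => ∫ y, Real.log |x - y| ∂M :=
      measurable_log_abs_sub.stronglyMeasurable.integral_prod_right
    exact this.measurable.neg
  rw [mutualEnergy_eq_integral_logPotential hMM, integral_dilation hM hmeas]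
  simp only [logPotential_dilation hn hM h]
  rw [integral_const_mul, integral_sub hμμ.integrable_logPotential (integrable_const _),
    ← mutualEnergy_eq_integral_logPotential hμμ, integral_const, probReal_univ, one_smul]
  ring

end Dilation

/-! ### The Hamiltonian -/

lemma sum_ne_bot {ι : Type*} (s : Finset ι) {f : ι → EReal} (h : ∀ i ∈ s, f i ≠ ⊥) :
    ∑ i ∈ s, f i ≠ ⊥ := by
  classical
  induction s using Finset.induction_on with
  | empty => simp
  | insert a s ha ih =>
    rw [Finset.sum_insert ha, Ne, EReal.add_eq_bot_iff, not_or]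
    exact ⟨h a (Finset.mem_insert_self _ _), ih fun i hi => h i (Finset.mem_insert_of_mem hi)⟩

lemma sum_eq_top {ι : Type*} {s : Finset ι} {f : ι → EReal} (h : ∀ i ∈ s, f i ≠ ⊥) {i : ι}
    (hi : i ∈ s) (hf : f i = ⊤) : ∑ i ∈ s, f i = ⊤ := by
  classical
  rw [← Finset.add_sum_erase _ _ hi, hf]
  exact EReal.top_add_of_ne_bot (sum_ne_bot _ fun j hj => h j (Finset.mem_of_mem_erase hj))

lemma coe_sum {ι : Type*} (s : Finset ι) (f : ι → ℝ) :
    ∑ i ∈ s, (f i : EReal) = ((∑ i ∈ s, f i : ℝ) : EReal) :=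
  (map_sum (⟨⟨fun x : ℝ => (x : EReal), EReal.coe_zero⟩, EReal.coe_add⟩ : ℝ →+ EReal) f s).symm

lemma hamiltonian_eq_top (V : ℝ → ℝ) {n : ℕ} {x : Fin n → ℝ} (hx : ¬ Function.Injective x) :
    hamiltonian V n x = ⊤ := by
  simp only [Function.Injective, not_forall] at hx
  obtain ⟨i, j, hij, hne⟩ := hx
  have hb : ∀ i : Fin n, ∀ j ∈ Finset.univ.erase i, logKernel (x i) (x j) ≠ ⊥ :=
    fun i j _ => logKernel_ne_bot _ _
  rw [hamiltonian, sum_eq_top (fun i _ => sum_ne_bot _ (hb i)) (Finset.mem_univ i)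
    (sum_eq_top (hb i) (Finset.mem_erase.2 ⟨fun e => hne e.symm, Finset.mem_univ j⟩) (by
      rw [hij, logKernel_self]))]
  exact EReal.top_add_coe _

lemma hamiltonian_eq_coe (V : ℝ → ℝ) {n : ℕ} {x : Fin n → ℝ} (hx : Function.Injective x) :
    hamiltonian V n x =
      ((-∑ i, ∑ j ∈ Finset.univ.erase i, Real.log |x i - x j| + n * ∑ i, V (x i) : ℝ) : EReal) := by
  have e : ∀ i, ∑ j ∈ Finset.univ.erase i, logKernel (x i) (x j) =
      ((∑ j ∈ Finset.univ.erase i, -Real.log |x i - x j| : ℝ) : EReal) := by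
    intro i
    rw [← coe_sum]
    refine Finset.sum_congr rfl fun j hj => ?_
    exact logKernel_of_ne fun h => Finset.ne_of_mem_erase hj (hx h).symm
  rw [hamiltonian, Finset.sum_congr rfl fun i _ => e i, coe_sum, ← EReal.coe_add]
  simp only [Finset.sum_neg_distrib]

/-! ### The splitting formula -/

lemma multiplicity_of_injective {n : ℕ} {y : Fin n → ℝ} (hy : Function.Injective y) {p : ℝ}
    (hp : p ∈ Finset.univ.image y) : multiplicity y p = 1 := by
  obtain ⟨i, -, rfl⟩ := Finset.mem_image.1 hp
  have : (Finset.univ.filter fun j => y j = y i) = {i} := by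
    ext j
    simp [hy.eq_iff]
  simp [multiplicity, this]

lemma chargeField_congr {Λ : Finset ℝ} {k k' : ℝ → ℝ} (h : ∀ p ∈ Λ, k p = k' p) (M : Measure ℝ) :
    chargeField Λ k M = chargeField Λ k' M := by
  ext z
  rw [chargeField, chargeField, Finset.sum_congr rfl fun p hp => by rw [h p hp]]

lemma sum_multiplicity {n : ℕ} (y : Fin n → ℝ) :
    ∑ p ∈ Finset.univ.image y, multiplicity y p = n := by
  have := sum_eq_sum_multiplicity y fun _ => 1
  simp only [mul_one, Finset.sum_const, Finset.card_univ, Fintype.card_fin, nsmul_eq_mul] at this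
  exact_mod_cast this.symm

lemma one_le_multiplicity {n : ℕ} {y : Fin n → ℝ} {p : ℝ} (hp : p ∈ Finset.univ.image y) :
    1 ≤ multiplicity y p := by
  obtain ⟨i, -, rfl⟩ := Finset.mem_image.1 hp
  rw [multiplicity, Nat.one_le_cast, Nat.one_le_iff_ne_zero, Finset.card_ne_zero]
  exact ⟨i, by simp⟩

/-- If two charges coincide, the sum of the squares of the charges exceeds their number. -/
lemma card_lt_sum_sq_multiplicity {n : ℕ} {y : Fin n → ℝ} (hy : ¬ Function.Injective y) :
    ((Finset.univ.image y).card : ℝ) < ∑ p ∈ Finset.univ.image y, multiplicity y p ^ 2 := by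
  have h1 : ((Finset.univ.image y).card : ℝ) < n := by
    have h2 : (Finset.univ.image y).card ≤ n := Finset.card_image_le.trans (by simp)
    refine Nat.cast_lt.2 (lt_of_le_of_ne h2 fun e => hy ?_)
    have : (Finset.univ.image y).card = (Finset.univ : Finset (Fin n)).card := by simpa using e
    simpa using Finset.card_image_iff.1 this
  refine h1.trans_le ?_
  rw [← sum_multiplicity y]
  refine Finset.sum_le_sum fun p hp => ?_
  have := one_le_multiplicity hp
  nlinarith

/-- Each of the `n (n - 1)` ordered pairs contributes one `log n`. -/
lemma sum_log_dilation {n : ℕ} (hn : 1 ≤ n) {x : Fin n → ℝ} (hx : Function.Injective x) :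
    ∑ p ∈ Finset.univ.image (fun i => (n : ℝ) * x i),
      ∑ q ∈ (Finset.univ.image fun i => (n : ℝ) * x i).erase p, Real.log |p - q| =
    n * (n - 1) * Real.log n + ∑ i, ∑ j ∈ Finset.univ.erase i, Real.log |x i - x j| := by
  have hn0 : (0 : ℝ) < n := by exact_mod_cast hn
  have hy : Function.Injective fun i => (n : ℝ) * x i := fun i j h =>
    hx (mul_left_cancel₀ hn0.ne' h)
  have e : ∀ i : Fin n, ∑ j ∈ Finset.univ.erase i, Real.log |n * x i - n * x j| =
      (n - 1) * Real.log n + ∑ j ∈ Finset.univ.erase i, Real.log |x i - x j| := by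
    intro i
    have hc : ((Finset.univ.erase i).card : ℝ) = n - 1 := by
      rw [Finset.card_erase_of_mem (Finset.mem_univ i), Finset.card_univ, Fintype.card_fin,
        Nat.cast_sub hn, Nat.cast_one]
    rw [← hc, ← nsmul_eq_mul (Finset.univ.erase i).card, ← Finset.sum_const, ← Finset.sum_add_distrib]
    refine Finset.sum_congr rfl fun j hj => ?_
    have : 0 < |x i - x j| := abs_pos.2 (sub_ne_zero.2 fun h => Finset.ne_of_mem_erase hj (hx h).symm)
    rw [← mul_sub, abs_mul, Nat.abs_cast, Real.log_mul hn0.ne' this.ne']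
  rw [Finset.sum_image hy.injOn]
  simp only [← Finset.image_erase hy, Finset.sum_image hy.injOn]
  rw [Finset.sum_congr rfl fun i _ => e i, Finset.sum_add_distrib, Finset.sum_const,
    Finset.card_univ, Fintype.card_fin, nsmul_eq_mul, mul_assoc]

section Splitting

variable {m₀ : ℝ → ℝ} {n : ℕ} {M : Measure ℝ} [IsFiniteMeasure M]
  (hMdef : M = volume.withDensity fun t => ENNReal.ofReal (m₀ (t / n))) {C : NNReal} {L : ℝ}
  (h : BoundedDensity M C L) (hL : 0 < L) (hneutral : M.real Set.univ = n) (x : Fin n → ℝ)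
  (hx : ∀ i, |(n : ℝ) * x i| ≤ L)

include hMdef h hL hneutral hx

lemma hasRenormalizedEnergy_of_not_injective (hy : ¬ Function.Injective fun i => (n : ℝ) * x i) :
    HasRenormalizedEnergy (gradient (blownUpPotential m₀ n x))
      (Finset.univ.image fun i => (n : ℝ) * x i) (fun _ => 1) ⊤ := by
  obtain ⟨R, hR, hlim⟩ := exists_tendsto_truncated h hL
    (Λ := Finset.univ.image fun i => (n : ℝ) * x i) (k := multiplicity fun i => (n : ℝ) * x i)
    (fun p => Nat.cast_nonneg _) (fun p hp => by
      obtain ⟨i, -, rfl⟩ := Finset.mem_image.1 hp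
      exact hx i) (by rw [sum_multiplicity, hneutral])
  -- The truncated energy is a convergent quantity plus `π (#Λ - ∑ k_p²) log η`. The coefficient is
  -- negative, so this tends to `+∞`.
  have hpos := sub_neg.2 (card_lt_sum_sq_multiplicity hy)
  have htop := (Real.tendsto_log_nhdsGT_zero.const_mul_atBot_of_neg
    (mul_neg_of_pos_of_neg Real.pi_pos hpos))
  have hsum := hlim.add_atTop htop
  refine (EReal.tendsto_coe_nhds_top_iff.2 hsum).congr' ?_
  filter_upwards [self_mem_nhdsWithin] with η hη
  rw [truncatedEnergy_blownUpPotential x hMdef h hL hx hneutral hη]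
  congr 1
  ring

lemma hasRenormalizedEnergy_of_injective (hy : Function.Injective fun i => (n : ℝ) * x i) :
    HasRenormalizedEnergy (gradient (blownUpPotential m₀ n x))
      (Finset.univ.image fun i => (n : ℝ) * x i) (fun _ => 1)
      ((Real.pi * (-∑ p ∈ Finset.univ.image (fun i => (n : ℝ) * x i),
        ∑ q ∈ (Finset.univ.image fun i => (n : ℝ) * x i).erase p, Real.log |p - q| -
        2 * ∑ i, logPotential M (n * x i) + mutualEnergy M M) : ℝ) : EReal) := by
  have hcard : ((Finset.univ.image fun i => (n : ℝ) * x i).card : ℝ) = n := by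
    rw [Finset.card_image_of_injective _ hy, Finset.card_univ, Fintype.card_fin]
  have hΛ : ∀ p ∈ Finset.univ.image fun i => (n : ℝ) * x i, |p| ≤ L := fun p hp => by
    obtain ⟨i, -, rfl⟩ := Finset.mem_image.1 hp
    exact hx i
  obtain ⟨R, hR, hlim⟩ := exists_tendsto_truncated h hL (k := fun _ => 1)
    (fun _ => zero_le_one) hΛ (by simpa [hcard] using hneutral)
  simp only [one_pow, Finset.sum_const, nsmul_eq_mul, mul_one] at hlim
  rw [integral_regularDensity_one h hL hΛ (hneutral.trans hcard.symm) hR,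
    ← chargeField_congr fun p hp => multiplicity_of_injective hy hp] at hlim
  rw [← Finset.sum_image (f := fun p => logPotential M p) hy.injOn]
  refine (EReal.tendsto_coe.2 hlim).congr' ?_
  filter_upwards [self_mem_nhdsWithin] with η hη
  rw [truncatedEnergy_blownUpPotential x hMdef h hL hx hneutral hη]
  congr 1
  ring

end Splitting

end LogGas

theorem mainTheorem6 (V m₀ : ℝ → ℝ) (μ₀ : Measure ℝ)
    (hV_lsc : LowerSemicontinuous V)
    (hV_growth : Tendsto (fun x : ℝ => V x / 2 - Real.log |x|) (cocompact ℝ) atTop)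
    (hμ₀ : LogGas.IsEquilibriumMeasure V μ₀)
    (hm₀ : μ₀ = volume.withDensity (fun x => ENNReal.ofReal (m₀ x)))
    (hsupp : ∃ (M : ℕ) (a b : Fin M → ℝ), (∀ k, a k ≤ b k) ∧
      μ₀.support = ⋃ k, Set.Icc (a k) (b k))
    (hm₀_bounds : ∃ γ mbar : ℝ, 0 < γ ∧ 0 < mbar ∧ ∀ x : ℝ,
      γ * Real.sqrt (Metric.infDist x (μ₀.support)ᶜ) ≤ m₀ x ∧ m₀ x ≤ mbar)
    (hm₀_holder : ∃ C : NNReal, HolderWith C (1 / 2) m₀)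
    (hV_int : ∃ β₁ : ℝ, 0 < β₁ ∧
      IntegrableOn (fun x : ℝ => Real.exp (-β₁ * (V x / 2 - Real.log |x|)))
        (Set.Icc (-1) 1)ᶜ) :
    (∃! c : ℝ, LogGas.IsEquilibriumConstant V μ₀ c) ∧
    ∀ c : ℝ, LogGas.IsEquilibriumConstant V μ₀ c →
      ∀ (n : ℕ), 1 ≤ n → ∀ x : Fin n → ℝ,
        ∃ W : EReal,
          LogGas.HasRenormalizedEnergy (gradient (LogGas.blownUpPotential m₀ n x))
            (Finset.univ.image (fun i => (n : ℝ) * x i)) (fun _ => 1) W ∧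
          LogGas.hamiltonian V n x =
            (((n : ℝ) ^ 2 : ℝ) : EReal) * LogGas.meanFieldEnergy V μ₀
              - ((n * Real.log n : ℝ) : EReal)
              + ((1 / Real.pi : ℝ) : EReal) * W
              + ((2 * n * ∑ i, LogGas.zeta V μ₀ c (x i) : ℝ) : EReal) := by
  have hprob := hμ₀.1
  obtain ⟨γ, mbar, hγ, hmbar, hbounds⟩ := hm₀_bounds
  have h0 : ∀ x, 0 ≤ m₀ x := fun x =>
    (mul_nonneg hγ.le (Real.sqrt_nonneg _)).trans (hbounds x).1
  have hcont : Continuous m₀ := by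
    obtain ⟨C, hC⟩ := hm₀_holder
    exact hC.continuous (by norm_num)
  have hcompact : IsCompact μ₀.support := by
    obtain ⟨N, a, b, -, h⟩ := hsupp
    rw [h]
    exact isCompact_iUnion fun k => isCompact_Icc
  have hcs : HasCompactSupport m₀ := HasCompactSupport.intro hcompact fun x hx => by
    rw [hm₀] at hx
    exact LogGas.eq_zero_of_notMem_support hcont h0 hx
  obtain ⟨L₀, hL₀⟩ := hcompact.isBounded.subset_closedBall 0
  have hbdd : ∀ᵐ t ∂μ₀, |t| ≤ L₀ := by
    have : ∀ᵐ t ∂μ₀, t ∈ μ₀.support := Measure.support_mem_ae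
    filter_upwards [this] with t ht
    simpa using hL₀ ht
  have hb : LogGas.BoundedDensity μ₀ mbar.toNNReal L₀ := by
    rw [hm₀] at hbdd ⊢
    exact LogGas.boundedDensity_withDensity (fun x => (hbounds x).2) hbdd
  have hU : Continuous (LogGas.logPotential μ₀) := by
    rw [hm₀]
    exact LogGas.continuous_logPotential hcont h0 hcs
  have huniq : ∀ c, LogGas.IsEquilibriumConstant V μ₀ c → c = LogGas.robinConstant V μ₀ :=
    fun c hc => LogGas.IsEquilibriumConstant.eq_robinConstant hV_lsc hμ₀ hb hU hc
  refine ⟨⟨_, LogGas.isEquilibriumConstant_robinConstant hV_lsc hμ₀ hb hU, huniq⟩, ?_⟩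
  intro c hc n hn x
  have hn0 : (0 : ℝ) < n := by exact_mod_cast hn
  have hF := LogGas.meanFieldEnergy_eq_coe (hb.hasMutualEnergy hb.bdd)
    (hμ₀.integrable_potential hV_lsc hbdd)
  set M : Measure ℝ := volume.withDensity fun t => ENNReal.ofReal (m₀ (t / n)) with hMdef
  have hM : M = (n : ENNReal) • μ₀.map fun s => (n : ℝ) * s := by
    rw [hMdef, hm₀]
    exact LogGas.withDensity_dilation hcont.measurable hn
  have hMfin : IsFiniteMeasure M := LogGas.isFiniteMeasure_dilation hM
  -- A common bound for the blown-up background and all blown-up points; the `+ 1` makes it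
  -- positive.
  set L : ℝ := n * |L₀| + ∑ i, |(n : ℝ) * x i| + 1 with hLdef
  have hsum : 0 ≤ ∑ i, |(n : ℝ) * x i| := Finset.sum_nonneg fun _ _ => abs_nonneg _
  have hL : 0 < L := by positivity
  have hx : ∀ i, |(n : ℝ) * x i| ≤ L := by
    intro i
    have h1 := Finset.single_le_sum (f := fun i => |(n : ℝ) * x i|) (fun _ _ => abs_nonneg _)
      (Finset.mem_univ i)
    have h2 : 0 ≤ n * |L₀| := by positivity
    linarith
  have hMbdd : ∀ᵐ t ∂M, |t| ≤ L := by
    filter_upwards [LogGas.ae_abs_le_dilation hM hbdd] with t ht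
    have : n * L₀ ≤ n * |L₀| := by gcongr; exact le_abs_self _
    linarith
  have hMb : LogGas.BoundedDensity M mbar.toNNReal L :=
    LogGas.boundedDensity_withDensity (fun x => (hbounds _).2) hMbdd
  have hneutral : M.real Set.univ = n := LogGas.real_univ_dilation hM
  by_cases hinj : Function.Injective x
  · have hy : Function.Injective fun i => (n : ℝ) * x i := fun i j h =>
      hinj (mul_left_cancel₀ hn0.ne' h)
    refine ⟨_, LogGas.hasRenormalizedEnergy_of_injective hMdef hMb hL hneutral x hx hy, ?_⟩
    -- The `log n` terms in `W / π` add up to `-n (n - 1) + 2 n² - n² = n`, which cancels `-n log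
    -- n`. The potentials `U^{μ₀}(x_i)` cancel against `ζ`, and `2 c = 2 I(μ₀) + ∫ V dμ₀` absorbs
    -- the remaining multiples of `n²`.
    rw [LogGas.hamiltonian_eq_coe V hinj, hF, ← EReal.coe_mul, ← EReal.coe_mul, ← EReal.coe_sub,
      ← EReal.coe_add, ← EReal.coe_add, EReal.coe_eq_coe_iff, LogGas.sum_log_dilation hn hinj,
      LogGas.mutualEnergy_dilation hn hM hb (hMb.hasMutualEnergy hMbdd)]
    simp only [LogGas.logPotential_dilation hn hM hb, LogGas.zeta, huniq c hc,
      LogGas.robinConstant, Finset.sum_sub_distrib, Finset.sum_add_distrib, ← Finset.mul_sum,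
      ← Finset.sum_div, Finset.sum_const, Finset.card_univ, Fintype.card_fin, nsmul_eq_mul]
    field_simp
    ring
  · have hy : ¬ Function.Injective fun i => (n : ℝ) * x i := fun h =>
      hinj fun i j hij => h (by simp only [hij])
    refine ⟨⊤, LogGas.hasRenormalizedEnergy_of_not_injective hMdef hMb hL hneutral x hx hy, ?_⟩
    rw [LogGas.hamiltonian_eq_top V hinj, hF, EReal.coe_mul_top_of_pos (by positivity),
      ← EReal.coe_mul, ← EReal.coe_sub, EReal.coe_add_top, EReal.top_add_coe]
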